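/- Let $M$ be a smooth manifold of dimension $2n+1$ (Hausdorff, second countable, without boundary) with a contact form $\alpha$ and Reeb field $R$ (so $\alpha(R)=1$, $i_R\,d\alpha=0$), and put $\xi=\ker\alpha$. Let $J$ be a smooth complex structure on $\xi$ such that $d\alpha(J\cdot,J\cdot)=d\alpha$ and $d\alpha(\cdot,J\cdot)$ is positive definite on $\xi$, extended to an $\mathbb R$-invariant almost complex structure on $\mathbb R\times M$ by $J\frac{\partial}{\partial t}=R$. Let $G$ be the metric on $\mathbb R\times M$ for which $\frac{\partial}{\partial t}$ and $R$ are orthonormal and orthogonal to $\xi$, and which equals $d\alpha(\cdot,J\cdot)$ on $\xi$. Let $T_0>0$ be smaller than the period of every closed Reeb orbit in $M$ (a $k$-fold cover of an orbit counts as a closed orbit, of period $k$ times that of the orbit). Let $(\Sigma,j)$ be a compact connected Riemann surface, $\mathbf x,\mathbf z\subset\Sigma$ disjoint finite sets with $\mathbf x\cup\mathbf z\neq\emptyset$, and let $\tilde u=(a,u):\Sigma\setminus(\mathbf x\cup\mathbf z)\to\mathbb R\times M$ be a smooth map such that $a\to+\infty$ at every point of $\mathbf x$ and $a\to-\infty$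 at every point of $\mathbf z$, and such that for every puncture $p$ there are a closed Reeb orbit $\gamma$, of period $T$, and a holomorphic chart centred at $p$, with polar coordinates $\rho e^{i\theta}$, in which $$\lim_{\rho\to0}u(\rho e^{i\theta})=\gamma\Bigl(\mp\frac{T}{2\pi}\theta\Bigr)\quad\text{uniformly in }\theta,$$ with sign $-$ if $p\in\mathbf x$ and $+$ if $p\in\mathbf z$. Put $$\nu=d\tilde u+J\circ d\tilde u\circ j,\qquad \|\nu\|_{L^2(G)}^2=\int_\Sigma\|\nu\|_G^2\,dA,$$ where $\|\nu\|_G$ is the pointwise operator norm with respect to $G$ and any conformal metric on $\Sigma$ with area form $dA$ (the integral does not depend on that metric). If $\|\nu\|_{L^2(G)}<2\sqrt{T_0}$, then $\mathbf x\neq\emptyset$: the curve $\tilde u$ has at least one positive (top) puncture. -/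

import Mathlib

open Set Filter Topology MeasureTheory Bundle
open scoped Manifold ContDiff ENNReal

noncomputable section

namespace SymplectizationCurve

/-! ### Contact forms and their Reeb vector fields -/

/-- Model space of a manifold of odd dimension `2 n + 1`. -/
abbrev Model (n : ℕ) : Type := EuclideanSpace ℝ (Fin (2 * n + 1))

/-- A (not yet smooth) one-form on `M`. -/
abbrev OneForm (n : ℕ) (M : Type*) [TopologicalSpace M] [ChartedSpace (Model n) M] : Type _ :=
  (x : M) → TangentSpace 𝓘(ℝ, Model n) x →L[ℝ] ℝ

section Contact

variable {n : ℕ} {M : Type*} [TopologicalSpace M] [ChartedSpace (Model n) M]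

/-- The local expression of the one-form `α` in the preferred chart at `x`, that is, its pull-back
under the inverse of this chart. -/
def OneForm.local (α : OneForm n M) (x : M) (y : Model n) : Model n →L[ℝ] ℝ :=
  (α ((chartAt (Model n) x).symm y)).comp
    (mfderiv 𝓘(ℝ, Model n) 𝓘(ℝ, Model n) (chartAt (Model n) x).symm y)

/-- The exterior derivative `dα` of a one-form, `dα(v, w) = D_v α(w) - D_w α(v)` in the preferred
chart at `x`, through which Mathlib identifies the tangent space at `x` with the model space. -/
def OneForm.d (α : OneForm n M) (x : M) (v w : TangentSpace 𝓘(ℝ, Model n) x) : ℝ :=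
  fderiv ℝ (α.local x) (chartAt (Model n) x x) v w -
    fderiv ℝ (α.local x) (chartAt (Model n) x x) w v

variable (n M) in
/-- A contact form on a manifold of dimension `2 n + 1`: a smooth one-form `α`, nowhere zero, such
that `dα` is non-degenerate on the hyperplane field `ξ = ker α`; equivalently, `α ∧ (dα)ⁿ` is
nowhere zero. -/
structure ContactForm [IsManifold 𝓘(ℝ, Model n) ∞ M] where
  form : OneForm n M
  smooth : ContMDiff 𝓘(ℝ, Model n) (𝓘(ℝ, Model n).prod 𝓘(ℝ, Model n →L[ℝ] ℝ)) ∞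
    (fun x => TotalSpace.mk' (Model n →L[ℝ] ℝ)
      (E := fun x : M => TangentSpace 𝓘(ℝ, Model n) x →L[ℝ] Bundle.Trivial M ℝ x) x (form x))
  ne_zero : ∀ x, form x ≠ 0
  nondegenerate : ∀ (x : M) (v : TangentSpace 𝓘(ℝ, Model n) x), form x v = 0 →
    (∀ w : TangentSpace 𝓘(ℝ, Model n) x, form x w = 0 → form.d x v w = 0) → v = 0

/-- Linear algebra behind the Reeb field. -/
theorem existsUnique_reeb_aux {V : Type*} [AddCommGroup V] [Module ℝ V] [FiniteDimensional ℝ V]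
    (a : V →ₗ[ℝ] ℝ) (ha : a ≠ 0) (B : V →ₗ[ℝ] V →ₗ[ℝ] ℝ) (hB : ∀ v, B v v = 0)
    (hnd : ∀ v, a v = 0 → (∀ w, a w = 0 → B v w = 0) → v = 0) :
    ∃! v, a v = 1 ∧ ∀ w, B v w = 0 := by
  let r : Module.Dual ℝ V →ₗ[ℝ] Module.Dual ℝ (LinearMap.ker a) :=
    Module.Dual.transpose (LinearMap.ker a).subtype
  let Φ : V →ₗ[ℝ] ℝ × Module.Dual ℝ (LinearMap.ker a) := a.prod (r.comp B)
  have hinj : Function.Injective Φ := by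
    rw [injective_iff_map_eq_zero]
    intro v hv
    have h1 : a v = 0 := congrArg Prod.fst hv
    have h2 : r (B v) = 0 := congrArg Prod.snd hv
    exact hnd v h1 fun w hw => LinearMap.congr_fun h2 ⟨w, hw⟩
  have hrange : Module.finrank ℝ (LinearMap.range a) = 1 := by
    rw [LinearMap.range_eq_top.2 (LinearMap.surjective ha), finrank_top, Module.finrank_self]
  have hdim : Module.finrank ℝ V = Module.finrank ℝ (ℝ × Module.Dual ℝ (LinearMap.ker a)) := by
    rw [Module.finrank_prod, Subspace.dual_finrank_eq, Module.finrank_self,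
      ← LinearMap.finrank_range_add_finrank_ker a, hrange]
  have hsurj : Function.Surjective Φ :=
    (LinearMap.injective_iff_surjective_of_finrank_eq_finrank hdim).1 hinj
  obtain ⟨v, hv⟩ := hsurj (1, 0)
  have h1 : a v = 1 := congrArg Prod.fst hv
  have h2 : r (B v) = 0 := congrArg Prod.snd hv
  have h3 : ∀ w, a w = 0 → B v w = 0 := fun w hw => LinearMap.congr_fun h2 ⟨w, hw⟩
  refine ⟨v, ⟨h1, fun w => ?_⟩, fun v' hv' => hinj ?_⟩
  · have h4 := h3 (w - a w • v) (by simp [h1])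
    simpa [hB] using h4
  · refine Prod.ext (hv'.1.trans h1.symm) (LinearMap.ext fun w => ?_)
    exact (hv'.2 w).trans (h3 w w.2).symm

variable [IsManifold 𝓘(ℝ, Model n) ∞ M]

theorem ContactForm.existsUnique_reeb (α : ContactForm n M) (x : M) :
    ∃! v : TangentSpace 𝓘(ℝ, Model n) x, α.form x v = 1 ∧ ∀ w, α.form.d x v w = 0 := by
  let a : Model n →L[ℝ] ℝ := α.form x
  let D : Model n →L[ℝ] Model n →L[ℝ] ℝ := fderiv ℝ (α.form.local x) (chartAt (Model n) x x)
  let D' : Model n →ₗ[ℝ] Model n →ₗ[ℝ] ℝ := (ContinuousLinearMap.coeLM ℝ).comp D.toLinearMap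
  have ha : a.toLinearMap ≠ 0 := fun h => α.ne_zero x (ContinuousLinearMap.coe_injective h)
  have key := existsUnique_reeb_aux a.toLinearMap ha (D' - D'.flip)
    (fun v => sub_self (D v v)) (fun v hv hw => α.nondegenerate x v hv hw)
  exact key

/-- The Reeb vector field: the unique solution of `α(R) = 1` and `i_R dα = 0`. -/
def ContactForm.reeb (α : ContactForm n M) (x : M) : TangentSpace 𝓘(ℝ, Model n) x :=
  (α.existsUnique_reeb x).choose

/-- `γ` is a closed Reeb orbit and `T` its period. Multiple covers of an orbit are closed orbits
too, the period of a `k`-fold cover being `k` times the minimal one. -/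
structure ContactForm.IsClosedOrbit (α : ContactForm n M) (γ : ℝ → M) (T : ℝ) : Prop where
  period_pos : 0 < T
  periodic : Function.Periodic γ T
  integralCurve : IsMIntegralCurve (I := 𝓘(ℝ, Model n)) γ α.reeb

/-! ### The symplectization with its almost complex structure and its metrics -/

/-- A smooth complex structure `J` on the bundle `ξ = ker α`, compatible with `dα`: it preserves
`dα` on `ξ`, and `dα(·, J ·)` is positive definite on `ξ`. The endomorphism of `ξ` is encoded as
an endomorphism of `TM = ℝ R ⊕ ξ` that vanishes on the Reeb field `R`. -/
structure ContactForm.CompatibleStructure (α : ContactForm n M) where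
  J : (x : M) → TangentSpace 𝓘(ℝ, Model n) x →L[ℝ] TangentSpace 𝓘(ℝ, Model n) x
  smooth : ContMDiff 𝓘(ℝ, Model n) (𝓘(ℝ, Model n).prod 𝓘(ℝ, Model n →L[ℝ] Model n)) ∞
    (fun x => TotalSpace.mk' (Model n →L[ℝ] Model n)
      (E := fun x : M => TangentSpace 𝓘(ℝ, Model n) x →L[ℝ] TangentSpace 𝓘(ℝ, Model n) x) x (J x))
  map_reeb : ∀ x, J x (α.reeb x) = 0
  map_ker : ∀ (x : M) (v : TangentSpace 𝓘(ℝ, Model n) x), α.form x v = 0 →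
    α.form x (J x v) = 0
  sq : ∀ (x : M) (v : TangentSpace 𝓘(ℝ, Model n) x), α.form x v = 0 → J x (J x v) = -v
  preserves : ∀ (x : M) (v w : TangentSpace 𝓘(ℝ, Model n) x), α.form x v = 0 →
    α.form x w = 0 → α.form.d x (J x v) (J x w) = α.form.d x v w
  pos : ∀ (x : M) (v : TangentSpace 𝓘(ℝ, Model n) x), α.form x v = 0 → v ≠ 0 →
    0 < α.form.d x v (J x v)

/-- Tangent space of the symplectization `ℝ × M` at `p`; Mathlib's model of it is the product of
the tangent spaces of the factors, so vectors are pairs `(s, v)`, standing for `s ∂/∂t + v`. -/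
abbrev SymplTangent (p : ℝ × M) : Type :=
  TangentSpace (𝓘(ℝ, ℝ).prod 𝓘(ℝ, Model n)) p

variable {α : ContactForm n M}

/-- The `ℝ`-invariant almost complex structure on `ℝ × M` that extends the one on `ξ` by
`J ∂/∂t = R` (hence `J R = -∂/∂t`): `(s, v) ↦ (-α(v), s R + J v)`. -/
def ContactForm.CompatibleStructure.symplJ (J : α.CompatibleStructure) (p : ℝ × M) :
    SymplTangent (n := n) p →L[ℝ] SymplTangent (n := n) p :=
  let pr₁ : SymplTangent (n := n) p →L[ℝ] ℝ := ContinuousLinearMap.fst ℝ ℝ (Model n)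
  let pr₂ : SymplTangent (n := n) p →L[ℝ] TangentSpace 𝓘(ℝ, Model n) p.2 :=
    ContinuousLinearMap.snd ℝ ℝ (Model n)
  let X : SymplTangent (n := n) p →L[ℝ] ℝ := -((α.form p.2).comp pr₂)
  let Y : SymplTangent (n := n) p →L[ℝ] TangentSpace 𝓘(ℝ, Model n) p.2 :=
    pr₁.smulRight (α.reeb p.2) + (J.J p.2).comp pr₂
  X.prod Y

/-- The metric `G` on `ℝ × M` for which `∂/∂t` and `R` are orthonormal and orthogonal to `ξ`, and
which equals `dα(·, J ·)` on `ξ`. Since `i_R dα = 0` and the encoded `J` kills `R`, the last term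
only sees the components along `ξ`. -/
def ContactForm.CompatibleStructure.metricG (J : α.CompatibleStructure) (p : ℝ × M)
    (V W : SymplTangent (n := n) p) : ℝ :=
  V.1 * W.1 + α.form p.2 V.2 * α.form p.2 W.2 + α.form.d p.2 V.2 (J.J p.2 W.2)

end Contact

/-! ### Punctured curves

`S` is a Riemann surface. Its real tangent spaces `TangentSpace 𝓘(ℝ, ℂ) z` are copies of `ℂ`, by
means of the preferred holomorphic chart at `z`; so its complex structure `j` is multiplication
by `i`. -/

section Curves

variable {n : ℕ} {M : Type*} [TopologicalSpace M] [ChartedSpace (Model n) M]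
  [IsManifold 𝓘(ℝ, Model n) ∞ M] {α : ContactForm n M}
  {S : Type*} [TopologicalSpace S] [ChartedSpace ℂ S]

/-- The complex structure `j` of the Riemann surface `S`. -/
def complexStructure (z : S) : TangentSpace 𝓘(ℝ, ℂ) z →L[ℝ] TangentSpace 𝓘(ℝ, ℂ) z :=
  ContinuousLinearMap.mul ℝ ℂ Complex.I

/-- The differential of `u : S → ℝ × M`. -/
abbrev differential (u : S → ℝ × M) (z : S) :
    TangentSpace 𝓘(ℝ, ℂ) z →L[ℝ] SymplTangent (n := n) (u z) :=
  mfderiv 𝓘(ℝ, ℂ) (𝓘(ℝ, ℝ).prod 𝓘(ℝ, Model n)) u z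

/-- Holomorphic charts of the Riemann surface `S`. -/
abbrev IsHolomorphicChart (e : OpenPartialHomeomorph S ℂ) : Prop :=
  e ∈ IsManifold.maximalAtlas 𝓘(ℂ, ℂ) ω S

/-- The curve `u` is asymptotic at the puncture `p` to the closed orbit `γ` of period `T`, with
sign `σ`: for some holomorphic chart `φ` centred at `p`, in polar coordinates `ρ e^{iθ}` of this
chart, `u` tends to `γ (-σ T θ / 2π)` as `ρ → 0`, uniformly in `θ`. Uniform convergence to the
continuous loop is expressed as joint convergence for `ρ → 0`, `θ → θ₀`, at every `θ₀`. -/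
def AsymptoticToOrbit (u : S → ℝ × M) (p : S) (σ : ℝ) (γ : ℝ → M) (T : ℝ) : Prop :=
  ∃ φ : OpenPartialHomeomorph S ℂ, IsHolomorphicChart φ ∧ p ∈ φ.source ∧ φ p = 0 ∧
    ∀ θ₀ : ℝ, Tendsto
      (fun q : ℝ × ℝ => (u (φ.symm (q.1 * Complex.exp (q.2 * Complex.I)))).2)
      (𝓝[>] 0 ×ˢ 𝓝 θ₀) (𝓝 (γ (-σ * (T / (2 * Real.pi)) * θ₀)))

/-- `p` is a positive (top) puncture of `u`: the `ℝ`-component tends to `+∞` at `p`, and the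
`M`-component is asymptotic to a closed Reeb orbit. -/
def IsPositivePuncture (α : ContactForm n M) (u : S → ℝ × M) (p : S) : Prop :=
  Tendsto (fun z => (u z).1) (𝓝[≠] p) atTop ∧
    ∃ γ T, α.IsClosedOrbit γ T ∧ AsymptoticToOrbit u p 1 γ T

/-- `p` is a negative (bottom) puncture of `u`: the `ℝ`-component tends to `-∞` at `p`, and the
`M`-component is asymptotic to a closed Reeb orbit. -/
def IsNegativePuncture (α : ContactForm n M) (u : S → ℝ × M) (p : S) : Prop :=
  Tendsto (fun z => (u z).1) (𝓝[≠] p) atBot ∧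
    ∃ γ T, α.IsClosedOrbit γ T ∧ AsymptoticToOrbit u p (-1) γ T

/-- `‖ν‖²_G` at the point with coordinate `ζ` in the holomorphic chart `e`, where `‖·‖_G` is the
operator norm with respect to `G` and the flat metric `|dζ|²` of the chart. -/
def normSqInChart (J : α.CompatibleStructure) (u : S → ℝ × M)
    (ν : (z : S) → TangentSpace 𝓘(ℝ, ℂ) z →L[ℝ] SymplTangent (n := n) (u z))
    (e : OpenPartialHomeomorph S ℂ) (ζ : ℂ) : ℝ≥0∞ :=
  ⨆ (w : ℂ) (_ : ‖w‖ = 1),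
    let V : SymplTangent (n := n) (u (e.symm ζ)) :=
      ν (e.symm ζ) (mfderiv 𝓘(ℝ, ℂ) 𝓘(ℝ, ℂ) e.symm ζ w)
    ENNReal.ofReal (J.metricG (u (e.symm ζ)) V V)

/-- The `L²(G)`-norm of `ν`. The density `‖ν‖²_G dx dy` does not depend on the holomorphic
coordinate `x + i y`; its integral over `S` is the supremum of the sums of its integrals over
finitely many pairwise disjoint measurable sets, each of them inside the domain of a chart. -/
def l2Norm (J : α.CompatibleStructure) (u : S → ℝ × M)
    (ν : (z : S) → TangentSpace 𝓘(ℝ, ℂ) z →L[ℝ] SymplTangent (n := n) (u z)) : ℝ≥0∞ :=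
  (⨆ (k : ℕ) (e : Fin k → OpenPartialHomeomorph S ℂ) (A : Fin k → Set ℂ)
    (_ : ∀ i, IsHolomorphicChart (e i) ∧ MeasurableSet (A i) ∧ A i ⊆ (e i).target)
    (_ : Pairwise fun i i' => Disjoint ((e i).symm '' A i) ((e i').symm '' A i')),
    ∑ i, ∫⁻ ζ in A i, normSqInChart J u ν (e i) ζ) ^ (1 / 2 : ℝ)

end Curves

end SymplectizationCurve

end

/-!
Let `w` be the `M`-component of the curve `u = (a, w)`, and suppose that all its punctures are
negative. With `ν = du + J ∘ du ∘ j`, and in a holomorphic coordinate, the pointwise identity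
`energyDensity_eq` yields `‖ν‖² ≥ -4 d(w^* α)(∂_x, ∂_y)` (`energyDensity_bounds`). Hence Stokes'
theorem bounds the energy `∫ ‖ν‖²` from below by four times the total action `∫ w^* α` of small
circles around the punctures. If each of these circles has action at least `T₀`, the energy is at
least `4 T₀` (`le_l2Norm_sq`), against the assumption `‖ν‖ < 2 √T₀`.

The difficulty is the action of small circles: the curve is only assumed to converge to a closed
orbit uniformly, without its derivatives, and it is not holomorphic. In the coordinate
`s + iθ = log ζ` a punctured disc becomes a half-cylinder on which `‖ν‖²` is integrable.
* The action of the circles is almost monotone, since `d(w^* α) ≥ -‖ν‖² / 4`. It is also the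
  derivative of the integral of `a` up to an error controlled by `ν`; if it were very negative
  somewhere, it would remain so for all smaller `s`, and `a` could not tend to `-∞`. So the action
  is bounded below, and the `ξ`-component of `∂_θ w` is square integrable; there are circles, with
  `s → -∞`, along which its length tends to zero (`eventually_le_action`).
* Along such circles the actions converge to the period `T` of the orbit (`tendsto_integral_form`).
  Locally `∫ w^* α` is the increase of a time function `τ` of the Reeb flow, up to a constant times
  the length of the `ξ`-component; this uses only that `τ` is Lipschitz and grows with unit speed
  along the flow (`exists_timeFunction`, `IsTimeFunction.abs_sub_le`). Continuity of `τ` turns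
  uniform convergence of the loops into convergence of the actions.
* By almost monotonicity and the finiteness of the energy, the action of every small circle is at
  least `T - ε`. Since `T > T₀`, this gives the lower bound
  `IsNegativePuncture.exists_le_integral_pull`.

For Stokes' theorem the surface is dissected into finitely many measurable pieces inside holomorphic
charts (`exists_isDissection`), which is also how the `L²`-norm is defined. The form `w^* α` is
multiplied by a cut-off vanishing near the punctures. The integral of the exterior derivative of the
product is zero (`IsDissection.sum_integral_curl`), and since the cut-off is radial near a puncture,
its differential averages the action over circles of different radii (`le_integral_wedge_radial`,
`exists_cutoff`).
-/

namespace SymplectizationCurve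

/-! ### Flow boxes of vector fields and their time functions -/

section FlowBox

open Metric
open scoped NNReal

variable {E : Type*} [NormedAddCommGroup E] [NormedSpace ℝ E]

/-- The local flow of a `C¹` vector field, confined to a prescribed neighbourhood. -/
theorem exists_local_flow [CompleteSpace E] {X : E → E} {x₀ : E} (hX : ContDiffAt ℝ 1 X x₀)
    {V : Set E}
    (hV : V ∈ 𝓝 x₀) :
    ∃ δ > 0, ∃ r > 0, ∃ φ : E → ℝ → E, ∃ L : ℝ≥0,
      (∀ x ∈ ball x₀ r, φ x 0 = x) ∧
      (∀ x ∈ ball x₀ r, ∀ t ∈ Ioo (-δ) δ, HasDerivAt (φ x) (X (φ x t)) t ∧ φ x t ∈ V) ∧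
      ∀ t ∈ Ioo (-δ) δ, LipschitzOnWith L (φ · t) (ball x₀ r) := by
  obtain ⟨ε, hε, a, r, L, K, hr, hpl⟩ := IsPicardLindelof.of_contDiffAt_one hX
  have h0 := hpl 0
  obtain ⟨φ, h1, L', h2⟩ := h0.exists_forall_mem_closedBall_eq_hasDerivWithinAt_lipschitzOnWith
  have hcont : ContinuousOn (Function.uncurry φ) (closedBall x₀ r ×ˢ Icc (0 - ε) (0 + ε)) :=
    continuousOn_prod_of_continuousOn_lipschitzOnWith _ L'
      (fun x hx => HasDerivWithinAt.continuousOn (h1 x hx).2) h2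
  have hr' : (0 : ℝ) < r := hr
  have hmem : closedBall x₀ r ×ˢ Icc (0 - ε) (0 + ε) ∈ 𝓝 (x₀, (0 : ℝ)) :=
    prod_mem_nhds (closedBall_mem_nhds _ hr') (Icc_mem_nhds (by linarith) (by linarith))
  have hca : ContinuousAt (Function.uncurry φ) (x₀, (0 : ℝ)) := hcont.continuousAt hmem
  have hφ0 : Function.uncurry φ (x₀, (0 : ℝ)) = x₀ :=
    (h1 x₀ (mem_closedBall_self hr'.le)).1
  have hev : ∀ᶠ q in 𝓝 (x₀, (0 : ℝ)), Function.uncurry φ q ∈ V :=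
    hca (by rw [hφ0]; exact hV)
  obtain ⟨ρ, hρ, hball⟩ := Metric.mem_nhds_iff.1 (hev.and hmem)
  rw [← ball_prod_same] at hball
  refine ⟨ρ, hρ, ρ, hρ, φ, L', fun x hx => ?_, fun x hx t ht => ?_, fun t ht => ?_⟩
  · have := (hball (show (x, (0 : ℝ)) ∈ _ from ⟨hx, mem_ball_self hρ⟩)).2.1
    exact (h1 x this).1
  · have ht' : t ∈ ball (0 : ℝ) ρ := by simpa [abs_lt] using ht
    have hV' := (hball (show (x, t) ∈ _ from ⟨hx, ht'⟩)).1
    have hx' := (hball (show (x, t) ∈ _ from ⟨hx, ht'⟩)).2.1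
    refine ⟨((h1 x hx').2 t (hball (show (x, t) ∈ _ from ⟨hx, ht'⟩)).2.2).hasDerivAt ?_, hV'⟩
    refine mem_of_superset (isOpen_ball.mem_nhds ht') fun s hs => ?_
    exact (hball (show (x, s) ∈ _ from ⟨hx, hs⟩)).2.2
  · have ht' : t ∈ ball (0 : ℝ) ρ := by simpa [abs_lt] using ht
    refine (h2 t (hball (show (x₀, t) ∈ _ from ⟨mem_ball_self hρ, ht'⟩)).2.2).mono fun x hx => ?_
    exact (hball (show (x, t) ∈ _ from ⟨hx, ht'⟩)).2.1

/-- `τ` is a time function for the vector field `X` on `U`: it is Lipschitz, and along every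
integral curve of `X` that starts in `U` it increases with unit speed for a short time. -/
structure IsTimeFunction (X : E → E) (τ : E → ℝ) (K : ℝ≥0) (U : Set E) : Prop where
  lipschitz : LipschitzOnWith K τ U
  exists_curve : ∀ x ∈ U, ∃ c : ℝ → E, c 0 = x ∧ HasDerivAt c (X x) 0 ∧
    ∀ᶠ t in 𝓝 0, c t ∈ U ∧ τ (c t) = τ x + t

/-- A `C¹` vector field has a time function near each point where it does not vanish: minus the
time at which the flow line hits a transverse hyperplane. Being Lipschitz, rather than `C¹`, it
requires no differentiability of the flow in the initial point. -/
theorem exists_timeFunction [CompleteSpace E] {X : E → E} {x₀ : E} (hX : ContDiffAt ℝ 1 X x₀)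
    (l : E →L[ℝ] ℝ) (hl : l (X x₀) = 1) : ∃ (τ : E → ℝ) (K : ℝ≥0), ∃ U : Set E, IsOpen U ∧ x₀ ∈ U ∧
      IsTimeFunction X τ K U := by
  obtain ⟨KX, V₁, hV₁, hlip⟩ := hX.exists_lipschitzOnWith
  have hV₂ : ∀ᶠ x in 𝓝 x₀, (1 / 2 : ℝ) < l (X x) := by
    have : ContinuousAt (fun x => l (X x)) x₀ :=
      l.continuous.continuousAt.comp hX.continuousAt
    exact this.eventually (lt_mem_nhds (by norm_num [hl]))
  obtain ⟨δ, hδ, r, hr, φ, L, hφ0, hφ, hφL⟩ := exists_local_flow hX (inter_mem hV₁ hV₂)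
  -- the height of the flow line above the hyperplane increases at least with speed `1 / 2`
  have hmono : ∀ x ∈ ball x₀ r, ∀ s ∈ Ioo (-δ) δ, ∀ t ∈ Ioo (-δ) δ, s ≤ t →
      (1 / 2 : ℝ) * (t - s) ≤ l (φ x t) - l (φ x s) := by
    intro x hx
    have hd : ∀ t ∈ Ioo (-δ) δ, HasDerivAt (fun t => l (φ x t)) (l (X (φ x t))) t := fun t ht =>
      l.hasFDerivAt.comp_hasDerivAt t (hφ x hx t ht).1
    refine (convex_Ioo _ _).mul_sub_le_image_sub_of_le_deriv
      (fun t ht => (hd t ht).continuousAt.continuousWithinAt)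
      (fun t ht => (hd t (interior_subset ht)).differentiableAt.differentiableWithinAt) ?_
    intro t ht
    rw [(hd t (interior_subset ht)).deriv]
    exact le_of_lt (hφ x hx t (interior_subset ht)).2.2
  have habs : ∀ x ∈ ball x₀ r, ∀ s ∈ Ioo (-δ) δ, ∀ t ∈ Ioo (-δ) δ,
      (1 / 2 : ℝ) * |t - s| ≤ |l (φ x t) - l (φ x s)| := by
    intro x hx s hs t ht
    rcases le_total s t with h | h
    · rw [abs_of_nonneg (sub_nonneg.2 h)]
      exact (hmono x hx s hs t ht h).trans (le_abs_self _)
    · rw [abs_sub_comm, abs_of_nonneg (sub_nonneg.2 h), abs_sub_comm]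
      exact (hmono x hx t ht s hs h).trans (le_abs_self _)
  obtain ⟨ρ, hρ, hρr, hρl⟩ : ∃ ρ > 0, ρ ≤ r ∧ ‖l‖ * ρ ≤ δ / 8 := by
    refine ⟨min r (δ / 8 / (‖l‖ + 1)), by positivity, min_le_left _ _, ?_⟩
    calc ‖l‖ * min r (δ / 8 / (‖l‖ + 1)) ≤ (‖l‖ + 1) * (δ / 8 / (‖l‖ + 1)) := by
          gcongr
          · linarith
          · exact min_le_right _ _
      _ = δ / 8 := by field_simp
  have hUr : ball x₀ ρ ⊆ ball x₀ r := ball_subset_ball hρr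
  -- the flow lines through points close to `x₀` hit the hyperplane
  have hex : ∀ x ∈ ball x₀ ρ, ∃ t ∈ Icc (-(δ / 4)) (δ / 4), l (φ x t) = l x₀ := by
    intro x hx
    have hx' := hUr hx
    have hc : ContinuousOn (fun t => l (φ x t)) (Icc (-(δ / 4)) (δ / 4)) := fun t ht =>
      (l.continuous.continuousAt.comp
        (hφ x hx' t ⟨by linarith [ht.1], by linarith [ht.2]⟩).1.continuousAt).continuousWithinAt
    have h0 : |l x - l x₀| ≤ δ / 8 := by
      rw [← map_sub]
      refine (l.le_opNorm _).trans (le_trans ?_ hρl)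
      gcongr
      exact le_of_lt (by simpa [dist_eq_norm] using hx)
    have h1 := hmono x hx' 0 ⟨by linarith, hδ⟩ (δ / 4) ⟨by linarith, by linarith⟩ (by linarith)
    have h2 := hmono x hx' (-(δ / 4)) ⟨by linarith, by linarith⟩ 0 ⟨by linarith, hδ⟩ (by linarith)
    rw [hφ0 x hx'] at h1 h2
    have h3 := abs_le.1 h0
    exact intermediate_value_Icc (by linarith) hc ⟨by linarith, by linarith⟩
  choose! σ hσ hσ0 using hex
  have hσ' : ∀ x ∈ ball x₀ ρ, σ x ∈ Ioo (-δ) δ := fun x hx =>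
    ⟨by linarith [(hσ x hx).1], by linarith [(hσ x hx).2]⟩
  refine ⟨fun x => -σ x, 2 * ‖l‖₊ * L, ball x₀ ρ, isOpen_ball, mem_ball_self hρ, ?_, ?_⟩
  · refine LipschitzOnWith.of_dist_le_mul fun x hx y hy => ?_
    have h1 := habs y (hUr hy) (σ y) (hσ' y hy) (σ x) (hσ' x hx)
    rw [hσ0 y hy, ← hσ0 x hx, ← map_sub] at h1
    have h2 := (l.le_opNorm (φ y (σ x) - φ x (σ x)))
    have h3 := (hφL (σ x) (hσ' x hx)).dist_le_mul y (hUr hy) x (hUr hx)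
    rw [dist_eq_norm] at h3
    have h4 : ‖l‖ * ‖φ y (σ x) - φ x (σ x)‖ ≤ ‖l‖ * (L * dist y x) := by gcongr
    rw [Real.norm_eq_abs] at h2
    have h5 : dist (-σ x) (-σ y) = |σ x - σ y| := by
      rw [Real.dist_eq, abs_sub_comm]; congr 1; ring
    rw [h5, dist_comm x y]
    push_cast
    linarith
  · intro x hx
    have hx' := hUr hx
    have h0 : (0 : ℝ) ∈ Ioo (-δ) δ := ⟨by linarith, hδ⟩
    have hd0 : HasDerivAt (φ x) (X x) 0 := by
      have := (hφ x hx' 0 h0).1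
      rwa [hφ0 x hx'] at this
    refine ⟨φ x, hφ0 x hx', hd0, ?_⟩
    have hU : ∀ᶠ t in 𝓝 (0 : ℝ), φ x t ∈ ball x₀ ρ :=
      hd0.continuousAt (isOpen_ball.mem_nhds (by rwa [hφ0 x hx']))
    have hsmall : ∀ᶠ t in 𝓝 (0 : ℝ), t ∈ Ioo (-(δ / 4)) (δ / 4) :=
      Ioo_mem_nhds (by linarith) (by linarith)
    filter_upwards [hU, hsmall] with h hhU hh
    refine ⟨hhU, ?_⟩
    have hη := hUr hhU
    -- the flow line through `φ x h` is the one through `x`, reparametrised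
    have hEq : EqOn (φ (φ x h)) (fun t => φ x (t + h)) (Ioo (-(3 * δ / 4)) (3 * δ / 4)) := by
      refine ODE_solution_unique_of_mem_Ioo (v := fun _ => X) (s := fun _ => V₁) (t₀ := 0)
        (K := KX) (fun _ _ => hlip) ⟨by linarith, by linarith⟩ (fun t ht => ?_)
        (fun t ht => ?_) ?_
      · have := hφ _ hη t ⟨by linarith [ht.1], by linarith [ht.2]⟩
        exact ⟨this.1, this.2.1⟩
      · have := hφ x hx' (t + h) ⟨by linarith [ht.1, hh.1], by linarith [ht.2, hh.2]⟩
        exact ⟨this.1.comp_add_const t h, this.2.1⟩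
      · simp [hφ0 _ hη]
    have hσx := hσ x hx
    have h1 : σ x - h ∈ Ioo (-(3 * δ / 4)) (3 * δ / 4) :=
      ⟨by linarith [hσx.1, hh.2], by linarith [hσx.2, hh.1]⟩
    have h2 := hEq h1
    simp only [sub_add_cancel] at h2
    have h3 := habs _ hη (σ x - h) ⟨by linarith [h1.1], by linarith [h1.2]⟩ (σ (φ x h))
      (hσ' _ hhU)
    rw [hσ0 _ hhU, h2, hσ0 x hx, sub_self, abs_zero] at h3
    have h4 : σ (φ x h) - (σ x - h) = 0 := abs_eq_zero.1 (le_antisymm (by linarith) (abs_nonneg _))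
    linarith

/-- Along a curve with velocity `g X + e` a time function of `X` increases by `∫ g`, up to the
total size of `e`; no bound on `∫ |g|` enters. -/
theorem IsTimeFunction.abs_sub_le {X : E → E} {τ : E → ℝ} {K : ℝ≥0} {U : Set E}
    (hτ : IsTimeFunction X τ K U) {v : ℝ → E} {g k : ℝ → ℝ} {e : ℝ → E} {a b : ℝ} (hab : a ≤ b)
    (hg : Continuous g) (hk : Continuous k) (hek : ∀ t ∈ Icc a b, ‖e t‖ ≤ k t)
    (hv : ∀ t ∈ Icc a b, v t ∈ U)
    (hv' : ∀ t ∈ Icc a b, HasDerivAt v (g t • X (v t) + e t) t) :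
    |τ (v b) - τ (v a) - ∫ t in a..b, g t| ≤ K * ∫ t in a..b, k t := by
  set f : ℝ → ℝ := fun t => τ (v t) - τ (v a) - ∫ s in a..t, g s with hf
  have hvc : ContinuousOn v (Icc a b) := fun t ht => (hv' t ht).continuousAt.continuousWithinAt
  have hGd : ∀ t, HasDerivAt (fun t => ∫ s in a..t, g s) (g t) t := fun t =>
    intervalIntegral.integral_hasDerivAt_right (hg.intervalIntegrable _ _)
      hg.aestronglyMeasurable.stronglyMeasurableAtFilter hg.continuousAt
  have hEd : ∀ t, HasDerivAt (fun t => ∫ s in a..t, k s) (k t) t := fun t =>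
    intervalIntegral.integral_hasDerivAt_right (hk.intervalIntegrable _ _)
      hk.aestronglyMeasurable.stronglyMeasurableAtFilter hk.continuousAt
  have hfc : ContinuousOn f (Icc a b) :=
    ((hτ.lipschitz.continuousOn.comp hvc hv).sub continuousOn_const).sub
      fun t _ => (hGd t).continuousAt.continuousWithinAt
  -- `τ` need not be differentiable, so `|f|` is bounded by means of its right slopes
  have key : ∀ η > 0, |f b| ≤ K * (∫ t in a..b, k t) + η * (b - a) := by
    intro η hη
    refine image_norm_le_of_liminf_right_slope_norm_lt_deriv_boundary (f := f)
      (f' := fun t => K * ‖e t‖) (B := fun t => K * (∫ s in a..t, k s) + η * (t - a))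
      (B' := fun t => K * k t + η) hfc ?_ ?_ ?_ ?_ ?_ (right_mem_Icc.2 hab)
    · intro x hx r hr
      have hxab : x ∈ Icc a b := Ico_subset_Icc_self hx
      obtain ⟨c, hc0, hcd, hcU⟩ := hτ.exists_curve (v x) (hv x hxab)
      -- compare `v` with the integral curve of `X` through `v x`, run with speed `g x`
      have hd1 : HasDerivAt (fun z => c (g x * (z - x))) (g x • X (v x)) x := by
        have h1 : HasDerivAt (fun z => g x * (z - x)) (g x) x := by
          simpa using ((hasDerivAt_id x).sub_const x).const_mul (g x)
        have h2 : HasDerivAt c (X (v x)) (g x * (x - x)) := by simpa using hcd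
        exact h2.scomp x h1
      have hd2 : HasDerivAt (fun z => v z - c (g x * (z - x))) (e x) x := by
        have := (hv' x hxab).fun_sub hd1
        simpa using this
      have hd3 : HasDerivAt (fun z => g x * (z - x) - ∫ s in a..z, g s) 0 x := by
        have h1 : HasDerivAt (fun z => g x * (z - x)) (g x) x := by
          simpa using ((hasDerivAt_id x).sub_const x).const_mul (g x)
        simpa using h1.fun_sub (hGd x)
      have ht2 : Tendsto (fun z => ‖slope (fun z => v z - c (g x * (z - x))) x z‖) (𝓝[>] x)
          (𝓝 ‖e x‖) :=
        ((hasDerivAt_iff_tendsto_slope.1 hd2).mono_left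
          (nhdsWithin_mono x fun z hz => ne_of_gt hz)).norm
      have ht3 : Tendsto (fun z => |slope (fun z => g x * (z - x) - ∫ s in a..z, g s) x z|)
          (𝓝[>] x) (𝓝 0) := by
        have := ((hasDerivAt_iff_tendsto_slope.1 hd3).mono_left
          (nhdsWithin_mono x fun z hz => ne_of_gt hz : 𝓝[>] x ≤ _)).norm
        rwa [norm_zero] at this
      have ht : Tendsto (fun z => K * ‖slope (fun z => v z - c (g x * (z - x))) x z‖ +
          |slope (fun z => g x * (z - x) - ∫ s in a..z, g s) x z|) (𝓝[>] x)
          (𝓝 (K * ‖e x‖ + 0)) := (ht2.const_mul (K : ℝ)).add ht3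
      rw [add_zero] at ht
      have hlin : Tendsto (fun z : ℝ => g x * (z - x)) (𝓝[>] x) (𝓝 0) := by
        have : Continuous fun z : ℝ => g x * (z - x) := by fun_prop
        simpa using (this.tendsto x).mono_left nhdsWithin_le_nhds
      have hIoo : ∀ᶠ z in 𝓝[>] x, z ∈ Ioo x b := Ioo_mem_nhdsGT hx.2
      refine Eventually.frequently ?_
      filter_upwards [ht.eventually (gt_mem_nhds hr), hlin.eventually hcU, hIoo] with z h1 h2 h3
      refine lt_of_le_of_lt ?_ h1
      have hzx : 0 < z - x := sub_pos.2 h3.1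
      have hz : z ∈ Icc a b := ⟨hx.1.trans h3.1.le, h3.2.le⟩
      simp only [slope_def_field, slope_def_module, norm_smul, Function.comp, norm_inv,
        Real.norm_eq_abs, abs_div, abs_of_pos hzx, sub_self, mul_zero, hc0, sub_zero]
      have h4 := hτ.lipschitz.dist_le_mul (v z) (hv z hz) _ h2.1
      rw [Real.dist_eq, h2.2, dist_eq_norm] at h4
      have h5 : f z - f x = (τ (v z) - (τ (v x) + g x * (z - x))) +
          (g x * (z - x) - (∫ s in a..z, g s) - (0 - ∫ s in a..x, g s)) := by
        simp only [hf]; ring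
      have h6 : |f z| - |f x| ≤ |f z - f x| := abs_sub_abs_le_abs_sub _ _
      have h7 := abs_add_le (τ (v z) - (τ (v x) + g x * (z - x)))
        (g x * (z - x) - (∫ s in a..z, g s) - (0 - ∫ s in a..x, g s))
      rw [← h5] at h7
      rw [div_le_iff₀ hzx, add_mul, div_mul_cancel₀ _ hzx.ne', mul_assoc, mul_assoc,
        mul_comm _ (z - x), inv_mul_cancel_left₀ hzx.ne']
      linarith
    · simp [hf]
    · exact fun t _ => ((((hEd t).const_mul (K : ℝ)).add
        (((hasDerivAt_id t).sub_const a).const_mul η)).continuousAt).continuousWithinAt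
    · intro t _
      have := ((hEd t).const_mul (K : ℝ)).fun_add (((hasDerivAt_id t).sub_const a).const_mul η)
      simpa using this.hasDerivWithinAt
    · intro t ht _
      have := mul_le_mul_of_nonneg_left (hek t (Ico_subset_Icc_self ht)) K.coe_nonneg
      linarith
  have hlim : Tendsto (fun η : ℝ => K * (∫ t in a..b, k t) + η * (b - a)) (𝓝[>] 0)
      (𝓝 (K * (∫ t in a..b, k t) + 0 * (b - a))) :=
    ((tendsto_id.mul_const (b - a)).const_add _).mono_left nhdsWithin_le_nhds
  rw [zero_mul, add_zero] at hlim
  exact ge_of_tendsto hlim (by filter_upwards [self_mem_nhdsWithin] with η hη using key η hη)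

end FlowBox

/-! ### Exterior derivatives and pull-backs of one-forms -/

section Curl

variable {E F : Type*} [NormedAddCommGroup E] [NormedSpace ℝ E]
  [NormedAddCommGroup F] [NormedSpace ℝ F]

/-- The exterior derivative of a one-form on a normed space. -/
noncomputable def curl (β : F → F →L[ℝ] ℝ) (y a b : F) : ℝ := fderiv ℝ β y a b - fderiv ℝ β y b a

theorem curl_congr {β β' : F → F →L[ℝ] ℝ} {y : F} (h : β =ᶠ[𝓝 y] β') (a b : F) :
    curl β y a b = curl β' y a b := by
  rw [curl, curl, h.fderiv_eq]

/-- The exterior derivative commutes with pull-backs. -/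
theorem curl_comp_fderiv {β : E → E →L[ℝ] ℝ} {f : F → E} {y : F}
    (hβ : DifferentiableAt ℝ β (f y)) (hf : ContDiffAt ℝ 2 f y) (a b : F) :
    curl (fun y => (β (f y)).comp (fderiv ℝ f y)) y a b =
      curl β (f y) (fderiv ℝ f y a) (fderiv ℝ f y b) := by
  have hf1 : DifferentiableAt ℝ f y := hf.differentiableAt (by norm_num)
  have hf2 : DifferentiableAt ℝ (fderiv ℝ f) y :=
    (hf.fderiv_right (m := 1) (by norm_num)).differentiableAt (by norm_num)
  have h := (hβ.hasFDerivAt.comp y hf1.hasFDerivAt).clm_comp hf2.hasFDerivAt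
  have hsymm := hf.isSymmSndFDerivAt (by simp) a b
  simp only [curl]
  have h' : fderiv ℝ (fun y => (β (f y)).comp (fderiv ℝ f y)) y = _ := h.fderiv
  rw [h']
  simp [hsymm]

/-- The exterior derivative as a bilinear form. -/
noncomputable def curlForm (β : F → F →L[ℝ] ℝ) (y : F) : F →L[ℝ] F →L[ℝ] ℝ :=
  fderiv ℝ β y - (fderiv ℝ β y).flip

theorem contDiffAt_curlForm {β : F → F →L[ℝ] ℝ} {y : F} {m k : WithTop ℕ∞}
    (h : ContDiffAt ℝ m β y) (hk : k + 1 ≤ m) : ContDiffAt ℝ k (curlForm β) y := by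
  have h1 := h.fderiv_right hk
  have hL : ContDiff ℝ k (fun B : F →L[ℝ] F →L[ℝ] ℝ => B.flip) :=
    IsBoundedLinearMap.contDiff ⟨⟨fun _ _ => rfl, fun _ _ => rfl⟩, 1, one_pos, fun B => by
      rw [one_mul]; exact B.opNorm_flip.le⟩
  exact h1.sub (hL.contDiffAt.comp y h1)

end Curl

section Pull

variable {n : ℕ} {M : Type*} [TopologicalSpace M] [ChartedSpace (Model n) M]
  {F : Type*} [NormedAddCommGroup F] [NormedSpace ℝ F]

/-- The pull-back of a one-form on `M` under a map from a normed space. -/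
noncomputable def OneForm.pull (α : OneForm n M) (w : F → M) (y : F) : F →L[ℝ] ℝ :=
  (α (w y)).comp (mfderiv 𝓘(ℝ, F) 𝓘(ℝ, Model n) w y)

theorem OneForm.apply_congr (α : OneForm n M) {x x' : M} (hx : x = x') {a b : Model n}
    (hab : a = b) :
    (show Model n →L[ℝ] ℝ from α x) a = (show Model n →L[ℝ] ℝ from α x') b := by
  subst hx hab; rfl

variable [IsManifold 𝓘(ℝ, Model n) ∞ M]

theorem mfderiv_chart_symm_mfderiv_chart {x₀ x : M} (hx : x ∈ (chartAt (Model n) x₀).source)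
    (v : TangentSpace 𝓘(ℝ, Model n) x) :
    mfderiv 𝓘(ℝ, Model n) 𝓘(ℝ, Model n) (chartAt (Model n) x₀).symm (chartAt (Model n) x₀ x)
      (mfderiv 𝓘(ℝ, Model n) 𝓘(ℝ, Model n) (chartAt (Model n) x₀) x v) = v := by
  have : IsManifold 𝓘(ℝ, Model n) 1 M := IsManifold.of_le (n := ∞) (by simp)
  exact DFunLike.congr_fun
    ((mdifferentiable_chart (I := 𝓘(ℝ, Model n)) x₀).symm_comp_deriv hx) v

theorem mfderiv_chart_mfderiv_chart_symm {x₀ : M} {y : Model n}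
    (hy : y ∈ (chartAt (Model n) x₀).target) (v : Model n) :
    mfderiv 𝓘(ℝ, Model n) 𝓘(ℝ, Model n) (chartAt (Model n) x₀) ((chartAt (Model n) x₀).symm y)
      (mfderiv 𝓘(ℝ, Model n) 𝓘(ℝ, Model n) (chartAt (Model n) x₀).symm y v) = v := by
  have : IsManifold 𝓘(ℝ, Model n) 1 M := IsManifold.of_le (n := ∞) (by simp)
  exact DFunLike.congr_fun
    ((mdifferentiable_chart (I := 𝓘(ℝ, Model n)) x₀).comp_symm_deriv hy) v

theorem mdifferentiableAt_chart {x₀ x : M} (hx : x ∈ (chartAt (Model n) x₀).source) :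
    MDifferentiableAt 𝓘(ℝ, Model n) 𝓘(ℝ, Model n) (chartAt (Model n) x₀) x := by
  have : IsManifold 𝓘(ℝ, Model n) 1 M := IsManifold.of_le (n := ∞) (by simp)
  exact (mdifferentiable_chart (I := 𝓘(ℝ, Model n)) x₀).mdifferentiableAt hx

/-- Chain rule for a map to `M` read in a chart. -/
theorem fderiv_chart_comp {w : F → M} {y : F} (hw : MDifferentiableAt 𝓘(ℝ, F) 𝓘(ℝ, Model n) w y)
    {x₀ : M} (hx : w y ∈ (chartAt (Model n) x₀).source) (a : F) :
    fderiv ℝ (fun y => chartAt (Model n) x₀ (w y)) y a =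
      mfderiv 𝓘(ℝ, Model n) 𝓘(ℝ, Model n) (chartAt (Model n) x₀) (w y)
        (mfderiv 𝓘(ℝ, F) 𝓘(ℝ, Model n) w y a) := by
  rw [← mfderiv_eq_fderiv]
  exact DFunLike.congr_fun (mfderiv_comp y (mdifferentiableAt_chart hx) hw) a

theorem OneForm.local_apply_fderiv (α : OneForm n M) {x₀ x : M}
    (hx : x ∈ (chartAt (Model n) x₀).source) (v : TangentSpace 𝓘(ℝ, Model n) x) :
    α.local x₀ (chartAt (Model n) x₀ x)
      (mfderiv 𝓘(ℝ, Model n) 𝓘(ℝ, Model n) (chartAt (Model n) x₀) x v) = α x v := by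
  have key : ∀ x' : M, x' = x → ∀ v' : Model n, v' = v →
      (show Model n →L[ℝ] ℝ from α x') v' = (show Model n →L[ℝ] ℝ from α x) v := by
    rintro _ rfl _ rfl; rfl
  exact key _ ((chartAt (Model n) x₀).left_inv hx) _ (mfderiv_chart_symm_mfderiv_chart hx v)

theorem OneForm.pull_eq_local (α : OneForm n M) {w : F → M} {y : F}
    (hw : MDifferentiableAt 𝓘(ℝ, F) 𝓘(ℝ, Model n) w y) {x₀ : M}
    (hx : w y ∈ (chartAt (Model n) x₀).source) :
    α.pull w y = (α.local x₀ (chartAt (Model n) x₀ (w y))).comp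
      (fderiv ℝ (fun y => chartAt (Model n) x₀ (w y)) y) := by
  ext a
  rw [ContinuousLinearMap.comp_apply, fderiv_chart_comp hw hx]
  exact (α.local_apply_fderiv hx _).symm

theorem symmL_trivializationAt_eq {x₀ x : M} (hx : x ∈ (chartAt (Model n) x₀).source)
    (v : Model n) :
    (trivializationAt (Model n) (TangentSpace 𝓘(ℝ, Model n)) x₀).symmL ℝ x v =
      mfderiv 𝓘(ℝ, Model n) 𝓘(ℝ, Model n) (chartAt (Model n) x₀).symm (chartAt (Model n) x₀ x) v := by
  have : IsManifold 𝓘(ℝ, Model n) 1 M := IsManifold.of_le (n := ∞) (by simp)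
  have h := TangentBundle.symmL_trivializationAt (I := 𝓘(ℝ, Model n)) hx
  have h2 := DFunLike.congr_fun h v
  refine h2.trans ?_
  rw [modelWithCornersSelf_coe, range_id, mfderivWithin_univ]
  rfl

theorem continuousLinearMapAt_trivializationAt_eq {x₀ x : M}
    (hx : x ∈ (chartAt (Model n) x₀).source) (v : TangentSpace 𝓘(ℝ, Model n) x) :
    (trivializationAt (Model n) (TangentSpace 𝓘(ℝ, Model n)) x₀).continuousLinearMapAt ℝ x v =
      mfderiv 𝓘(ℝ, Model n) 𝓘(ℝ, Model n) (chartAt (Model n) x₀) x v := by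
  have : IsManifold 𝓘(ℝ, Model n) 1 M := IsManifold.of_le (n := ∞) (by simp)
  exact DFunLike.congr_fun (TangentBundle.continuousLinearMapAt_trivializationAt
    (I := 𝓘(ℝ, Model n)) hx) v

theorem contMDiffAt_chart_symm {x₀ : M} {y : Model n} (hy : y ∈ (chartAt (Model n) x₀).target) :
    ContMDiffAt 𝓘(ℝ, Model n) 𝓘(ℝ, Model n) ∞ (chartAt (Model n) x₀).symm y :=
  (contMDiffOn_chart_symm (n := ∞) (I := 𝓘(ℝ, Model n)) (x := x₀)).contMDiffAt
    ((chartAt (Model n) x₀).open_target.mem_nhds hy)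

/-- The form is smooth in the preferred chart. -/
theorem ContactForm.contDiffAt_local (α : ContactForm n M) (x₀ : M) :
    ContDiffAt ℝ ∞ (α.form.local x₀) (chartAt (Model n) x₀ x₀) := by
  have : IsManifold 𝓘(ℝ, Model n) 1 M := IsManifold.of_le (n := ∞) (by simp)
  have h := ((contMDiffAt_hom_bundle _).1 (α.smooth x₀)).2
  have hs := contMDiffAt_chart_symm (M := M) (mem_chart_target (Model n) x₀)
  rw [← contMDiffAt_iff_contDiffAt]
  refine (ContMDiffAt.comp_of_eq h hs
    ((chartAt (Model n) x₀).left_inv (mem_chart_source _ x₀))).congr_of_eventuallyEq ?_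
  filter_upwards [(chartAt (Model n) x₀).open_target.mem_nhds (mem_chart_target _ x₀)] with y hy
  have hy' := (chartAt (Model n) x₀).map_target hy
  have hr := (chartAt (Model n) x₀).right_inv hy
  ext v
  have h1 := symmL_trivializationAt_eq hy' v
  rw [hr] at h1
  refine (congrArg (fun v : Model n => α.form ((chartAt (Model n) x₀).symm y) v) h1.symm).trans ?_
  exact (DFunLike.congr_fun (Bundle.Trivial.continuousLinearMapAt_trivialization ℝ M ℝ _) _).symm

/-- The complex structure on `ξ`, extended by zero, in the preferred chart at `x₀`. -/
noncomputable def ContactForm.CompatibleStructure.localJ {α : ContactForm n M}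
    (J : α.CompatibleStructure) (x₀ : M) (y : Model n) : Model n →L[ℝ] Model n :=
  ((mfderiv 𝓘(ℝ, Model n) 𝓘(ℝ, Model n) (chartAt (Model n) x₀) ((chartAt (Model n) x₀).symm y)).comp
    (J.J ((chartAt (Model n) x₀).symm y))).comp
    (mfderiv 𝓘(ℝ, Model n) 𝓘(ℝ, Model n) (chartAt (Model n) x₀).symm y)

theorem ContactForm.CompatibleStructure.contDiffAt_localJ {α : ContactForm n M}
    (J : α.CompatibleStructure) (x₀ : M) :
    ContDiffAt ℝ ∞ (J.localJ x₀) (chartAt (Model n) x₀ x₀) := by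
  have : IsManifold 𝓘(ℝ, Model n) 1 M := IsManifold.of_le (n := ∞) (by simp)
  have h := ((contMDiffAt_hom_bundle _).1 (J.smooth x₀)).2
  have hs := contMDiffAt_chart_symm (M := M) (mem_chart_target (Model n) x₀)
  rw [← contMDiffAt_iff_contDiffAt]
  refine (ContMDiffAt.comp_of_eq h hs
    ((chartAt (Model n) x₀).left_inv (mem_chart_source _ x₀))).congr_of_eventuallyEq ?_
  filter_upwards [(chartAt (Model n) x₀).open_target.mem_nhds (mem_chart_target _ x₀)] with y hy
  have hy' := (chartAt (Model n) x₀).map_target hy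
  have hr := (chartAt (Model n) x₀).right_inv hy
  ext1 v
  have h1 := symmL_trivializationAt_eq hy' v
  rw [hr] at h1
  refine (continuousLinearMapAt_trivializationAt_eq hy' _).symm.trans ?_
  exact congrArg (fun v : Model n =>
    (trivializationAt (Model n) (TangentSpace 𝓘(ℝ, Model n)) x₀).continuousLinearMapAt ℝ
      ((chartAt (Model n) x₀).symm y) (J.J ((chartAt (Model n) x₀).symm y) v)) h1.symm

theorem contDiffAt_chart_comp {w : F → M} {y : F} {k : WithTop ℕ∞} (hk : k ≤ (∞ : WithTop ℕ∞))
    (hw : ContMDiffAt 𝓘(ℝ, F) 𝓘(ℝ, Model n) k w y) {x₀ : M}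
    (hx : w y ∈ (chartAt (Model n) x₀).source) :
    ContDiffAt ℝ k (fun y => chartAt (Model n) x₀ (w y)) y := by
  rw [← contMDiffAt_iff_contDiffAt]
  have h : ContMDiffAt 𝓘(ℝ, Model n) 𝓘(ℝ, Model n) k (chartAt (Model n) x₀) (w y) :=
    ((contMDiffOn_chart (n := ∞) (I := 𝓘(ℝ, Model n)) (x := x₀)).contMDiffAt
      ((chartAt (Model n) x₀).open_source.mem_nhds hx)).of_le hk
  exact h.comp y hw

/-- Near a point, the pull-back of a form is the pull-back of its local expression. -/
theorem OneForm.pull_eventuallyEq (α : OneForm n M) {w : F → M} {y : F}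
    (hw : ContMDiffAt 𝓘(ℝ, F) 𝓘(ℝ, Model n) 2 w y) {x₀ : M}
    (hx : w y ∈ (chartAt (Model n) x₀).source) :
    α.pull w =ᶠ[𝓝 y] fun y => (α.local x₀ (chartAt (Model n) x₀ (w y))).comp
      (fderiv ℝ (fun y => chartAt (Model n) x₀ (w y)) y) := by
  have : IsManifold 𝓘(ℝ, Model n) 2 M := IsManifold.of_le (n := ∞) ENat.LEInfty.out
  filter_upwards [(contMDiffAt_iff_contMDiffAt_nhds (by simp)).1 hw, hw.continuousAt
    ((chartAt (Model n) x₀).open_source.mem_nhds hx)] with y' h1 h2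
  exact α.pull_eq_local (h1.mdifferentiableAt (by norm_num)) h2

theorem ContactForm.contDiffAt_pull (α : ContactForm n M) {w : F → M} {y : F}
    (hw : ContMDiffAt 𝓘(ℝ, F) 𝓘(ℝ, Model n) 2 w y) : ContDiffAt ℝ 1 (α.form.pull w) y := by
  refine ContDiffAt.congr_of_eventuallyEq ?_
    (α.form.pull_eventuallyEq hw (mem_chart_source _ (w y)))
  have h := contDiffAt_chart_comp ENat.LEInfty.out hw (mem_chart_source (Model n) (w y))
  exact (((α.contDiffAt_local (w y)).of_le ENat.LEInfty.out).comp y (h.of_le one_le_two)).clm_comp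
    (h.fderiv_right (by norm_num))

/-- `d (w^* α) = w^* dα`. -/
theorem ContactForm.curl_pull (α : ContactForm n M) {w : F → M} {y : F}
    (hw : ContMDiffAt 𝓘(ℝ, F) 𝓘(ℝ, Model n) 2 w y) (a b : F) :
    curl (α.form.pull w) y a b = α.form.d (w y) (mfderiv 𝓘(ℝ, F) 𝓘(ℝ, Model n) w y a)
      (mfderiv 𝓘(ℝ, F) 𝓘(ℝ, Model n) w y b) := by
  rw [curl_congr (α.form.pull_eventuallyEq hw (mem_chart_source _ (w y)))]
  have h := contDiffAt_chart_comp ENat.LEInfty.out hw (mem_chart_source (Model n) (w y))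
  rw [curl_comp_fderiv (f := fun y' => chartAt (Model n) (w y) (w y'))
    ((α.contDiffAt_local (w y)).differentiableAt (by simp)) h]
  have key : ∀ a : F, fderiv ℝ (fun y' => chartAt (Model n) (w y) (w y')) y a =
      mfderiv 𝓘(ℝ, F) 𝓘(ℝ, Model n) w y a := by
    intro a
    have hm : MDifferentiableAt 𝓘(ℝ, F) 𝓘(ℝ, Model n) w y := hw.mdifferentiableAt (by norm_num)
    refine Eq.trans ?_ (DFunLike.congr_fun hm.mfderiv a).symm
    rw [modelWithCornersSelf_coe, range_id, fderivWithin_univ]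
    rfl
  rw [key, key]
  rfl

theorem ContactForm.d_eq_curl_local (α : ContactForm n M) {x₀ x : M}
    (hx : x ∈ (chartAt (Model n) x₀).source) (v v' : TangentSpace 𝓘(ℝ, Model n) x) :
    α.form.d x v v' = curl (α.form.local x₀) (chartAt (Model n) x₀ x)
      (mfderiv 𝓘(ℝ, Model n) 𝓘(ℝ, Model n) (chartAt (Model n) x₀) x v)
      (mfderiv 𝓘(ℝ, Model n) 𝓘(ℝ, Model n) (chartAt (Model n) x₀) x v') := by
  have h := α.curl_pull ((contMDiffAt_chart_symm
    ((chartAt (Model n) x₀).map_source hx)).of_le ENat.LEInfty.out)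
    (mfderiv 𝓘(ℝ, Model n) 𝓘(ℝ, Model n) (chartAt (Model n) x₀) x v)
    (mfderiv 𝓘(ℝ, Model n) 𝓘(ℝ, Model n) (chartAt (Model n) x₀) x v')
  refine Eq.trans ?_ h.symm
  have key : ∀ x' : M, x' = x → ∀ a b : Model n, a = v → b = v' →
      α.form.d x v v' = α.form.d x' a b := by
    rintro _ rfl _ _ rfl rfl; rfl
  exact key _ ((chartAt (Model n) x₀).left_inv hx) _ _ (mfderiv_chart_symm_mfderiv_chart hx v)
    (mfderiv_chart_symm_mfderiv_chart hx v')

end Pull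

/-! ### The Reeb field and the metric on `ξ` in a chart -/

section Reeb

variable {n : ℕ} {M : Type*} [TopologicalSpace M] [ChartedSpace (Model n) M]

theorem OneForm.d_swap (α : OneForm n M) (x : M) (v w : TangentSpace 𝓘(ℝ, Model n) x) :
    α.d x v w = -α.d x w v := by
  simp only [OneForm.d]; ring

theorem OneForm.d_add_right (α : OneForm n M) (x : M) (v w w' : TangentSpace 𝓘(ℝ, Model n) x) :
    α.d x v (w + w') = α.d x v w + α.d x v w' :=
  map_add (curlForm (α.local x) (chartAt (Model n) x x) v) w w'

theorem OneForm.d_smul_right (α : OneForm n M) (x : M) (c : ℝ)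
    (v w : TangentSpace 𝓘(ℝ, Model n) x) : α.d x v (c • w) = c * α.d x v w :=
  map_smul (curlForm (α.local x) (chartAt (Model n) x x) v) c w

theorem OneForm.d_add_left (α : OneForm n M) (x : M) (v v' w : TangentSpace 𝓘(ℝ, Model n) x) :
    α.d x (v + v') w = α.d x v w + α.d x v' w := by
  rw [α.d_swap, α.d_add_right, α.d_swap x w v, α.d_swap x w v']; ring

theorem OneForm.d_smul_left (α : OneForm n M) (x : M) (c : ℝ)
    (v w : TangentSpace 𝓘(ℝ, Model n) x) : α.d x (c • v) w = c * α.d x v w := by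
  rw [α.d_swap, α.d_smul_right, α.d_swap x w v]; ring

variable [IsManifold 𝓘(ℝ, Model n) ∞ M]

theorem ContactForm.form_reeb (α : ContactForm n M) (x : M) : α.form x (α.reeb x) = 1 :=
  (α.existsUnique_reeb x).choose_spec.1.1

theorem ContactForm.d_reeb_left (α : ContactForm n M) (x : M)
    (v : TangentSpace 𝓘(ℝ, Model n) x) : α.form.d x (α.reeb x) v = 0 :=
  (α.existsUnique_reeb x).choose_spec.1.2 v

theorem ContactForm.d_reeb_right (α : ContactForm n M) (x : M)
    (v : TangentSpace 𝓘(ℝ, Model n) x) : α.form.d x v (α.reeb x) = 0 := by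
  rw [α.form.d_swap, α.d_reeb_left, neg_zero]

/-- The component of a tangent vector along `ξ = ker α`. -/
noncomputable def ContactForm.proj (α : ContactForm n M) (x : M)
    (v : TangentSpace 𝓘(ℝ, Model n) x) : TangentSpace 𝓘(ℝ, Model n) x :=
  v - α.form x v • α.reeb x

theorem ContactForm.form_proj (α : ContactForm n M) (x : M)
    (v : TangentSpace 𝓘(ℝ, Model n) x) : α.form x (α.proj x v) = 0 := by
  rw [ContactForm.proj, map_sub, map_smul, α.form_reeb]; simp

theorem ContactForm.proj_add_reeb (α : ContactForm n M) (x : M)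
    (v : TangentSpace 𝓘(ℝ, Model n) x) : α.proj x v + α.form x v • α.reeb x = v :=
  sub_add_cancel _ _

theorem ContactForm.d_proj (α : ContactForm n M) (x : M)
    (v w : TangentSpace 𝓘(ℝ, Model n) x) : α.form.d x (α.proj x v) (α.proj x w) =
      α.form.d x v w := by
  conv_rhs => rw [← α.proj_add_reeb x v, ← α.proj_add_reeb x w]
  simp [OneForm.d_add_left, OneForm.d_add_right, OneForm.d_smul_left, OneForm.d_smul_right,
    α.d_reeb_left, α.d_reeb_right]

variable {α : ContactForm n M}

theorem ContactForm.CompatibleStructure.map_proj (J : α.CompatibleStructure) (x : M)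
    (v : TangentSpace 𝓘(ℝ, Model n) x) : J.J x (α.proj x v) = J.J x v := by
  rw [ContactForm.proj, map_sub, map_smul, J.map_reeb, smul_zero, sub_zero]

/-- The squared norm of the `ξ`-component. -/
theorem ContactForm.CompatibleStructure.d_map_proj (J : α.CompatibleStructure) (x : M)
    (v : TangentSpace 𝓘(ℝ, Model n) x) :
    α.form.d x (α.proj x v) (J.J x (α.proj x v)) = α.form.d x v (J.J x v) := by
  rw [J.map_proj, ContactForm.proj, sub_eq_add_neg, ← neg_smul, OneForm.d_add_left,
    OneForm.d_smul_left, α.d_reeb_left, mul_zero, add_zero]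

theorem ContactForm.CompatibleStructure.d_nonneg (J : α.CompatibleStructure) (x : M)
    (v : TangentSpace 𝓘(ℝ, Model n) x) : 0 ≤ α.form.d x v (J.J x v) := by
  rw [← J.d_map_proj]
  rcases eq_or_ne (α.proj x v) 0 with h | h
  · rw [h, map_zero]
    have := α.form.d_smul_left x 0 0 (0 : TangentSpace 𝓘(ℝ, Model n) x)
    rw [zero_smul, zero_mul] at this
    exact this.ge
  · exact (J.pos x _ (α.form_proj x v) h).le

variable (α) in
/-- The Reeb field in the preferred chart at `x₀`. -/
noncomputable def ContactForm.localReeb (x₀ : M) (y : Model n) : Model n :=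
  mfderiv 𝓘(ℝ, Model n) 𝓘(ℝ, Model n) (chartAt (Model n) x₀) ((chartAt (Model n) x₀).symm y)
    (α.reeb ((chartAt (Model n) x₀).symm y))

theorem ContactForm.localReeb_chart {x₀ x : M} (hx : x ∈ (chartAt (Model n) x₀).source) :
    α.localReeb x₀ (chartAt (Model n) x₀ x) =
      mfderiv 𝓘(ℝ, Model n) 𝓘(ℝ, Model n) (chartAt (Model n) x₀) x (α.reeb x) := by
  have key : ∀ x' : M, x' = x →
      (show Model n from mfderiv 𝓘(ℝ, Model n) 𝓘(ℝ, Model n) (chartAt (Model n) x₀) x'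
        (α.reeb x')) =
      mfderiv 𝓘(ℝ, Model n) 𝓘(ℝ, Model n) (chartAt (Model n) x₀) x (α.reeb x) := by
    rintro _ rfl; rfl
  exact key _ ((chartAt (Model n) x₀).left_inv hx)

theorem ContactForm.CompatibleStructure.localJ_chart (J : α.CompatibleStructure) {x₀ x : M}
    (hx : x ∈ (chartAt (Model n) x₀).source) (v : TangentSpace 𝓘(ℝ, Model n) x) :
    J.localJ x₀ (chartAt (Model n) x₀ x)
      (mfderiv 𝓘(ℝ, Model n) 𝓘(ℝ, Model n) (chartAt (Model n) x₀) x v) =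
      mfderiv 𝓘(ℝ, Model n) 𝓘(ℝ, Model n) (chartAt (Model n) x₀) x (J.J x v) := by
  have key : ∀ x' : M, x' = x → ∀ v' : Model n, v' = v →
      (show Model n from mfderiv 𝓘(ℝ, Model n) 𝓘(ℝ, Model n) (chartAt (Model n) x₀) x'
        (J.J x' v')) =
      mfderiv 𝓘(ℝ, Model n) 𝓘(ℝ, Model n) (chartAt (Model n) x₀) x (J.J x v) := by
    rintro _ rfl _ rfl; rfl
  exact key _ ((chartAt (Model n) x₀).left_inv hx) _ (mfderiv_chart_symm_mfderiv_chart hx v)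

/-- The Reeb field is `C¹` in a chart: it is `A⁻¹ α` for the isomorphism
`A v = α(v) α + i_v dα` from the tangent to the cotangent space. -/
theorem ContactForm.contDiffAt_localReeb (x₀ : M) :
    ContDiffAt ℝ 1 (α.localReeb x₀) (chartAt (Model n) x₀ x₀) := by
  set y₀ := chartAt (Model n) x₀ x₀ with hy₀
  set a : Model n → Model n →L[ℝ] ℝ := α.form.local x₀ with ha
  let A : Model n → Model n →L[ℝ] Model n →L[ℝ] ℝ := fun y =>
    (a y).smulRight (a y) + curlForm a y
  have hAv : ∀ y v w, A y v w = a y v * a y w + curl a y v w := fun y v w => rfl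
  have hsmooth : ContDiffAt ℝ ∞ a y₀ := α.contDiffAt_local x₀
  have hA : ContDiffAt ℝ 1 A y₀ := by
    have h1 : ContDiffAt ℝ 1 a y₀ := hsmooth.of_le ENat.LEInfty.out
    have h2 : ContDiffAt ℝ 1 (curlForm a) y₀ :=
      contDiffAt_curlForm (m := 2) (hsmooth.of_le ENat.LEInfty.out) (by norm_num)
    exact (h1.smulRight h1).add h2
  have hsrc := mem_chart_source (Model n) x₀
  have htgt := (chartAt (Model n) x₀).open_target.mem_nhds (mem_chart_target (Model n) x₀)
  have hR : ∀ y ∈ (chartAt (Model n) x₀).target, A y (α.localReeb x₀ y) = a y ∧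
      a y (α.localReeb x₀ y) = 1 := by
    intro y hy
    have hx := (chartAt (Model n) x₀).map_target hy
    have hr := (chartAt (Model n) x₀).right_inv hy
    have h1 := α.form.local_apply_fderiv hx (α.reeb _)
    rw [hr, α.form_reeb] at h1
    refine ⟨?_, h1⟩
    ext w
    have h2 := α.d_eq_curl_local hx (α.reeb _)
      (mfderiv 𝓘(ℝ, Model n) 𝓘(ℝ, Model n) (chartAt (Model n) x₀).symm y w)
    rw [hr, α.d_reeb_left] at h2
    have h3 := mfderiv_chart_mfderiv_chart_symm hy w
    have h4 : curl a y (α.localReeb x₀ y) w = 0 :=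
      (congrArg (curl a y (α.localReeb x₀ y)) h3).symm.trans h2.symm
    rw [hAv, h4]
    have h1' : a y (α.localReeb x₀ y) = 1 := h1
    rw [h1', one_mul, add_zero]
  have hinj : Function.Injective (A y₀).toLinearMap := by
    rw [injective_iff_map_eq_zero]
    intro v hv
    have hv' : ∀ w, a y₀ v * a y₀ w + curl a y₀ v w = 0 := fun w => DFunLike.congr_fun hv w
    have hR0 := hR y₀ (mem_chart_target (Model n) x₀)
    have h0 : a y₀ v = 0 := by
      have h1 := hv' (α.localReeb x₀ y₀)
      have h2 := DFunLike.congr_fun hR0.1 v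
      rw [hAv, hR0.2, one_mul] at h2
      have h3 : curl a y₀ v (α.localReeb x₀ y₀) = -curl a y₀ (α.localReeb x₀ y₀) v := by
        simp only [curl]; ring
      rw [hR0.2] at h1
      linarith
    have h1 : ∀ w, curl a y₀ v w = 0 := fun w => by simpa [h0] using hv' w
    have hx0 := (chartAt (Model n) x₀).left_inv hsrc
    have h2 : (show Model n from mfderiv 𝓘(ℝ, Model n) 𝓘(ℝ, Model n) (chartAt (Model n) x₀).symm
        (chartAt (Model n) x₀ x₀) v) = (0 : Model n) := by
      have h3 : ∀ v' : TangentSpace 𝓘(ℝ, Model n) x₀,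
          (mfderiv 𝓘(ℝ, Model n) 𝓘(ℝ, Model n) (chartAt (Model n) x₀) x₀ v' : Model n) = v →
          v' = 0 := by
        intro v' hv'
        refine α.nondegenerate x₀ v' ?_ fun w _ => ?_
        · rw [← α.form.local_apply_fderiv hsrc v']
          exact (congrArg (a y₀) hv').trans h0
        · rw [α.d_eq_curl_local hsrc]
          exact (congrArg (fun z => curl a y₀ z _) hv').trans (h1 _)
      refine h3 _ ?_
      have h4 := mfderiv_chart_mfderiv_chart_symm (mem_chart_target (Model n) x₀) v
      have key : ∀ x' : M, x' = x₀ → ∀ z : Model n,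
          (show Model n from mfderiv 𝓘(ℝ, Model n) 𝓘(ℝ, Model n) (chartAt (Model n) x₀) x' z) =
          mfderiv 𝓘(ℝ, Model n) 𝓘(ℝ, Model n) (chartAt (Model n) x₀) x₀ z := by
        rintro _ rfl z; rfl
      exact (key _ hx0 _).symm.trans h4
    have h4 := mfderiv_chart_mfderiv_chart_symm (mem_chart_target (Model n) x₀) v
    rw [← h4]
    refine (congrArg (fun z : Model n => (show Model n from mfderiv 𝓘(ℝ, Model n) 𝓘(ℝ, Model n)
      (chartAt (Model n) x₀) ((chartAt (Model n) x₀).symm y₀) z)) h2).trans ?_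
    exact map_zero _
  have hdim : Module.finrank ℝ (Model n) = Module.finrank ℝ (Model n →L[ℝ] ℝ) := by
    rw [← LinearEquiv.finrank_eq (LinearMap.toContinuousLinearMap (𝕜 := ℝ) (E := Model n) (F' := ℝ))]
    exact (Subspace.dual_finrank_eq (K := ℝ) (V := Model n)).symm
  let e : Model n ≃L[ℝ] (Model n →L[ℝ] ℝ) :=
    (LinearEquiv.ofInjectiveOfFinrankEq (A y₀).toLinearMap hinj hdim).toContinuousLinearEquiv
  have he : (e : Model n →L[ℝ] Model n →L[ℝ] ℝ) = A y₀ := by ext v w; rfl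
  have hinv : ContDiffAt ℝ 1 (fun y => (A y).inverse) y₀ := by
    have h1 : ContDiffAt ℝ 1 ContinuousLinearMap.inverse (A y₀) := he ▸ contDiffAt_map_inverse e
    exact h1.comp y₀ hA
  have hmain : ContDiffAt ℝ 1 (fun y => (A y).inverse (a y)) y₀ :=
    hinv.clm_apply (hsmooth.of_le ENat.LEInfty.out)
  refine hmain.congr_of_eventuallyEq ?_
  have hopen : ∀ᶠ y in 𝓝 y₀, A y ∈ range ((↑) : (Model n ≃L[ℝ] (Model n →L[ℝ] ℝ)) → _) :=
    hA.continuousAt (by rw [← he]; exact ContinuousLinearEquiv.nhds e)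
  filter_upwards [hopen, htgt] with y hy hyt
  obtain ⟨e', he'⟩ := hy
  have h1 := (hR y hyt).1
  rw [← he', ContinuousLinearMap.inverse_equiv, ← h1, ← he']
  simp

/-- In a chart, the metric on `ξ` is bounded below by a multiple of the Euclidean one. -/
theorem ContactForm.CompatibleStructure.exists_metric_lower_bound (J : α.CompatibleStructure)
    (x₀ : M) : ∃ m > 0, ∀ᶠ x in 𝓝 x₀, ∀ v : TangentSpace 𝓘(ℝ, Model n) x, α.form x v = 0 →
      m * norm (E := Model n)
        (mfderiv 𝓘(ℝ, Model n) 𝓘(ℝ, Model n) (chartAt (Model n) x₀) x v) ^ 2 ≤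
        α.form.d x v (J.J x v) := by
  set y₀ := chartAt (Model n) x₀ x₀ with hy₀
  set a : Model n → Model n →L[ℝ] ℝ := α.form.local x₀ with ha
  have hsmooth : ContDiffAt ℝ ∞ a y₀ := α.contDiffAt_local x₀
  let Φ : Model n × Model n → ℝ := fun p => a p.1 p.2 ^ 2 + curlForm a p.1 p.2 (J.localJ x₀ p.1 p.2)
  have hΦc : ∀ v, ContinuousAt Φ (y₀, v) := by
    intro v
    have h1 : ContinuousAt (fun p : Model n × Model n => a p.1) (y₀, v) :=
      ContinuousAt.comp (f := Prod.fst) (g := a) (x := (y₀, v)) hsmooth.continuousAt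
        continuousAt_fst
    have h2 : ContinuousAt (fun p : Model n × Model n => curlForm a p.1) (y₀, v) :=
      ContinuousAt.comp (f := Prod.fst) (g := curlForm a) (x := (y₀, v))
        (contDiffAt_curlForm (k := 1) (m := 2) (hsmooth.of_le ENat.LEInfty.out)
          (by norm_num)).continuousAt continuousAt_fst
    have h3 : ContinuousAt (fun p : Model n × Model n => J.localJ x₀ p.1) (y₀, v) :=
      ContinuousAt.comp (f := Prod.fst) (g := J.localJ x₀) (x := (y₀, v))
        (J.contDiffAt_localJ x₀).continuousAt continuousAt_fst
    exact ((h1.clm_apply continuousAt_snd).pow 2).add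
      ((h2.clm_apply continuousAt_snd).clm_apply (h3.clm_apply continuousAt_snd))
  have hsrc := mem_chart_source (Model n) x₀
  have hΦ : ∀ x ∈ (chartAt (Model n) x₀).source, ∀ v : TangentSpace 𝓘(ℝ, Model n) x,
      Φ (chartAt (Model n) x₀ x, mfderiv 𝓘(ℝ, Model n) 𝓘(ℝ, Model n) (chartAt (Model n) x₀) x v) =
        α.form x v ^ 2 + α.form.d x v (J.J x v) := by
    intro x hx v
    rw [α.d_eq_curl_local hx, ← J.localJ_chart hx, ← α.form.local_apply_fderiv hx]
    rfl
  have hpos : ∀ v ∈ Metric.sphere (0 : Model n) 1, 0 < Φ (y₀, v) := by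
    intro v hv
    obtain ⟨v', hv'⟩ : ∃ v' : TangentSpace 𝓘(ℝ, Model n) x₀,
        (mfderiv 𝓘(ℝ, Model n) 𝓘(ℝ, Model n) (chartAt (Model n) x₀) x₀ v' : Model n) = v := by
      have : IsManifold 𝓘(ℝ, Model n) 1 M := IsManifold.of_le (n := ∞) (by simp)
      exact (mdifferentiable_chart (I := 𝓘(ℝ, Model n)) x₀).mfderiv_surjective hsrc v
    have h1 := hΦ x₀ hsrc v'
    rw [hv'] at h1
    rw [h1]
    rcases eq_or_ne (α.form x₀ v') 0 with h | h
    · have hne : v' ≠ 0 := by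
        rintro rfl
        have h2 : (0 : Model n) = v := (map_zero _).symm.trans hv'
        rw [← h2] at hv
        simp at hv
      have := J.pos x₀ v' h hne
      positivity
    · have := J.d_nonneg x₀ v'
      positivity
  obtain ⟨m, hm, hmin⟩ := (isCompact_sphere (0 : Model n) 1).exists_forall_le'
    (f := fun v => Φ (y₀, v))
    (fun v _ => ((hΦc v).comp (by fun_prop : ContinuousAt (fun v => (y₀, v)) v)).continuousWithinAt)
    hpos
  have hev : ∀ᶠ y in 𝓝 y₀, ∀ v ∈ Metric.sphere (0 : Model n) 1, m / 2 < Φ (y, v) :=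
    (isCompact_sphere (0 : Model n) 1).eventually_forall_of_forall_eventually fun v hv =>
      (hΦc v).eventually (lt_mem_nhds (lt_of_lt_of_le (by linarith) (hmin v hv)))
  refine ⟨m / 2, by positivity, ?_⟩
  have hc : ContinuousAt (chartAt (Model n) x₀) x₀ := (chartAt (Model n) x₀).continuousAt hsrc
  filter_upwards [hc.eventually hev, (chartAt (Model n) x₀).open_source.mem_nhds hsrc]
    with x hx hxs v hv
  set z : Model n := mfderiv 𝓘(ℝ, Model n) 𝓘(ℝ, Model n) (chartAt (Model n) x₀) x v with hz
  have h1 : Φ (chartAt (Model n) x₀ x, z) = α.form x v ^ 2 + α.form.d x v (J.J x v) := hΦ x hxs v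
  have h2 : α.form.d x v (J.J x v) = Φ (chartAt (Model n) x₀ x, z) := by rw [h1, hv]; ring
  rw [h2]
  rcases eq_or_ne z 0 with h0 | h0
  · rw [h0]; simp [Φ]
  · have hnz : 0 < ‖z‖ := norm_pos_iff.2 h0
    have h3 := hx (‖z‖⁻¹ • z) (by simp [norm_smul, hnz.ne'])
    have h4 : Φ (chartAt (Model n) x₀ x, ‖z‖⁻¹ • z) = ‖z‖⁻¹ ^ 2 * Φ (chartAt (Model n) x₀ x, z) := by
      simp only [Φ, map_smul, smul_apply, smul_eq_mul]
      ring
    rw [h4] at h3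
    have h5 : Φ (chartAt (Model n) x₀ x, z) =
        ‖z‖ ^ 2 * (‖z‖⁻¹ ^ 2 * Φ (chartAt (Model n) x₀ x, z)) := by
      field_simp
    rw [h5, mul_comm (m / 2)]
    exact mul_le_mul_of_nonneg_left h3.le (by positivity)

end Reeb

/-! ### The action of loops that approach a Reeb orbit -/

section Loops

variable {n : ℕ} {M : Type*} [TopologicalSpace M] [ChartedSpace (Model n) M]
  [IsManifold 𝓘(ℝ, Model n) ∞ M] {α : ContactForm n M}

/-- The velocity of a curve in `M`. -/
noncomputable abbrev velocity (v : ℝ → M) (t : ℝ) : TangentSpace 𝓘(ℝ, Model n) (v t) :=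
  mfderiv 𝓘(ℝ, ℝ) 𝓘(ℝ, Model n) v t (1 : ℝ)

/-- Near every point of `M` there is a function whose increase along a curve `v` is `∫ v^* α`, up
to a multiple of the length of the `ξ`-component of `v`. -/
theorem ContactForm.CompatibleStructure.exists_local_time (J : α.CompatibleStructure) (x₀ : M) :
    ∃ (τ : M → ℝ) (C : ℝ) (U : Set M), IsOpen U ∧ x₀ ∈ U ∧ ContinuousOn τ U ∧
      ∀ (v : ℝ → M) (k : ℝ → ℝ) (a b : ℝ), a ≤ b →
        (∀ t ∈ Icc a b, MDifferentiableAt 𝓘(ℝ, ℝ) 𝓘(ℝ, Model n) v t ∧ v t ∈ U) →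
        Continuous (fun t => α.form (v t) (velocity v t)) → Continuous k → (∀ t, 0 ≤ k t) →
        (∀ t, α.form.d (v t) (velocity v t) (J.J (v t) (velocity v t)) ≤ k t ^ 2) →
        |τ (v b) - τ (v a) - ∫ t in a..b, α.form (v t) (velocity v t)| ≤
          C * ∫ t in a..b, k t := by
  obtain ⟨m, hm, hlow⟩ := J.exists_metric_lower_bound x₀
  set e := chartAt (Model n) x₀ with he
  have hsrc := mem_chart_source (Model n) x₀
  have hl : α.form.local x₀ (e x₀) (α.localReeb x₀ (e x₀)) = 1 := by
    rw [α.localReeb_chart hsrc]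
    exact (α.form.local_apply_fderiv hsrc _).trans (α.form_reeb x₀)
  obtain ⟨τ, K, V, hVo, hxV, hτ⟩ := exists_timeFunction (α.contDiffAt_localReeb x₀)
    (α.form.local x₀ (e x₀)) hl
  obtain ⟨W, hW, hWo, hxW⟩ := eventually_nhds_iff.1 hlow
  refine ⟨τ ∘ e, K * (Real.sqrt m)⁻¹, (e.source ∩ e ⁻¹' V) ∩ W,
    (e.isOpen_inter_preimage hVo).inter hWo, ⟨⟨hsrc, hxV⟩, hxW⟩, ?_, ?_⟩
  · exact hτ.lipschitz.continuousOn.comp (e.continuousOn.mono fun x hx => hx.1.1)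
      fun x hx => hx.1.2
  · intro v k a b hab hv hg hk hk0 hkd
    have hsm : 0 < Real.sqrt m := Real.sqrt_pos.2 hm
    have := hτ.abs_sub_le (v := fun t => e (v t)) (g := fun t => α.form (v t) (velocity v t))
      (k := fun t => (Real.sqrt m)⁻¹ * k t)
      (e := fun t => mfderiv 𝓘(ℝ, Model n) 𝓘(ℝ, Model n) e (v t) (α.proj (v t) (velocity v t)))
      hab hg (hk.const_mul _) (fun t ht => ?_) (fun t ht => (hv t ht).2.1.2) (fun t ht => ?_)
    · rw [intervalIntegral.integral_const_mul, ← mul_assoc] at this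
      exact this
    · have h1 := hW (v t) (hv t ht).2.2 _ (α.form_proj (v t) (velocity v t))
      rw [J.d_map_proj] at h1
      have h2 := h1.trans (hkd t)
      rw [inv_mul_eq_div, le_div_iff₀ hsm, mul_comm]
      refine abs_le_of_sq_le_sq' ?_ (hk0 t) |>.2
      rw [mul_pow, Real.sq_sqrt hm.le]
      exact h2
    · have hx := (hv t ht).2.1.1
      have h1 : DifferentiableAt ℝ (fun t => e (v t)) t :=
        ((mdifferentiableAt_chart hx).comp t (hv t ht).1).differentiableAt
      have h2 := h1.hasDerivAt
      have h3 : deriv (fun t => e (v t)) t =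
          mfderiv 𝓘(ℝ, Model n) 𝓘(ℝ, Model n) e (v t) (velocity v t) := by
        rw [← fderiv_apply_one_eq_deriv]
        exact fderiv_chart_comp (hv t ht).1 hx 1
      have h4 : deriv (fun t => e (v t)) t = α.form (v t) (velocity v t) • α.localReeb x₀ (e (v t)) +
          (show Model n from
            mfderiv 𝓘(ℝ, Model n) 𝓘(ℝ, Model n) e (v t) (α.proj (v t) (velocity v t))) := by
        rw [h3, α.localReeb_chart hx]
        refine (congrArg (mfderiv 𝓘(ℝ, Model n) 𝓘(ℝ, Model n) e (v t))
          (α.proj_add_reeb (v t) (velocity v t))).symm.trans ?_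
        refine Eq.trans ?_ (add_comm (G := Model n) _ _)
        exact (map_add _ _ _).trans (congrArg₂ _ rfl (map_smul _ _ _))
      rw [h4] at h2
      exact h2

/-- A Reeb trajectory, run with speed `c`. -/
theorem velocity_comp_mul {γ : ℝ → M} (hγ : IsMIntegralCurve (I := 𝓘(ℝ, Model n)) γ α.reeb)
    (c t : ℝ) : MDifferentiableAt 𝓘(ℝ, ℝ) 𝓘(ℝ, Model n) (fun t => γ (c * t)) t ∧
      velocity (fun t => γ (c * t)) t = c • α.reeb (γ (c * t)) := by
  have h1 : HasMFDerivAt 𝓘(ℝ, ℝ) 𝓘(ℝ, ℝ) (fun t : ℝ => c * t) t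
      (c • ContinuousLinearMap.id ℝ ℝ) :=
    HasFDerivAt.hasMFDerivAt ((hasFDerivAt_id t).const_mul c)
  have h2 := (hγ (c * t)).comp t h1
  refine ⟨h2.mdifferentiableAt, ?_⟩
  refine (DFunLike.congr_fun h2.mfderiv (1 : ℝ)).trans ?_
  change (c • (1 : ℝ)) • α.reeb (γ (c * t)) = _
  simp

/-- If loops `w i` converge uniformly to a Reeb trajectory and the lengths of their
`ξ`-components tend to zero, then their actions `∫ (w i)^* α` converge to the action of the limit.
The convergence is uniform in the sense of continuous convergence. -/
theorem ContactForm.CompatibleStructure.tendsto_integral_form (J : α.CompatibleStructure)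
    {γ : ℝ → M} (hγ : IsMIntegralCurve (I := 𝓘(ℝ, Model n)) γ α.reeb) (c : ℝ)
    {ι : Type*} {l : Filter ι} {w : ι → ℝ → M} {k : ι → ℝ → ℝ} {a₀ b₀ : ℝ} (hab₀ : a₀ ≤ b₀)
    (hw : ∀ i t, MDifferentiableAt 𝓘(ℝ, ℝ) 𝓘(ℝ, Model n) (w i) t)
    (hg : ∀ i, Continuous (fun t => α.form (w i t) (velocity (w i) t)))
    (hk : ∀ i, Continuous (k i)) (hk0 : ∀ i t, 0 ≤ k i t)
    (hkd : ∀ i t, α.form.d (w i t) (velocity (w i) t) (J.J (w i t) (velocity (w i) t)) ≤ k i t ^ 2)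
    (hkl : Tendsto (fun i => ∫ t in a₀..b₀, k i t) l (𝓝 0))
    (hconv : ∀ t₀, Tendsto (fun q : ι × ℝ => w q.1 q.2) (l ×ˢ 𝓝 t₀) (𝓝 (γ (c * t₀)))) :
    Tendsto (fun i => ∫ t in a₀..b₀, α.form (w i t) (velocity (w i) t)) l
      (𝓝 (c * (b₀ - a₀))) := by
  have hpt : ∀ t, Tendsto (fun i => w i t) l (𝓝 (γ (c * t))) := fun t =>
    (hconv t).comp (tendsto_id.prodMk (tendsto_const_nhds (x := t)))
  -- the statement for short intervals, by means of a local time function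
  have hloc : ∀ t₀ : ℝ, ∃ V : Set ℝ, IsOpen V ∧ t₀ ∈ V ∧ ∀ a b, a ≤ b → Icc a b ⊆ V →
      Icc a b ⊆ Icc a₀ b₀ →
      Tendsto (fun i => ∫ t in a..b, α.form (w i t) (velocity (w i) t)) l (𝓝 (c * (b - a))) := by
    intro t₀
    obtain ⟨τ, C, U, hUo, hxU, hτc, hτ⟩ := J.exists_local_time (γ (c * t₀))
    have h1 := (hconv t₀).eventually (hUo.mem_nhds hxU)
    obtain ⟨p, hp, q, hq, hpq⟩ := eventually_prod_iff.1 h1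
    have hγc : Continuous fun t => γ (c * t) := hγ.continuous.comp (by fun_prop)
    have h2 : ∀ᶠ t in 𝓝 t₀, γ (c * t) ∈ U := hγc.continuousAt.eventually (hUo.mem_nhds hxU)
    obtain ⟨V, hV, hVo, htV⟩ := eventually_nhds_iff.1 (hq.and h2)
    refine ⟨V, hVo, htV, fun a b hab hVab hI => ?_⟩
    have hγτ : τ (γ (c * b)) - τ (γ (c * a)) = c * (b - a) := by
      have hval : ∀ t, α.form (γ (c * t)) (velocity (fun t => γ (c * t)) t) = c := by
        intro t
        rw [(velocity_comp_mul hγ c t).2, map_smul, α.form_reeb]; simp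
      have h3 := hτ (fun t => γ (c * t)) (fun _ => 0) a b hab
        (fun t ht => ⟨(velocity_comp_mul hγ c t).1, (hV t (hVab ht)).2⟩)
        (by simp only [hval]; exact continuous_const) continuous_const (fun _ => le_rfl)
        (fun t => by
          rw [(velocity_comp_mul hγ c t).2, OneForm.d_smul_left, α.d_reeb_left]; simp)
      simp only [hval, intervalIntegral.integral_const, smul_eq_mul, mul_zero, abs_nonpos_iff] at h3
      linarith
    have hτw : ∀ t ∈ Icc a b, Tendsto (fun i => τ (w i t)) l (𝓝 (τ (γ (c * t)))) := fun t ht =>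
      ((hτc.continuousAt (hUo.mem_nhds (hV t (hVab ht)).2)).tendsto.comp (hpt t))
    have hsub : Tendsto (fun i => C * ∫ t in a..b, k i t) l (𝓝 0) := by
      have ha := hI (left_mem_Icc.2 hab)
      have hb := hI (right_mem_Icc.2 hab)
      have : Tendsto (fun i => ∫ t in a..b, k i t) l (𝓝 0) := by
        refine squeeze_zero (fun i => intervalIntegral.integral_nonneg hab fun t _ => hk0 i t)
          (fun i => ?_) hkl
        exact intervalIntegral.integral_mono_interval ha.1 hab hb.2
          (Eventually.of_forall fun t => hk0 i t) ((hk i).intervalIntegrable _ _)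
      simpa using this.const_mul C
    have hdiff : Tendsto (fun i => τ (w i b) - τ (w i a) -
        ∫ t in a..b, α.form (w i t) (velocity (w i) t)) l (𝓝 0) := by
      refine squeeze_zero_norm' ?_ hsub
      filter_upwards [hp] with i hi
      exact hτ (w i) (k i) a b hab (fun t ht => ⟨hw i t, hpq hi (hV t (hVab ht)).1⟩) (hg i) (hk i)
        (hk0 i) (hkd i)
    have h4 := ((hτw b (right_mem_Icc.2 hab)).sub (hτw a (left_mem_Icc.2 hab))).sub hdiff
    rw [hγτ, sub_zero] at h4
    refine h4.congr fun i => ?_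
    ring
  -- subdivision of `[a₀, b₀]` into short intervals
  choose V hVo hVt hV using hloc
  obtain ⟨t, ht0, htm, ⟨N, hN⟩, htV⟩ := exists_monotone_Icc_subset_open_cover_Icc hab₀
    (c := fun t => Subtype.val ⁻¹' V t) (fun t => (hVo t).preimage continuous_subtype_val)
    (fun t _ => mem_iUnion.2 ⟨t, hVt t⟩)
  have hind : ∀ m, Tendsto (fun i => ∫ s in a₀..t m, α.form (w i s) (velocity (w i) s)) l
      (𝓝 (c * (t m - a₀))) := by
    intro m
    induction m with
    | zero => simpa [ht0] using tendsto_const_nhds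
    | succ m ih =>
      obtain ⟨j, hj⟩ := htV m
      have hle : (t m : ℝ) ≤ t (m + 1) := htm (Nat.le_succ m)
      have hI : Icc (t m : ℝ) (t (m + 1)) ⊆ Icc a₀ b₀ :=
        Icc_subset_Icc (t m).2.1 (t (m + 1)).2.2
      have h1 := hV j (t m) (t (m + 1)) hle
        (fun s hs => hj (show (⟨s, hI hs⟩ : Icc a₀ b₀) ∈ Icc (t m) (t (m + 1)) from hs)) hI
      have h2 := ih.add h1
      rw [← mul_add, sub_add_sub_cancel'] at h2
      refine h2.congr fun i => ?_
      exact intervalIntegral.integral_add_adjacent_intervals ((hg i).intervalIntegrable _ _)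
        ((hg i).intervalIntegrable _ _)
  have := hind N
  rwa [hN N le_rfl] at this

end Loops

/-! ### Half-cylinders of finite energy -/

section Cylinder

/-- The action of the circles of a half-cylinder of finite energy does not stay below the period
of its asymptotic orbit. In the application, at the coordinate `s` of the half-cylinder, `f` is the
action of the circle, `A` the integral over it of the `ℝ`-component of the curve, and `d`, `e`, `n`,
`y` are the integrals over it of `dα`, of the energy density, of the Reeb component of `ν` and of
the squared `ξ`-component of the velocity of the circle.

If `f` were very negative somewhere, it would remain so and drive `A` to `+∞`; so `f` is bounded
below, hence `y` has finite integral, so that it is small for suitable `s → -∞`. -/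
theorem eventually_le_action {s₀ T C : ℝ} {f A d e n y : ℝ → ℝ}
    (hdc : ContinuousOn d (Iio s₀)) (hec : ContinuousOn e (Iio s₀))
    (hfc : ContinuousOn f (Iio s₀)) (hnc : ContinuousOn n (Iio s₀))
    (hyc : ContinuousOn y (Iio s₀))
    (hf : ∀ s₁ s₂, s₁ ≤ s₂ → s₂ < s₀ → ∫ s in s₁..s₂, d s = f s₂ - f s₁)
    (hA : ∀ s₁ s₂, s₁ ≤ s₂ → s₂ < s₀ → ∫ s in s₁..s₂, (f s - n s) = A s₂ - A s₁)
    (hAlim : Tendsto A atBot atBot)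
    (he : ∀ s < s₀, 0 ≤ e s) (hed : ∀ s < s₀, -4 * d s ≤ e s) (hy : ∀ s < s₀, 0 ≤ y s)
    (hey : ∀ s < s₀, y s - 2 * d s ≤ e s)
    (hn : ∀ κ > 0, ∀ s < s₀, -(κ + Real.pi / (2 * κ) * e s) ≤ n s)
    (hC : ∀ s₁ s₂, s₁ ≤ s₂ → s₂ < s₀ → ∫ s in s₁..s₂, e s ≤ C)
    (hloop : ∀ σ : ℕ → ℝ, (∀ k, σ k < s₀) → Tendsto σ atTop atBot →
      Tendsto (fun k => y (σ k)) atTop (𝓝 0) → Tendsto (fun k => f (σ k)) atTop (𝓝 T)) :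
    ∀ ε > 0, ∃ S < s₀, ∀ s ≤ S, T - ε ≤ f s := by
  have hsub : ∀ {s₁ s₂}, s₁ ≤ s₂ → s₂ < s₀ → uIcc s₁ s₂ ⊆ Iio s₀ := fun h1 h2 s hs =>
    lt_of_le_of_lt (by rw [uIcc_of_le h1] at hs; exact hs.2) h2
  have hI : ∀ {g : ℝ → ℝ}, ContinuousOn g (Iio s₀) → ∀ {s₁ s₂}, s₁ ≤ s₂ → s₂ < s₀ →
      IntervalIntegrable g volume s₁ s₂ := fun hg _ _ h1 h2 =>
    (hg.mono (hsub h1 h2)).intervalIntegrable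
  -- the action is almost increasing
  have hdrop : ∀ {s₁ s₂}, s₁ ≤ s₂ → s₂ < s₀ → f s₁ - (1 / 4) * ∫ s in s₁..s₂, e s ≤ f s₂ := by
    intro s₁ s₂ h1 h2
    have h3 : ∫ s in s₁..s₂, -(1 / 4) * e s ≤ ∫ s in s₁..s₂, d s :=
      intervalIntegral.integral_mono_on h1 ((hI hec h1 h2).const_mul _) (hI hdc h1 h2)
        fun s hs => by linarith [hed s (lt_of_le_of_lt hs.2 h2)]
    rw [intervalIntegral.integral_const_mul, hf s₁ s₂ h1 h2] at h3
    linarith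
  have hC0 : 0 ≤ C := by simpa using hC (s₀ - 1) (s₀ - 1) le_rfl (by linarith)
  -- the action is bounded below
  have hlow : ∀ s < s₀, -(C / 4) ≤ f s := by
    intro s hs
    by_contra! hcon
    set δ := -(C / 4) - f s with hδ
    have hδ0 : 0 < δ := by linarith
    have hAlow : ∀ s' ≤ s, A s - Real.pi / (2 * (δ / 2)) * C ≤ A s' := by
      intro s' hs'
      have h1 : ∫ t in s'..s, (f t - n t) ≤
          ∫ t in s'..s, (Real.pi / (2 * (δ / 2)) * e t - δ / 2) := by
        refine intervalIntegral.integral_mono_on hs' ((hI hfc hs' hs).sub (hI hnc hs' hs))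
          (((hI hec hs' hs).const_mul _).sub (intervalIntegrable_const)) fun t ht => ?_
        have hts : t < s₀ := lt_of_le_of_lt ht.2 hs
        have h2 := hdrop ht.2 hs
        have h3 := hC t s ht.2 hs
        have h4 := hn (δ / 2) (by positivity) t hts
        linarith
      rw [hA s' s hs' hs, intervalIntegral.integral_sub ((hI hec hs' hs).const_mul _)
        intervalIntegrable_const, intervalIntegral.integral_const_mul,
        intervalIntegral.integral_const, smul_eq_mul] at h1
      have h5 : Real.pi / (2 * (δ / 2)) * ∫ t in s'..s, e t ≤ Real.pi / (2 * (δ / 2)) * C :=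
        mul_le_mul_of_nonneg_left (hC s' s hs' hs) (by positivity)
      have h6 : 0 ≤ (s - s') * (δ / 2) := mul_nonneg (by linarith) (by linarith)
      linarith
    obtain ⟨s', h1, h2⟩ := ((hAlim.eventually (eventually_lt_atBot
      (A s - Real.pi / (2 * (δ / 2)) * C))).and (eventually_le_atBot s)).exists
    exact absurd (hAlow s' h2) (not_le.2 h1)
  -- the length of the `ξ`-components becomes small along a sequence
  have hsmall : ∀ ε > 0, ∀ S < s₀, ∃ s ≤ S, y s < ε := by
    intro ε hε S hS
    by_contra! hcon
    have h1 : ∀ s ≤ S, ε * (S - s) ≤ C + 2 * (f S + C / 4) := by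
      intro s hs
      have h2 : ∫ t in s..S, ε ≤ ∫ t in s..S, y t :=
        intervalIntegral.integral_mono_on hs intervalIntegrable_const (hI hyc hs hS)
          fun t ht => hcon t ht.2
      have h3 : ∫ t in s..S, y t ≤ ∫ t in s..S, (e t + 2 * d t) :=
        intervalIntegral.integral_mono_on hs (hI hyc hs hS)
          ((hI hec hs hS).add ((hI hdc hs hS).const_mul _))
          fun t ht => by linarith [hey t (lt_of_le_of_lt ht.2 hS)]
      rw [intervalIntegral.integral_add (hI hec hs hS) ((hI hdc hs hS).const_mul _),
        intervalIntegral.integral_const_mul, hf s S hs hS] at h3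
      rw [intervalIntegral.integral_const, smul_eq_mul] at h2
      have h4 := hC s S hs hS
      have h5 := hlow s (lt_of_le_of_lt hs hS)
      linarith
    set B := C + 2 * (f S + C / 4) with hB
    have hB0 : 0 ≤ B := by simpa using h1 S le_rfl
    have h2 := h1 (S - (B + 1) / ε) (by linarith [show 0 ≤ (B + 1) / ε by positivity])
    rw [sub_sub_cancel, mul_div_cancel₀ _ hε.ne'] at h2
    linarith
  choose σ hσ hσy using fun k : ℕ => hsmall (1 / ((k : ℝ) + 1)) (by positivity)
    (min (-(k : ℝ)) (s₀ - 1)) (lt_of_le_of_lt (min_le_right _ _) (by linarith))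
  have hσ0 : ∀ k, σ k < s₀ := fun k => by linarith [(hσ k).trans (min_le_right _ _)]
  have hσlim : Tendsto σ atTop atBot :=
    tendsto_atBot_mono (fun k => (hσ k).trans (min_le_left _ _))
      (tendsto_neg_atTop_atBot.comp tendsto_natCast_atTop_atTop)
  have hfσ := hloop σ hσ0 hσlim (squeeze_zero (fun k => hy _ (hσ0 k)) (fun k => (hσy k).le)
    tendsto_one_div_add_atTop_nhds_zero_nat)
  -- the energy of the ends tends to zero
  intro ε hε
  have htail : ∃ S < s₀, ∀ s ≤ S, ∫ t in s..S, e t ≤ ε := by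
    by_contra! hcon
    have h1 : ∀ m : ℕ, ∃ s < s₀, m * ε ≤ ∫ t in s..(s₀ - 1), e t ∧ s ≤ s₀ - 1 := by
      intro m
      induction m with
      | zero => exact ⟨s₀ - 1, by linarith, by simp, le_rfl⟩
      | succ m ih =>
        obtain ⟨S, hS, hm, hS1⟩ := ih
        obtain ⟨s, hs, hlt⟩ := hcon S hS
        refine ⟨s, lt_of_le_of_lt hs hS, ?_, hs.trans hS1⟩
        rw [← intervalIntegral.integral_add_adjacent_intervals (hI hec hs hS)
          (hI hec hS1 (by linarith))]
        push_cast
        linarith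
    obtain ⟨m, hm⟩ := exists_nat_gt (C / ε)
    obtain ⟨s, hs, h2, h3⟩ := h1 m
    rw [div_lt_iff₀ hε] at hm
    linarith [hC s (s₀ - 1) h3 (by linarith)]
  obtain ⟨S, hS, hSe⟩ := htail
  refine ⟨S, hS, fun s hs => ?_⟩
  have hs0 : s < s₀ := lt_of_le_of_lt hs hS
  refine le_of_tendsto (hfσ.sub_const ε) ?_
  filter_upwards [hσlim.eventually (eventually_le_atBot s)] with k hk
  have h1 := hdrop hk hs0
  have h2 : ∫ t in σ k..s, e t ≤ ∫ t in σ k..S, e t := by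
    rw [← intervalIntegral.integral_add_adjacent_intervals (hI hec hk hs0) (hI hec hs hS)]
    have := intervalIntegral.integral_nonneg hs
      (f := e) (μ := volume) fun t ht => he t (lt_of_le_of_lt ht.2 hS)
    linarith
  have h3 := hSe (σ k) (hk.trans hs)
  linarith

end Cylinder

/-! ### Riemann surfaces as real surfaces -/

section RealStructure

variable {S : Type*} [TopologicalSpace S] [ChartedSpace ℂ S]
  {S' : Type*} [TopologicalSpace S'] [ChartedSpace ℂ S']

theorem contMDiffAt_real {f : S → S'} {x : S} {k : WithTop ℕ∞}
    (h : ContMDiffAt 𝓘(ℂ, ℂ) 𝓘(ℂ, ℂ) k f x) : ContMDiffAt 𝓘(ℝ, ℂ) 𝓘(ℝ, ℂ) k f x := by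
  rw [contMDiffAt_iff] at h ⊢
  exact ⟨h.1, h.2.restrict_scalars ℝ⟩

theorem hasMFDerivAt_real {f : S → S'} {x : S}
    {f' : ℂ →L[ℂ] ℂ} (h : HasMFDerivAt 𝓘(ℂ, ℂ) 𝓘(ℂ, ℂ) f x f') :
    HasMFDerivAt 𝓘(ℝ, ℂ) 𝓘(ℝ, ℂ) f x (f'.restrictScalars ℝ : ℂ →L[ℝ] ℂ) :=
  ⟨h.1, HasFDerivWithinAt.restrictScalars ℝ h.2⟩

/-- Holomorphic maps have complex linear differentials. -/
theorem mfderiv_mul_of_holomorphic {f : S → S'} {x : S}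
    (h : MDifferentiableAt 𝓘(ℂ, ℂ) 𝓘(ℂ, ℂ) f x) (c v : ℂ) :
    (mfderiv 𝓘(ℝ, ℂ) 𝓘(ℝ, ℂ) f x (c * v : ℂ) : ℂ) =
      c * (show ℂ from mfderiv 𝓘(ℝ, ℂ) 𝓘(ℝ, ℂ) f x v) := by
  have h1 := (hasMFDerivAt_real h.hasMFDerivAt).mfderiv
  refine (DFunLike.congr_fun h1 (c * v)).trans ?_
  refine Eq.trans ?_ (congrArg (fun z : ℂ => c * z) (DFunLike.congr_fun h1 v)).symm
  exact map_smul (show ℂ →L[ℂ] ℂ from mfderiv 𝓘(ℂ, ℂ) 𝓘(ℂ, ℂ) f x) c v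

theorem isManifold_real [IsManifold 𝓘(ℂ, ℂ) ω S] : IsManifold 𝓘(ℝ, ℂ) ∞ S := by
  refine isManifold_of_contDiffOn 𝓘(ℝ, ℂ) ∞ S fun e e' he he' => ?_
  have h := contMDiffOn_of_mem_contDiffGroupoid
    ((contDiffGroupoid ω 𝓘(ℂ, ℂ)).compatible he he')
  have h1 : ContDiffOn ℂ ω (e.symm ≫ₕ e') (e.symm ≫ₕ e').source := contMDiffOn_iff_contDiffOn.1 h
  have h2 := (h1.restrict_scalars ℝ).of_le (le_top : (∞ : WithTop ℕ∞) ≤ ω)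
  simpa using h2

variable {e e' : OpenPartialHomeomorph S ℂ}

theorem IsHolomorphicChart.contMDiffAt (he : IsHolomorphicChart e) {x : S} (hx : x ∈ e.source) :
    ContMDiffAt 𝓘(ℂ, ℂ) 𝓘(ℂ, ℂ) ω e x :=
  contMDiffAt_of_mem_maximalAtlas he hx

theorem IsHolomorphicChart.contMDiffAt_symm (he : IsHolomorphicChart e) {y : ℂ}
    (hy : y ∈ e.target) : ContMDiffAt 𝓘(ℂ, ℂ) 𝓘(ℂ, ℂ) ω e.symm y :=
  contMDiffAt_symm_of_mem_maximalAtlas he hy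

theorem IsHolomorphicChart.contMDiffAt_real (he : IsHolomorphicChart e) {x : S}
    (hx : x ∈ e.source) : ContMDiffAt 𝓘(ℝ, ℂ) 𝓘(ℝ, ℂ) ∞ e x :=
  (SymplectizationCurve.contMDiffAt_real (he.contMDiffAt hx)).of_le le_top

theorem IsHolomorphicChart.contMDiffAt_symm_real (he : IsHolomorphicChart e) {y : ℂ}
    (hy : y ∈ e.target) : ContMDiffAt 𝓘(ℝ, ℂ) 𝓘(ℝ, ℂ) ∞ e.symm y :=
  (SymplectizationCurve.contMDiffAt_real (he.contMDiffAt_symm hy)).of_le le_top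

/-- Transition maps are holomorphic. -/
theorem IsHolomorphicChart.differentiableAt_trans (he : IsHolomorphicChart e)
    (he' : IsHolomorphicChart e') {y : ℂ} (hy : y ∈ e.target) (hy' : e.symm y ∈ e'.source) :
    DifferentiableAt ℂ (fun y => e' (e.symm y)) y := by
  have h := (he'.contMDiffAt hy').comp y (he.contMDiffAt_symm hy)
  exact (contMDiffAt_iff_contDiffAt.1 h).differentiableAt (by simp)

/-- Composing a holomorphic chart with a branch of the logarithm gives a holomorphic chart. -/
theorem IsHolomorphicChart.trans_log [IsManifold 𝓘(ℂ, ℂ) ω S] (he : IsHolomorphicChart e) :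
    IsHolomorphicChart (e.trans Complex.expOpenPartialHomeomorph.symm) := by
  refine OpenPartialHomeomorph.mem_maximalAtlas_of_contMDiffOn _ ?_ ?_
  · intro x hx
    rw [OpenPartialHomeomorph.trans_source] at hx
    have h1 : ContMDiffAt 𝓘(ℂ, ℂ) 𝓘(ℂ, ℂ) ω Complex.log (e x) :=
      (Complex.contDiffAt_log hx.2).contMDiffAt
    exact (h1.comp x (he.contMDiffAt hx.1)).contMDiffWithinAt
  · intro y hy
    rw [OpenPartialHomeomorph.trans_target] at hy
    have h1 : ContMDiffAt 𝓘(ℂ, ℂ) 𝓘(ℂ, ℂ) ω Complex.exp y :=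
      Complex.contDiff_exp.contDiffAt.contMDiffAt
    exact (ContMDiffAt.comp y (he.contMDiffAt_symm hy.2) h1).contMDiffWithinAt

end RealStructure

/-! ### The energy density -/

section Energy

variable {n : ℕ} {M : Type*} [TopologicalSpace M] [ChartedSpace (Model n) M]
  [IsManifold 𝓘(ℝ, Model n) ∞ M] {α : ContactForm n M}

theorem ContactForm.CompatibleStructure.form_map (J : α.CompatibleStructure) (x : M)
    (v : TangentSpace 𝓘(ℝ, Model n) x) : α.form x (J.J x v) = 0 := by
  rw [← J.map_proj]
  exact J.map_ker x _ (α.form_proj x v)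

theorem ContactForm.CompatibleStructure.map_map (J : α.CompatibleStructure) (x : M)
    (v : TangentSpace 𝓘(ℝ, Model n) x) : J.J x (J.J x v) = -α.proj x v := by
  rw [← J.map_proj x v]
  exact J.sq x _ (α.form_proj x v)

theorem ContactForm.CompatibleStructure.d_map_map (J : α.CompatibleStructure) (x : M)
    (v w : TangentSpace 𝓘(ℝ, Model n) x) :
    α.form.d x (J.J x v) (J.J x w) = α.form.d x v w := by
  rw [← J.map_proj x v, ← J.map_proj x w, J.preserves x _ _ (α.form_proj x v) (α.form_proj x w),
    α.d_proj]

theorem ContactForm.d_proj_right (α : ContactForm n M) (x : M)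
    (v w : TangentSpace 𝓘(ℝ, Model n) x) : α.form.d x v (α.proj x w) = α.form.d x v w := by
  rw [ContactForm.proj, sub_eq_add_neg, ← neg_smul, OneForm.d_add_right, OneForm.d_smul_right,
    α.d_reeb_right]
  ring

/-- `|Y - J X|² = |X|² + |Y|² - 2 dα(X, Y)` on `ξ`. -/
theorem ContactForm.CompatibleStructure.d_sub_map (J : α.CompatibleStructure) (x : M) (c : ℝ)
    (X Y : TangentSpace 𝓘(ℝ, Model n) x) :
    α.form.d x (Y + (c • α.reeb x + -J.J x X)) (J.J x (Y + (c • α.reeb x + -J.J x X))) =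
      α.form.d x X (J.J x X) + α.form.d x Y (J.J x Y) - 2 * α.form.d x X Y := by
  have h1 : J.J x (Y + (c • α.reeb x + -J.J x X)) = J.J x Y + α.proj x X := by
    rw [map_add, map_add, map_smul, J.map_reeb, map_neg, J.map_map]; simp
  have h2 : ∀ w, α.form.d x (-J.J x X) w = -α.form.d x (J.J x X) w := fun w => by
    rw [← neg_one_smul ℝ (J.J x X), OneForm.d_smul_left]; ring
  rw [h1]
  simp only [OneForm.d_add_left, OneForm.d_add_right, OneForm.d_smul_left, α.d_reeb_left,
    α.d_proj_right, h2, J.d_map_map]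
  rw [α.form.d_swap x Y X, α.form.d_swap x (J.J x X) X]
  ring

/-- The inequality `|Y + J X|² ≥ 0` on `ξ`, expanded. -/
theorem ContactForm.CompatibleStructure.two_d_le (J : α.CompatibleStructure) (x : M)
    (X Y : TangentSpace 𝓘(ℝ, Model n) x) :
    -(2 * α.form.d x X Y) ≤ α.form.d x X (J.J x X) + α.form.d x Y (J.J x Y) := by
  have h1 := J.d_sub_map x 0 (-X) Y
  have h2 := J.d_nonneg x (Y + ((0 : ℝ) • α.reeb x + -J.J x (-X)))
  have h3 : ∀ w, α.form.d x (-X) w = -α.form.d x X w := fun w => by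
    rw [← neg_one_smul ℝ X, OneForm.d_smul_left]; ring
  have h4 : α.form.d x X (J.J x (-X)) = -α.form.d x X (J.J x X) := by
    rw [map_neg, ← neg_one_smul ℝ (J.J x X), OneForm.d_smul_right]; ring
  rw [h1, h3, h3, h4] at h2
  linarith

theorem ContactForm.CompatibleStructure.metricG_nonneg (J : α.CompatibleStructure) (p : ℝ × M)
    (V : SymplTangent (n := n) p) : 0 ≤ J.metricG p V V := by
  have := J.d_nonneg p.2 V.2
  have h1 := mul_self_nonneg V.1
  have h2 := mul_self_nonneg (α.form p.2 V.2)
  simp only [metricG]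
  linarith

/-- The squared `G`-length of `W₂ - J W₁`, for tangent vectors `Wᵢ = sᵢ ∂/∂t + Xᵢ`. -/
theorem ContactForm.CompatibleStructure.metricG_sub (J : α.CompatibleStructure) (p : ℝ × M)
    (s₁ s₂ : ℝ) (X₁ X₂ : TangentSpace 𝓘(ℝ, Model n) p.2) (V : SymplTangent (n := n) p)
    (hV₁ : V.1 = s₂ + α.form p.2 X₁) (hV₂ : V.2 = X₂ + ((-s₁) • α.reeb p.2 + -J.J p.2 X₁)) :
    J.metricG p V V = (s₂ + α.form p.2 X₁) ^ 2 + (α.form p.2 X₂ - s₁) ^ 2 +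
      (α.form.d p.2 X₁ (J.J p.2 X₁) + α.form.d p.2 X₂ (J.J p.2 X₂) - 2 * α.form.d p.2 X₁ X₂) := by
  have hα : α.form p.2 V.2 = α.form p.2 X₂ - s₁ := by
    rw [hV₂, map_add, map_add, map_smul, map_neg, J.form_map, α.form_reeb, smul_eq_mul]; ring
  unfold metricG
  rw [hα, hV₁, hV₂, J.d_sub_map]
  ring

/-- The components of `W₂ - J W₁`. The components of the `Wᵢ` enter through equations, since those
of the differential of a curve are only propositionally the differentials of its components. -/
theorem ContactForm.CompatibleStructure.add_symplJ_neg (J : α.CompatibleStructure) (p : ℝ × M)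
    {W₁ W₂ V : SymplTangent (n := n) p} (hV : V = W₂ + J.symplJ p (-W₁)) {s₁ s₂ : ℝ}
    {X₁ X₂ : TangentSpace 𝓘(ℝ, Model n) p.2} (hs₁ : W₁.1 = s₁) (hs₂ : W₂.1 = s₂)
    (hX₁ : W₁.2 = X₁) (hX₂ : W₂.2 = X₂) :
    V.1 = s₂ + α.form p.2 X₁ ∧ V.2 = X₂ + ((-s₁) • α.reeb p.2 + -J.J p.2 X₁) := by
  subst hV hs₁ hs₂ hX₁ hX₂
  refine ⟨congrArg (fun c : ℝ => W₂.1 + c) ?_,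
    congrArg₂ (fun v w : TangentSpace 𝓘(ℝ, Model n) p.2 => v + w) rfl ?_⟩
  · exact (congrArg (fun c : ℝ => -c) (map_neg (α.form p.2) _)).trans (neg_neg _)
  · exact congrArg₂ (fun v w : TangentSpace 𝓘(ℝ, Model n) p.2 => v + w) rfl (map_neg (J.J p.2) _)

end Energy

section CurveEnergy

variable {n : ℕ} {M : Type*} [TopologicalSpace M] [ChartedSpace (Model n) M]

theorem mfderiv_fst_comp {W : ℂ → ℝ × M} {ζ : ℂ}
    (hW : MDifferentiableAt 𝓘(ℝ, ℂ) (𝓘(ℝ, ℝ).prod 𝓘(ℝ, Model n)) W ζ) (v : ℂ) :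
    (mfderiv 𝓘(ℝ, ℂ) (𝓘(ℝ, ℝ).prod 𝓘(ℝ, Model n)) W ζ v).1 =
      fderiv ℝ (fun ζ => (W ζ).1) ζ v := by
  have h := (hasMFDerivAt_fst (I := 𝓘(ℝ, ℝ)) (I' := 𝓘(ℝ, Model n)) (W ζ)).comp ζ hW.hasMFDerivAt
  rw [← mfderiv_eq_fderiv]
  exact (DFunLike.congr_fun h.mfderiv v).symm

theorem mfderiv_snd_comp {W : ℂ → ℝ × M} {ζ : ℂ}
    (hW : MDifferentiableAt 𝓘(ℝ, ℂ) (𝓘(ℝ, ℝ).prod 𝓘(ℝ, Model n)) W ζ) (v : ℂ) :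
    (mfderiv 𝓘(ℝ, ℂ) (𝓘(ℝ, ℝ).prod 𝓘(ℝ, Model n)) W ζ v).2 =
      mfderiv 𝓘(ℝ, ℂ) 𝓘(ℝ, Model n) (fun ζ => (W ζ).2) ζ v := by
  have h := (hasMFDerivAt_snd (I := 𝓘(ℝ, ℝ)) (I' := 𝓘(ℝ, Model n)) (W ζ)).comp ζ hW.hasMFDerivAt
  exact (DFunLike.congr_fun h.mfderiv v).symm

variable [IsManifold 𝓘(ℝ, Model n) ∞ M] {α : ContactForm n M}
  {S : Type*} [TopologicalSpace S] [ChartedSpace ℂ S]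

/-- The squared length of `ν(∂/∂y)` in the coordinate `x + i y` given by the parametrisation `P`.
It is a lower bound for the squared operator norm of `ν`, and unlike the latter it is plainly
continuous. As `ν` is complex antilinear, the two agree where `ν` has the form `du + J ∘ du ∘ j`. -/
noncomputable def energyDensity (J : α.CompatibleStructure) (u : S → ℝ × M)
    (ν : (z : S) → TangentSpace 𝓘(ℝ, ℂ) z →L[ℝ] SymplTangent (n := n) (u z)) (P : ℂ → S)
    (ζ : ℂ) : ℝ :=
  J.metricG (u (P ζ)) (ν (P ζ) (mfderiv 𝓘(ℝ, ℂ) 𝓘(ℝ, ℂ) P ζ Complex.I))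
    (ν (P ζ) (mfderiv 𝓘(ℝ, ℂ) 𝓘(ℝ, ℂ) P ζ Complex.I))

theorem energyDensity_nonneg (J : α.CompatibleStructure) (u : S → ℝ × M)
    (ν : (z : S) → TangentSpace 𝓘(ℝ, ℂ) z →L[ℝ] SymplTangent (n := n) (u z)) (P : ℂ → S)
    (ζ : ℂ) : 0 ≤ energyDensity J u ν P ζ :=
  J.metricG_nonneg _ _

theorem ofReal_energyDensity_le (J : α.CompatibleStructure) (u : S → ℝ × M)
    (ν : (z : S) → TangentSpace 𝓘(ℝ, ℂ) z →L[ℝ] SymplTangent (n := n) (u z))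
    (e : OpenPartialHomeomorph S ℂ) (ζ : ℂ) :
    ENNReal.ofReal (energyDensity J u ν e.symm ζ) ≤ normSqInChart J u ν e ζ :=
  le_iSup₂_of_le (f := fun (w : ℂ) (_ : ‖w‖ = 1) => ENNReal.ofReal (J.metricG (u (e.symm ζ))
    (ν (e.symm ζ) (mfderiv 𝓘(ℝ, ℂ) 𝓘(ℝ, ℂ) e.symm ζ w))
    (ν (e.symm ζ) (mfderiv 𝓘(ℝ, ℂ) 𝓘(ℝ, ℂ) e.symm ζ w)))) Complex.I (by simp) le_rfl

/-- The energy density in terms of the components of the curve. -/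
theorem energyDensity_eq (J : α.CompatibleStructure) {u : S → ℝ × M}
    {ν : (z : S) → TangentSpace 𝓘(ℝ, ℂ) z →L[ℝ] SymplTangent (n := n) (u z)} {P : ℂ → S} {ζ : ℂ}
    (hP : MDifferentiableAt 𝓘(ℂ, ℂ) 𝓘(ℂ, ℂ) P ζ)
    (hu : MDifferentiableAt 𝓘(ℝ, ℂ) (𝓘(ℝ, ℝ).prod 𝓘(ℝ, Model n)) u (P ζ))
    (hν : differential u (P ζ) +
      ((J.symplJ (u (P ζ))).comp (differential u (P ζ))).comp (complexStructure (P ζ)) = ν (P ζ)) :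
    energyDensity J u ν P ζ =
      (fderiv ℝ (fun ζ => (u (P ζ)).1) ζ Complex.I +
        α.form.pull (fun ζ => (u (P ζ)).2) ζ 1) ^ 2 +
      (α.form.pull (fun ζ => (u (P ζ)).2) ζ Complex.I -
        fderiv ℝ (fun ζ => (u (P ζ)).1) ζ 1) ^ 2 +
      (α.form.d (u (P ζ)).2 (mfderiv 𝓘(ℝ, ℂ) 𝓘(ℝ, Model n) (fun ζ => (u (P ζ)).2) ζ (1 : ℂ))
          (J.J _ (mfderiv 𝓘(ℝ, ℂ) 𝓘(ℝ, Model n) (fun ζ => (u (P ζ)).2) ζ (1 : ℂ))) +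
        α.form.d (u (P ζ)).2 (mfderiv 𝓘(ℝ, ℂ) 𝓘(ℝ, Model n) (fun ζ => (u (P ζ)).2) ζ Complex.I)
          (J.J _ (mfderiv 𝓘(ℝ, ℂ) 𝓘(ℝ, Model n) (fun ζ => (u (P ζ)).2) ζ Complex.I)) -
        2 * α.form.d (u (P ζ)).2
          (mfderiv 𝓘(ℝ, ℂ) 𝓘(ℝ, Model n) (fun ζ => (u (P ζ)).2) ζ (1 : ℂ))
          (mfderiv 𝓘(ℝ, ℂ) 𝓘(ℝ, Model n) (fun ζ => (u (P ζ)).2) ζ Complex.I)) := by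
  have hPr := (hasMFDerivAt_real hP.hasMFDerivAt).mdifferentiableAt
  have hW : MDifferentiableAt 𝓘(ℝ, ℂ) (𝓘(ℝ, ℝ).prod 𝓘(ℝ, Model n)) (fun ζ => u (P ζ)) ζ :=
    MDifferentiableAt.comp ζ hu hPr
  have hchain : ∀ v : ℂ, mfderiv 𝓘(ℝ, ℂ) (𝓘(ℝ, ℝ).prod 𝓘(ℝ, Model n)) u (P ζ)
      (mfderiv 𝓘(ℝ, ℂ) 𝓘(ℝ, ℂ) P ζ v) =
      mfderiv 𝓘(ℝ, ℂ) (𝓘(ℝ, ℝ).prod 𝓘(ℝ, Model n)) (fun ζ => u (P ζ)) ζ v := fun v =>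
    (DFunLike.congr_fun (mfderiv_comp ζ hu hPr) v).symm
  have hj : complexStructure (P ζ) (mfderiv 𝓘(ℝ, ℂ) 𝓘(ℝ, ℂ) P ζ Complex.I) =
      -(mfderiv 𝓘(ℝ, ℂ) 𝓘(ℝ, ℂ) P ζ (1 : ℂ)) := by
    have h1 := mfderiv_mul_of_holomorphic hP Complex.I Complex.I
    rw [Complex.I_mul_I] at h1
    exact h1.symm.trans (map_neg _ _)
  have hV : ν (P ζ) (mfderiv 𝓘(ℝ, ℂ) 𝓘(ℝ, ℂ) P ζ Complex.I) =
      mfderiv 𝓘(ℝ, ℂ) (𝓘(ℝ, ℝ).prod 𝓘(ℝ, Model n)) (fun ζ => u (P ζ)) ζ Complex.I +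
      J.symplJ (u (P ζ))
        (-mfderiv 𝓘(ℝ, ℂ) (𝓘(ℝ, ℝ).prod 𝓘(ℝ, Model n)) (fun ζ => u (P ζ)) ζ (1 : ℂ)) := by
    rw [← hν, ← hchain, ← hchain]
    change mfderiv 𝓘(ℝ, ℂ) (𝓘(ℝ, ℝ).prod 𝓘(ℝ, Model n)) u (P ζ)
      (mfderiv 𝓘(ℝ, ℂ) 𝓘(ℝ, ℂ) P ζ Complex.I) + J.symplJ (u (P ζ))
        (mfderiv 𝓘(ℝ, ℂ) (𝓘(ℝ, ℝ).prod 𝓘(ℝ, Model n)) u (P ζ)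
          (complexStructure (P ζ) (mfderiv 𝓘(ℝ, ℂ) 𝓘(ℝ, ℂ) P ζ Complex.I))) = _
    rw [hj, map_neg]
  obtain ⟨hV₁, hV₂⟩ := J.add_symplJ_neg (u (P ζ)) hV (mfderiv_fst_comp hW 1)
    (mfderiv_fst_comp hW Complex.I) (mfderiv_snd_comp hW 1) (mfderiv_snd_comp hW Complex.I)
  exact J.metricG_sub (u (P ζ)) _ _ _ _ _ hV₁ hV₂

end CurveEnergy

/-! ### Calculus on half-cylinders -/

section HalfCylinder

open Complex (I)

/-- Integrals over the circles of a half-cylinder depend continuously on the circle. -/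
theorem continuousOn_integral_circle {h : ℂ → ℝ} {s₀ : ℝ} (hh : ContinuousOn h {ζ | ζ.re < s₀}) :
    ContinuousOn (fun s : ℝ => ∫ θ in -Real.pi..Real.pi, h (s + θ * I)) (Iio s₀) := by
  intro s hs
  obtain ⟨s₁, h1, h2⟩ := exists_between (mem_Iio.1 hs)
  have hc : Continuous fun q : ℝ × ℝ => h ((min q.1 s₁ : ℝ) + q.2 * I) :=
    hh.comp_continuous (by fun_prop) fun q => by simpa using Or.inr h2
  have h3 := intervalIntegral.continuous_parametric_intervalIntegral_of_continuous'
    (f := fun (s θ : ℝ) => h ((min s s₁ : ℝ) + θ * I)) (μ := volume) hc (-Real.pi) Real.pi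
  refine (h3.continuousAt.congr ?_).continuousWithinAt
  filter_upwards [Iio_mem_nhds h1] with t ht
  simp only [min_eq_left (mem_Iio.1 ht).le]

theorem continuous_circle {h : ℂ → ℝ} {s₀ s : ℝ} (hh : ContinuousOn h {ζ | ζ.re < s₀})
    (hs : s < s₀) : Continuous fun θ : ℝ => h (s + θ * I) :=
  hh.comp_continuous (by fun_prop) fun q => by simpa using hs

/-- The divergence theorem on a piece of the half-cylinder, cut open. -/
theorem integral_fderiv_halfCylinder {h g : ℂ → ℝ} {s₀ s₁ s₂ : ℝ} (hs₁ : s₁ ≤ s₂) (hs₂ : s₂ < s₀)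
    (hh : ∀ ζ : ℂ, ζ.re < s₀ → ContDiffAt ℝ 1 h ζ) (hg : ∀ ζ : ℂ, ζ.re < s₀ → ContDiffAt ℝ 1 g ζ) :
    (∫ s in s₁..s₂, ∫ θ in -Real.pi..Real.pi, (fderiv ℝ h (s + θ * I) 1 + fderiv ℝ g (s + θ * I) I)) =
      ((∫ s in s₁..s₂, g (s + Real.pi * I)) - ∫ s in s₁..s₂, g (s + (-Real.pi : ℝ) * I)) +
        (∫ θ in -Real.pi..Real.pi, h (s₂ + θ * I)) - ∫ θ in -Real.pi..Real.pi, h (s₁ + θ * I) := by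
  let L : ℝ × ℝ →L[ℝ] ℂ := Complex.equivRealProdCLM.symm
  have hL : ∀ p : ℝ × ℝ, L p = p.1 + p.2 * I := Complex.equivRealProdCLM_symm_apply
  have hre : ∀ p ∈ uIcc s₁ s₂ ×ˢ uIcc (-Real.pi) Real.pi, (L p).re < s₀ := by
    intro p hp
    rw [uIcc_of_le hs₁] at hp
    rw [hL]
    simpa using lt_of_le_of_lt hp.1.2 hs₂
  have hd : ∀ {k : ℂ → ℝ}, (∀ ζ : ℂ, ζ.re < s₀ → ContDiffAt ℝ 1 k ζ) →
      ∀ p ∈ uIcc s₁ s₂ ×ˢ uIcc (-Real.pi) Real.pi,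
        HasFDerivAt (fun p => k (L p)) ((fderiv ℝ k (L p)).comp L) p := fun hk p hp =>
    ((hk _ (hre p hp)).differentiableAt (by norm_num)).hasFDerivAt.comp p L.hasFDerivAt
  have hopen : Ioo (min s₁ s₂) (max s₁ s₂) ×ˢ Ioo (min (-Real.pi) Real.pi) (max (-Real.pi) Real.pi) ⊆
      uIcc s₁ s₂ ×ˢ uIcc (-Real.pi) Real.pi := prod_mono Ioo_subset_Icc_self Ioo_subset_Icc_self
  have hcd : ∀ {k : ℂ → ℝ} (v : ℂ), (∀ ζ : ℂ, ζ.re < s₀ → ContDiffAt ℝ 1 k ζ) →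
      ContinuousOn (fun p => fderiv ℝ k (L p) v) (uIcc s₁ s₂ ×ˢ uIcc (-Real.pi) Real.pi) := by
    intro k v hk p hp
    have h1 : ContinuousAt (fderiv ℝ k) (L p) :=
      ((hk _ (hre p hp)).fderiv_right (m := 0) (by norm_num)).continuousAt
    exact ((ContinuousAt.comp (f := L) h1 L.continuous.continuousAt).clm_apply
      continuousAt_const).continuousWithinAt
  have key := integral2_divergence_prod_of_hasFDerivAt (fun p => h (L p)) (fun p => g (L p))
    (fun p => (fderiv ℝ h (L p)).comp L) (fun p => (fderiv ℝ g (L p)).comp L) s₁ (-Real.pi) s₂ Real.pi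
    (fun p hp => (hd hh p hp).continuousAt.continuousWithinAt)
    (fun p hp => (hd hg p hp).continuousAt.continuousWithinAt)
    (fun p hp => hd hh p (hopen hp)) (fun p hp => hd hg p (hopen hp)) ?_
  · have h10 : L (1, 0) = 1 := by simp [hL]
    have h01 : L (0, 1) = I := by simp [hL]
    simp only [ContinuousLinearMap.comp_apply, h10, h01, hL] at key
    exact key
  · have h10 : L (1, 0) = 1 := by simp [hL]
    have h01 : L (0, 1) = I := by simp [hL]
    simp only [ContinuousLinearMap.comp_apply, h10, h01]
    exact ((hcd 1 hh).add (hcd I hg)).integrableOn_compact (isCompact_uIcc.prod isCompact_uIcc)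

/-- Iterated integrals over the half-cylinder are bounded by the integral over the strip. -/
theorem integral_halfCylinder_le {h : ℂ → ℝ} {s₀ s₁ s₂ : ℝ} (hs₁ : s₁ ≤ s₂) (hs₂ : s₂ < s₀)
    (hh : ContinuousOn h {ζ | ζ.re < s₀}) (hh0 : ∀ ζ, 0 ≤ h ζ) {C : ℝ≥0∞} (hC : C ≠ ⊤)
    (hle : ∫⁻ ζ in {ζ : ℂ | ζ.re < s₀ ∧ ζ.im ∈ Ioo (-Real.pi) Real.pi}, ENNReal.ofReal (h ζ) ≤ C) :
    ∫ s in s₁..s₂, ∫ θ in -Real.pi..Real.pi, h (s + θ * I) ≤ C.toReal := by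
  have hpi : -Real.pi ≤ Real.pi := by linarith [Real.pi_pos]
  have hcont : ContinuousOn (fun p : ℝ × ℝ => h (p.1 + p.2 * I)) (Icc s₁ s₂ ×ˢ Icc (-Real.pi) Real.pi) :=
    hh.comp (by fun_prop) fun p hp => by simpa using lt_of_le_of_lt hp.1.2 hs₂
  have hint : IntegrableOn (fun p : ℝ × ℝ => h (p.1 + p.2 * I)) (Ioc s₁ s₂ ×ˢ Ioo (-Real.pi) Real.pi)
      (volume.prod volume) :=
    (hcont.integrableOn_compact (isCompact_Icc.prod isCompact_Icc)).mono_set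
      (prod_mono Ioc_subset_Icc_self Ioo_subset_Icc_self)
  have h1 : ∫ s in s₁..s₂, ∫ θ in -Real.pi..Real.pi, h (s + θ * I) =
      ∫ p in Ioc s₁ s₂ ×ˢ Ioo (-Real.pi) Real.pi, h (p.1 + p.2 * I) := by
    rw [Measure.volume_eq_prod, setIntegral_prod _ hint, intervalIntegral.integral_of_le hs₁]
    congr 1
    ext s
    rw [intervalIntegral.integral_of_le hpi, integral_Ioc_eq_integral_Ioo]
  rw [h1]
  refine (ENNReal.ofReal_le_iff_le_toReal hC).1 (le_trans ?_ hle)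
  have hint' : IntegrableOn (fun p : ℝ × ℝ => h (p.1 + p.2 * I))
      (Ioc s₁ s₂ ×ˢ Ioo (-Real.pi) Real.pi) := hint
  rw [ofReal_integral_eq_lintegral_ofReal hint' (Eventually.of_forall fun _ => hh0 _)]
  have hmp := Complex.volume_preserving_equiv_real_prod.symm
  have h2 := hmp.setLIntegral_comp_preimage_emb
    Complex.measurableEquivRealProd.symm.measurableEmbedding (fun ζ => ENNReal.ofReal (h ζ))
    {ζ : ℂ | ζ.re < s₀ ∧ ζ.im ∈ Ioo (-Real.pi) Real.pi}
  rw [← h2]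
  have h3 : ∀ p : ℝ × ℝ, Complex.measurableEquivRealProd.symm p = p.1 + p.2 * I := fun p => by
    apply Complex.ext <;> simp [Complex.measurableEquivRealProd]
  simp only [h3]
  refine lintegral_mono_set fun p hp => ?_
  simp only [mem_preimage, h3]
  simpa using ⟨lt_of_le_of_lt hp.1.2 hs₂, hp.2⟩

end HalfCylinder

section MetricContinuity

variable {n : ℕ} {M : Type*} [TopologicalSpace M] [ChartedSpace (Model n) M]
  [IsManifold 𝓘(ℝ, Model n) ∞ M] {α : ContactForm n M}
  {F : Type*} [NormedAddCommGroup F] [NormedSpace ℝ F]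

/-- The squared length of the `ξ`-component of a partial derivative of `w` is continuous. -/
theorem ContactForm.CompatibleStructure.continuousAt_d_map (J : α.CompatibleStructure)
    {w : F → M} {y : F} (hw : ContMDiffAt 𝓘(ℝ, F) 𝓘(ℝ, Model n) 2 w y) (a : F) :
    ContinuousAt (fun y => α.form.d (w y) (mfderiv 𝓘(ℝ, F) 𝓘(ℝ, Model n) w y a)
      (J.J (w y) (mfderiv 𝓘(ℝ, F) 𝓘(ℝ, Model n) w y a))) y := by
  set e := chartAt (Model n) (w y) with he
  have hsrc := mem_chart_source (Model n) (w y)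
  have h := contDiffAt_chart_comp ENat.LEInfty.out hw hsrc
  have hfd : ContinuousAt (fun y' => fderiv ℝ (fun y => e (w y)) y' a) y :=
    (h.fderiv_right (m := 1) (by norm_num)).continuousAt.clm_apply continuousAt_const
  have hJ : ContinuousAt (fun y' => J.localJ (w y) (e (w y'))) y :=
    ContinuousAt.comp (g := J.localJ (w y)) (f := fun y' => e (w y'))
      (J.contDiffAt_localJ (w y)).continuousAt h.continuousAt
  have hB : ContinuousAt (fun y' => curlForm (α.form.local (w y)) (e (w y'))) y :=
    ContinuousAt.comp (g := curlForm (α.form.local (w y))) (f := fun y' => e (w y'))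
      (contDiffAt_curlForm (k := 1) (m := 2) ((α.contDiffAt_local (w y)).of_le ENat.LEInfty.out)
        (by norm_num)).continuousAt h.continuousAt
  refine ((hB.clm_apply hfd).clm_apply (hJ.clm_apply hfd)).congr ?_
  have : IsManifold 𝓘(ℝ, Model n) 2 M := IsManifold.of_le (n := ∞) ENat.LEInfty.out
  filter_upwards [(contMDiffAt_iff_contMDiffAt_nhds (by simp)).1 hw, hw.continuousAt
    (e.open_source.mem_nhds hsrc)] with y' h1 h2
  have h3 := fderiv_chart_comp (h1.mdifferentiableAt (by norm_num)) h2 a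
  rw [α.d_eq_curl_local h2, ← J.localJ_chart h2]
  exact congrArg (fun v => curlForm (α.form.local (w y)) (e (w y')) v
    (J.localJ (w y) (e (w y')) v)) h3

end MetricContinuity

/-! ### The action of circles on a half-cylinder -/

section LoopAction

open Complex (I)

variable {n : ℕ} {M : Type*} [TopologicalSpace M] [ChartedSpace (Model n) M]

theorem velocity_circle {w : ℂ → M} {s t : ℝ}
    (hw : MDifferentiableAt 𝓘(ℝ, ℂ) 𝓘(ℝ, Model n) w (s + t * I)) :
    MDifferentiableAt 𝓘(ℝ, ℝ) 𝓘(ℝ, Model n) (fun t : ℝ => w (s + t * I)) t ∧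
      velocity (fun t : ℝ => w (s + t * I)) t =
        mfderiv 𝓘(ℝ, ℂ) 𝓘(ℝ, Model n) w (s + t * I) I := by
  let L : ℝ →L[ℝ] ℂ := Complex.ofRealCLM.smulRight I
  have h1 : HasMFDerivAt 𝓘(ℝ, ℝ) 𝓘(ℝ, ℂ) (fun t : ℝ => (s : ℂ) + t * I) t L :=
    HasFDerivAt.hasMFDerivAt (L.hasFDerivAt.const_add (s : ℂ))
  have h2 := HasMFDerivAt.comp t hw.hasMFDerivAt h1
  refine ⟨h2.mdifferentiableAt, ?_⟩
  refine (DFunLike.congr_fun h2.mfderiv (1 : ℝ)).trans ?_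
  change mfderiv 𝓘(ℝ, ℂ) 𝓘(ℝ, Model n) w (s + t * I) (((1 : ℝ) : ℂ) * I : ℂ) = _
  simp

theorem OneForm.pull_add_period (α : OneForm n M) {w : ℂ → M} {c : ℂ}
    (hper : ∀ ζ, w (ζ + c) = w ζ) {ζ : ℂ}
    (hw : MDifferentiableAt 𝓘(ℝ, ℂ) 𝓘(ℝ, Model n) w (ζ + c)) :
    α.pull w (ζ + c) = α.pull w ζ := by
  have h1 : HasMFDerivAt 𝓘(ℝ, ℂ) 𝓘(ℝ, ℂ) (fun ζ : ℂ => ζ + c) ζ (ContinuousLinearMap.id ℝ ℂ) :=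
    HasFDerivAt.hasMFDerivAt ((hasFDerivAt_id ζ).add_const c)
  have h2 := HasMFDerivAt.comp ζ hw.hasMFDerivAt h1
  have h3 : w ∘ (fun ζ => ζ + c) = w := funext hper
  rw [h3] at h2
  have h4 := h2.mfderiv
  ext v
  exact α.apply_congr (hper ζ) (DFunLike.congr_fun h4 v).symm

variable [IsManifold 𝓘(ℝ, Model n) ∞ M] {α : ContactForm n M}

/-- Convergence in `L²` implies convergence in `L¹`, for square roots of non-negative functions. -/
theorem tendsto_integral_sqrt {q : ℕ → ℝ → ℝ} {a b : ℝ} (hab : a ≤ b)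
    (hq : ∀ k, Continuous (q k)) (hq0 : ∀ k t, 0 ≤ q k t)
    (h : Tendsto (fun k => ∫ t in a..b, q k t) atTop (𝓝 0)) :
    Tendsto (fun k => ∫ t in a..b, √(q k t)) atTop (𝓝 0) := by
  have hle : ∀ δ > 0, ∀ k, ∫ t in a..b, √(q k t) ≤
      (b - a) * δ + 1 / (4 * δ) * ∫ t in a..b, q k t := by
    intro δ hδ k
    have h1 : ∫ t in a..b, √(q k t) ≤ ∫ t in a..b, (δ + 1 / (4 * δ) * q k t) := by
      refine intervalIntegral.integral_mono_on hab ((hq k).sqrt.intervalIntegrable _ _)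
        ((continuous_const.add (continuous_const.mul (hq k))).intervalIntegrable _ _) fun t _ => ?_
      have h2 := Real.sq_sqrt (hq0 k t)
      have h3 : δ + 1 / (4 * δ) * q k t - √(q k t) = (√(q k t) - 2 * δ) ^ 2 / (4 * δ) := by
        field_simp
        nlinarith
      have h4 : 0 ≤ (√(q k t) - 2 * δ) ^ 2 / (4 * δ) := by positivity
      linarith
    rwa [intervalIntegral.integral_add (continuous_const.intervalIntegrable _ _)
      (((hq k).intervalIntegrable _ _).const_mul _), intervalIntegral.integral_const,
      intervalIntegral.integral_const_mul, smul_eq_mul] at h1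
  refine tendsto_order.2 ⟨fun c hc => Eventually.of_forall fun k => lt_of_lt_of_le hc
    (intervalIntegral.integral_nonneg hab fun t _ => Real.sqrt_nonneg _), fun c hc => ?_⟩
  set δ := c / (2 * (b - a + 1)) with hδ
  have hba : 0 < b - a + 1 := by linarith
  have hδ0 : 0 < δ := by positivity
  have h1 : (b - a) * δ < c := by
    rw [hδ, mul_div_assoc', div_lt_iff₀ (by positivity)]
    nlinarith
  have h2 : Tendsto (fun k => (b - a) * δ + 1 / (4 * δ) * ∫ t in a..b, q k t) atTop
      (𝓝 ((b - a) * δ)) := by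
    simpa using (h.const_mul (1 / (4 * δ))).const_add ((b - a) * δ)
  filter_upwards [h2.eventually (gt_mem_nhds h1)] with k hk
  exact (hle δ hδ0 k).trans_lt hk

/-- On a half-cylinder of finite energy whose ends converge to a closed orbit of period `T`, the
action of the circles is at least `T - ε` far out. -/
theorem ContactForm.CompatibleStructure.eventually_le_integral_pull (J : α.CompatibleStructure)
    {γ : ℝ → M} {T : ℝ} (hγ : IsMIntegralCurve (I := 𝓘(ℝ, Model n)) γ α.reeb)
    {w : ℂ → M} {a E : ℂ → ℝ} {s₀ : ℝ} {C : ℝ≥0∞} (hC : C ≠ ⊤)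
    (hw : ∀ ζ : ℂ, ζ.re < s₀ → ContMDiffAt 𝓘(ℝ, ℂ) 𝓘(ℝ, Model n) 2 w ζ)
    (ha : ∀ ζ : ℂ, ζ.re < s₀ → ContDiffAt ℝ 1 a ζ)
    (hwper : ∀ ζ : ℂ, w (ζ + (2 * Real.pi : ℝ) * I) = w ζ)
    (hE : ContinuousOn E {ζ | ζ.re < s₀}) (hE0 : ∀ ζ, 0 ≤ E ζ)
    (hEd : ∀ ζ : ℂ, ζ.re < s₀ → -4 * curl (α.form.pull w) ζ 1 I ≤ E ζ)
    (hEy : ∀ ζ : ℂ, ζ.re < s₀ →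
      α.form.d (w ζ) (mfderiv 𝓘(ℝ, ℂ) 𝓘(ℝ, Model n) w ζ I)
        (J.J (w ζ) (mfderiv 𝓘(ℝ, ℂ) 𝓘(ℝ, Model n) w ζ I)) -
        2 * curl (α.form.pull w) ζ 1 I ≤ E ζ)
    (hEn : ∀ ζ : ℂ, ζ.re < s₀ → (α.form.pull w ζ I - fderiv ℝ a ζ 1) ^ 2 ≤ E ζ)
    (hEC : ∫⁻ ζ in {ζ : ℂ | ζ.re < s₀ ∧ ζ.im ∈ Ioo (-Real.pi) Real.pi}, ENNReal.ofReal (E ζ) ≤ C)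
    (halim : Tendsto a (comap Complex.re atBot) atBot)
    (hconv : ∀ θ₀ : ℝ, Tendsto (fun q : ℝ × ℝ => w (q.1 + q.2 * I)) (atBot ×ˢ 𝓝 θ₀)
      (𝓝 (γ (T / (2 * Real.pi) * θ₀)))) :
    ∀ ε > 0, ∃ S < s₀, ∀ s ≤ S,
      T - ε ≤ ∫ θ in -Real.pi..Real.pi, α.form.pull w (s + θ * I) I := by
  have hpi : -Real.pi ≤ Real.pi := by linarith [Real.pi_pos]
  have hmd : ∀ ζ : ℂ, ζ.re < s₀ → MDifferentiableAt 𝓘(ℝ, ℂ) 𝓘(ℝ, Model n) w ζ := fun ζ hζ =>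
    (hw ζ hζ).mdifferentiableAt (by norm_num)
  have hre : ∀ {s : ℝ}, s < s₀ → ∀ θ : ℝ, ((s : ℂ) + θ * I).re < s₀ := fun hs θ => by simpa using hs
  have hpull : ∀ ζ : ℂ, ζ.re < s₀ → ContDiffAt ℝ 1 (α.form.pull w) ζ := fun ζ hζ =>
    α.contDiffAt_pull (hw ζ hζ)
  have hpv : ∀ (v : ℂ) (ζ : ℂ), ζ.re < s₀ → ContDiffAt ℝ 1 (fun ζ => α.form.pull w ζ v) ζ :=
    fun v ζ hζ => (hpull ζ hζ).clm_apply contDiffAt_const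
  have hfd : ∀ (v v' : ℂ) (ζ : ℂ), ζ.re < s₀ →
      fderiv ℝ (fun ζ => α.form.pull w ζ v) ζ v' = fderiv ℝ (α.form.pull w) ζ v' v := by
    intro v v' ζ hζ
    have h := ((hpull ζ hζ).differentiableAt one_ne_zero).hasFDerivAt.clm_apply
      (hasFDerivAt_const v ζ)
    rw [h.fderiv]; simp
  -- continuity of the integrands
  have cf : ContinuousOn (fun ζ => α.form.pull w ζ I) {ζ | ζ.re < s₀} := fun ζ hζ =>
    (hpv I ζ hζ).continuousAt.continuousWithinAt
  have cd : ContinuousOn (fun ζ => curl (α.form.pull w) ζ 1 I) {ζ | ζ.re < s₀} := fun ζ hζ =>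
    (((contDiffAt_curlForm (k := 0) (hpull ζ hζ) (by norm_num)).continuousAt.clm_apply
      continuousAt_const).clm_apply continuousAt_const).continuousWithinAt
  have ca : ContinuousOn (fun ζ => fderiv ℝ a ζ 1) {ζ | ζ.re < s₀} := fun ζ hζ =>
    (((ha ζ hζ).fderiv_right (m := 0) (by norm_num)).continuousAt.clm_apply
      continuousAt_const).continuousWithinAt
  have ca0 : ContinuousOn a {ζ | ζ.re < s₀} := fun ζ hζ =>
    (ha ζ hζ).continuousAt.continuousWithinAt
  obtain ⟨q, hq⟩ : ∃ q : ℂ → ℝ, q = fun ζ =>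
      α.form.d (w ζ) (mfderiv 𝓘(ℝ, ℂ) 𝓘(ℝ, Model n) w ζ I)
        (J.J (w ζ) (mfderiv 𝓘(ℝ, ℂ) 𝓘(ℝ, Model n) w ζ I)) := ⟨_, rfl⟩
  have cq : ContinuousOn q {ζ | ζ.re < s₀} := fun ζ hζ => by
    rw [hq]; exact (J.continuousAt_d_map (hw ζ hζ) I).continuousWithinAt
  have hq0 : ∀ ζ, 0 ≤ q ζ := fun ζ => by rw [hq]; exact J.d_nonneg _ _
  have hEy' : ∀ ζ : ℂ, ζ.re < s₀ → q ζ - 2 * curl (α.form.pull w) ζ 1 I ≤ E ζ := by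
    rw [hq]; exact hEy
  have cI : ∀ {h : ℂ → ℝ}, ContinuousOn h {ζ | ζ.re < s₀} → ∀ {s : ℝ}, s < s₀ →
      IntervalIntegrable (fun θ : ℝ => h (s + θ * I)) volume (-Real.pi) Real.pi := fun hh _ hs =>
    (continuous_circle hh hs).intervalIntegrable _ _
  have hmono : ∀ {h k : ℂ → ℝ}, ContinuousOn h {ζ | ζ.re < s₀} →
      ContinuousOn k {ζ | ζ.re < s₀} → (∀ ζ : ℂ, ζ.re < s₀ → h ζ ≤ k ζ) → ∀ {s : ℝ}, s < s₀ →
      ∫ θ in -Real.pi..Real.pi, h (s + θ * I) ≤ ∫ θ in -Real.pi..Real.pi, k (s + θ * I) :=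
    fun hh hk hle _ hs => intervalIntegral.integral_mono_on hpi (cI hh hs) (cI hk hs)
      fun θ _ => hle _ (hre hs θ)
  refine eventually_le_action (C := C.toReal)
    (f := fun s => ∫ θ in -Real.pi..Real.pi, α.form.pull w (s + θ * I) I)
    (A := fun s => ∫ θ in -Real.pi..Real.pi, a (s + θ * I))
    (d := fun s => ∫ θ in -Real.pi..Real.pi, curl (α.form.pull w) (s + θ * I) 1 I)
    (e := fun s => ∫ θ in -Real.pi..Real.pi, E (s + θ * I))
    (n := fun s => ∫ θ in -Real.pi..Real.pi,
      (α.form.pull w (s + θ * I) I - fderiv ℝ a (s + θ * I) 1))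
    (y := fun s => ∫ θ in -Real.pi..Real.pi, q (s + θ * I))
    (continuousOn_integral_circle cd) (continuousOn_integral_circle hE)
    (continuousOn_integral_circle cf) (continuousOn_integral_circle (cf.sub ca))
    (continuousOn_integral_circle cq) ?_ ?_ ?_ ?_ ?_ ?_ ?_ ?_ ?_ ?_
  -- Stokes' theorem on an annulus: by periodicity, the contributions of the cut cancel
  · intro s₁ s₂ h₁ h₂
    have h := integral_fderiv_halfCylinder h₁ h₂ (hpv I)
      (g := fun ζ => -α.form.pull w ζ 1) (fun ζ hζ => (hpv 1 ζ hζ).neg)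
    have hb : ∀ s ∈ uIcc s₁ s₂, -(α.form.pull w (s + Real.pi * I) 1) =
        -(α.form.pull w (s + (-Real.pi : ℝ) * I) 1) := by
      intro s hs
      rw [uIcc_of_le h₁] at hs
      have h3 : (s : ℂ) + Real.pi * I = s + (-Real.pi : ℝ) * I + (2 * Real.pi : ℝ) * I := by
        push_cast; ring
      have h4 := α.form.pull_add_period hwper (ζ := s + (-Real.pi : ℝ) * I)
        (hmd _ (by simpa using lt_of_le_of_lt hs.2 h₂))
      rw [h3, h4]
    rw [intervalIntegral.integral_congr hb] at h
    rw [sub_self, zero_add] at h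
    refine Eq.trans (intervalIntegral.integral_congr fun s hs => ?_) h
    rw [uIcc_of_le h₁] at hs
    refine intervalIntegral.integral_congr fun θ _ => ?_
    have hs' := hre (lt_of_le_of_lt hs.2 h₂) θ
    have h5 : fderiv ℝ (fun ζ => -α.form.pull w ζ 1) (s + θ * I) I =
        -fderiv ℝ (α.form.pull w) (s + θ * I) I 1 := by
      rw [fderiv_fun_neg, ← hfd 1 I _ hs']; rfl
    exact (congrArg₂ (· + ·) (hfd I 1 _ hs') h5).symm
  -- the fundamental theorem of calculus for the `ℝ`-component
  · intro s₁ s₂ h₁ h₂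
    have h := integral_fderiv_halfCylinder (g := fun _ => (0 : ℝ)) h₁ h₂ ha
      (fun ζ hζ => contDiffAt_const)
    simp only [fderiv_fun_const, Pi.zero_apply, zero_apply, add_zero, sub_self,
      zero_add, intervalIntegral.integral_zero] at h
    refine Eq.trans (intervalIntegral.integral_congr fun s hs => ?_) h
    rw [uIcc_of_le h₁] at hs
    have hs' := lt_of_le_of_lt hs.2 h₂
    rw [← intervalIntegral.integral_sub (cI cf hs')
      (cI (h := fun ζ => α.form.pull w ζ I - fderiv ℝ a ζ 1) (cf.sub ca) hs')]
    simp
  · have h2π : (0 : ℝ) < 2 * Real.pi := by positivity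
    refine tendsto_atBot.2 fun b => ?_
    have h1 := halim.eventually (eventually_le_atBot (b / (2 * Real.pi)))
    obtain ⟨s', hs'⟩ := eventually_atBot.1 (eventually_comap.1 h1)
    filter_upwards [eventually_le_atBot s', eventually_lt_atBot s₀] with s hs hs0
    have h3 : ∫ θ in -Real.pi..Real.pi, a (s + θ * I) ≤
        ∫ θ in -Real.pi..Real.pi, b / (2 * Real.pi) :=
      intervalIntegral.integral_mono_on hpi (cI ca0 hs0) (by simp) fun θ _ =>
        hs' s hs _ (by simp)
    refine h3.trans (le_of_eq ?_)
    rw [intervalIntegral.integral_const, smul_eq_mul]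
    field_simp
    ring
  · exact fun s _ => intervalIntegral.integral_nonneg hpi fun θ _ => hE0 _
  · intro s hs
    rw [← intervalIntegral.integral_const_mul]
    exact hmono (continuousOn_const.mul cd) hE hEd hs
  · exact fun s _ => intervalIntegral.integral_nonneg hpi fun θ _ => hq0 _
  · intro s hs
    rw [← intervalIntegral.integral_const_mul, ← intervalIntegral.integral_sub (cI cq hs)
      (cI (h := fun ζ => 2 * curl (α.form.pull w) ζ 1 I) (continuousOn_const.mul cd) hs)]
    exact hmono (cq.sub (continuousOn_const.mul cd)) hE hEy' hs
  -- Young's inequality `-N ≤ κ / (2 π) + π N² / (2 κ)`, integrated over the circle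
  · intro κ hκ s hs
    have h1 := hmono (h := fun ζ => -(κ / (2 * Real.pi) + Real.pi / (2 * κ) * E ζ))
      (k := fun ζ => α.form.pull w ζ I - fderiv ℝ a ζ 1)
      (continuousOn_const.add (continuousOn_const.mul hE)).neg (cf.sub ca) (fun ζ hζ => by
        have h2 := hEn ζ hζ
        set N := α.form.pull w ζ I - fderiv ℝ a ζ 1
        have hp := Real.pi_pos
        have h3 : κ / (2 * Real.pi) + Real.pi / (2 * κ) * N ^ 2 + N =
            (κ + Real.pi * N) ^ 2 / (2 * Real.pi * κ) := by
          field_simp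
          ring
        have h4 : 0 ≤ (κ + Real.pi * N) ^ 2 / (2 * Real.pi * κ) := by positivity
        have h5 : Real.pi / (2 * κ) * N ^ 2 ≤ Real.pi / (2 * κ) * E ζ := by gcongr
        linarith) hs
    refine le_trans (le_of_eq ?_) h1
    rw [intervalIntegral.integral_neg, intervalIntegral.integral_add (by simp)
      ((cI hE hs).const_mul _), intervalIntegral.integral_const,
      intervalIntegral.integral_const_mul, smul_eq_mul]
    have h6 : (Real.pi - -Real.pi) * (κ / (2 * Real.pi)) = κ := by
      field_simp
      ring
    rw [h6]
  · exact fun s₁ s₂ h₁ h₂ => integral_halfCylinder_le h₁ h₂ hE hE0 hC hEC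
  -- the actions converge along circles with short `ξ`-components
  · intro σ hσ hσlim hy
    have hlim := J.tendsto_integral_form hγ (T / (2 * Real.pi)) (l := atTop) (ι := ℕ)
      (w := fun k t => w (σ k + t * I)) (k := fun k t => √(q (σ k + t * I))) hpi
      (fun k t => (velocity_circle (hmd _ (hre (hσ k) t))).1)
      (fun k => (continuous_circle cf (hσ k)).congr fun t => by
        rw [(velocity_circle (hmd _ (hre (hσ k) t))).2]; rfl)
      (fun k => (continuous_circle cq (hσ k)).sqrt) (fun k t => Real.sqrt_nonneg _)
      (fun k t => by
        rw [(velocity_circle (hmd _ (hre (hσ k) t))).2, Real.sq_sqrt (hq0 _), hq])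
      (tendsto_integral_sqrt hpi (fun k => continuous_circle cq (hσ k)) (fun k t => hq0 _) hy)
      (fun t₀ => (hconv t₀).comp (f := fun p : ℕ × ℝ => (σ p.1, p.2))
        ((hσlim.comp tendsto_fst).prodMk tendsto_snd))
    have h2 : T / (2 * Real.pi) * (Real.pi - -Real.pi) = T := by
      field_simp
      ring
    rw [h2] at hlim
    refine hlim.congr fun k => intervalIntegral.integral_congr fun t _ => ?_
    rw [(velocity_circle (hmd _ (hre (hσ k) t))).2]; rfl

end LoopAction

/-! ### Stokes' theorem on a closed Riemann surface -/

section PlaneForms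

open Complex (I)

/-- The Jacobian of multiplication by the complex number `c`. -/
theorem det_smul_one (c : ℂ) :
    ((c • (1 : ℂ →L[ℝ] ℂ) : ℂ →L[ℝ] ℂ)).det = Complex.normSq c := by
  rw [ContinuousLinearMap.det, ← LinearMap.det_toMatrix Complex.basisOneI, Matrix.det_fin_two]
  simp [LinearMap.toMatrix_apply, Complex.normSq_apply]

/-- A holomorphic change of variable multiplies an alternating form by the Jacobian. -/
theorem alternating_smul_one {B : ℂ →L[ℝ] ℂ →L[ℝ] ℝ} (hB : ∀ v v', B v v' = -B v' v) (c : ℂ) :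
    B ((c • (1 : ℂ →L[ℝ] ℂ) : ℂ →L[ℝ] ℂ) 1) ((c • (1 : ℂ →L[ℝ] ℂ) : ℂ →L[ℝ] ℂ) I) =
      |((c • (1 : ℂ →L[ℝ] ℂ) : ℂ →L[ℝ] ℂ)).det| * B 1 I := by
  rw [det_smul_one, abs_of_nonneg (Complex.normSq_nonneg c), Complex.normSq_apply]
  have h1 : (c • (1 : ℂ →L[ℝ] ℂ) : ℂ →L[ℝ] ℂ) 1 = c.re • (1 : ℂ) + c.im • I := by
    apply Complex.ext <;> simp
  have h2 : (c • (1 : ℂ →L[ℝ] ℂ) : ℂ →L[ℝ] ℂ) I = c.re • I - c.im • (1 : ℂ) := by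
    apply Complex.ext <;> simp
  have h3 : B 1 1 = 0 := by linarith [hB 1 1]
  have h4 : B I I = 0 := by linarith [hB I I]
  rw [h1, h2]
  simp only [map_add, map_sub, map_smul, add_apply, smul_apply, smul_eq_mul, h3, h4, hB I 1]
  ring

theorem curl_swap {F : Type*} [NormedAddCommGroup F] [NormedSpace ℝ F] (β : F → F →L[ℝ] ℝ)
    (y a b : F) : curl β y a b = -curl β y b a := by
  simp [curl]

theorem integral_fderiv_apply {g : ℂ → ℝ} (hg : ContDiff ℝ 1 g) (hs : HasCompactSupport g)
    (v : ℂ) : ∫ ζ, fderiv ℝ g ζ v = 0 := by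
  have hc : Continuous fun ζ => fderiv ℝ g ζ v :=
    (hg.continuous_fderiv one_ne_zero).clm_apply continuous_const
  have hs' : HasCompactSupport fun ζ => fderiv ℝ g ζ v := hs.fderiv_apply (𝕜 := ℝ) v
  have h := integral_bilinear_hasLineDerivAt_right_eq_neg_left_of_integrable (μ := volume)
    (f := fun _ : ℂ => (1 : ℝ)) (f' := fun _ => 0) (g := g) (g' := fun ζ => fderiv ℝ g ζ v) (v := v)
    (B := ContinuousLinearMap.mul ℝ ℝ) (by simp)
    (by simpa using hc.integrable_of_hasCompactSupport hs')
    (by simpa using hg.continuous.integrable_of_hasCompactSupport hs)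
    (fun x _ => by simpa using (hasFDerivAt_const (1 : ℝ) x).hasLineDerivAt v)
    (fun x _ => ((hg.differentiable one_ne_zero x).hasFDerivAt).hasLineDerivAt v)
  simpa using h

/-- Stokes' theorem for compactly supported forms on the plane. -/
theorem integral_curl_eq_zero {β : ℂ → ℂ →L[ℝ] ℝ} (hβ : ContDiff ℝ 1 β)
    (hs : HasCompactSupport β) : ∫ ζ, curl β ζ 1 I = 0 := by
  have h1 : ∀ v v' ζ : ℂ, fderiv ℝ (fun ζ => β ζ v) ζ v' = fderiv ℝ β ζ v' v := by
    intro v v' ζ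
    have h := ((hβ.differentiable one_ne_zero ζ).hasFDerivAt).clm_apply (hasFDerivAt_const v ζ)
    rw [h.fderiv]; simp
  have h2 : ∀ v : ℂ, ContDiff ℝ 1 fun ζ => β ζ v := fun v => hβ.clm_apply contDiff_const
  have h3 : ∀ v : ℂ, HasCompactSupport fun ζ => β ζ v := fun v =>
    hs.comp_left (g := fun L : ℂ →L[ℝ] ℝ => L v) (by simp)
  have h4 : ∀ v v' : ℂ, Integrable fun ζ => fderiv ℝ (fun ζ => β ζ v) ζ v' := fun v v' =>
    (((h2 v).continuous_fderiv one_ne_zero).clm_apply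
      continuous_const).integrable_of_hasCompactSupport ((h3 v).fderiv_apply (𝕜 := ℝ) v')
  have h5 := integral_sub (h4 I 1) (h4 1 I)
  rw [integral_fderiv_apply (h2 I) (h3 I), integral_fderiv_apply (h2 1) (h3 1), sub_self] at h5
  simpa only [h1, curl] using h5

end PlaneForms

section SurfaceForms

open Complex (I)

theorem eventually_mem_trans {S : Type*} [TopologicalSpace S]
    {e e' : OpenPartialHomeomorph S ℂ} {ζ : ℂ}
    (hζ : ζ ∈ e.target) (hζ' : e.symm ζ ∈ e'.source) :
    ∀ᶠ y in 𝓝 ζ, y ∈ e.target ∧ e.symm y ∈ e'.source :=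
  (e.open_target.eventually_mem hζ).and
    ((e.continuousAt_symm hζ).eventually (e'.open_source.mem_nhds hζ'))

variable {S : Type*} [TopologicalSpace S] [ChartedSpace ℂ S]

/-- A one-form on the surface `S`, given by its expressions `F e` in the holomorphic charts `e`,
which have to be related by pull-back along the transition maps. -/
def IsOneForm (F : OpenPartialHomeomorph S ℂ → ℂ → ℂ →L[ℝ] ℝ) : Prop :=
  ∀ e e', IsHolomorphicChart e → IsHolomorphicChart e' → ∀ ζ ∈ e.target, e.symm ζ ∈ e'.source →
    F e ζ = (F e' (e' (e.symm ζ))).comp (fderiv ℝ (fun y => e' (e.symm y)) ζ)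

/-- A density on the surface `S`, given by its expressions `D e` in the holomorphic charts `e`,
which have to be related by the Jacobians of the transition maps. -/
def IsDensity (D : OpenPartialHomeomorph S ℂ → ℂ → ℝ) : Prop :=
  ∀ e e', IsHolomorphicChart e → IsHolomorphicChart e' → ∀ ζ ∈ e.target, e.symm ζ ∈ e'.source →
    D e ζ = |(fderiv ℝ (fun y => e' (e.symm y)) ζ).det| * D e' (e' (e.symm ζ))

/-- A one-form on `S` is continuously differentiable if its expressions in all charts are. -/
def IsC1Form (F : OpenPartialHomeomorph S ℂ → ℂ → ℂ →L[ℝ] ℝ) : Prop :=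
  ∀ e, IsHolomorphicChart e → ∀ ζ ∈ e.target, ContDiffAt ℝ 1 (F e) ζ

/-- A dissection of `S`: pairwise disjoint pieces that cover `S`, each of them relatively compact
in the domain of a holomorphic chart, in which it is given by the measurable set `A i`. -/
structure IsDissection {k : ℕ} (e : Fin k → OpenPartialHomeomorph S ℂ) (A : Fin k → Set ℂ) :
    Prop where
  chart : ∀ i, IsHolomorphicChart (e i)
  measurableSet : ∀ i, MeasurableSet (A i)
  subset : ∀ i, ∃ K, IsCompact K ∧ A i ⊆ K ∧ K ⊆ (e i).target
  disjoint : Pairwise fun i i' => Disjoint ((e i).symm '' A i) ((e i').symm '' A i')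
  cover : ⋃ i, (e i).symm '' A i = univ

variable {k : ℕ} {e : Fin k → OpenPartialHomeomorph S ℂ} {A : Fin k → Set ℂ}

theorem IsDissection.subset_target (h : IsDissection e A) (i : Fin k) : A i ⊆ (e i).target :=
  let ⟨_, _, h1, h2⟩ := h.subset i
  h1.trans h2

theorem IsDissection.integrableOn (h : IsDissection e A) {i : Fin k} {f : ℂ → ℝ}
    (hf : ContinuousOn f (e i).target) : IntegrableOn f (A i) := by
  obtain ⟨K, hK, h1, h2⟩ := h.subset i
  exact ((hf.mono h2).integrableOn_compact hK).mono_set h1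

theorem hasFDerivAt_trans {e e' : OpenPartialHomeomorph S ℂ} (he : IsHolomorphicChart e)
    (he' : IsHolomorphicChart e') {ζ : ℂ} (hζ : ζ ∈ e.target) (hζ' : e.symm ζ ∈ e'.source) :
    ∃ c : ℂ, HasFDerivAt (fun y => e' (e.symm y)) (c • (1 : ℂ →L[ℝ] ℂ)) ζ :=
  ⟨_, (he.differentiableAt_trans he' hζ hζ').hasDerivAt.complexToReal_fderiv⟩

theorem contDiffAt_trans {e e' : OpenPartialHomeomorph S ℂ} (he : IsHolomorphicChart e)
    (he' : IsHolomorphicChart e') {ζ : ℂ} (hζ : ζ ∈ e.target) (hζ' : e.symm ζ ∈ e'.source) :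
    ContDiffAt ℝ ∞ (fun y => e' (e.symm y)) ζ :=
  contMDiffAt_iff_contDiffAt.1 ((he'.contMDiffAt_real hζ').comp ζ (he.contMDiffAt_symm_real hζ))

/-- A pointwise alternating form that transforms by pull-back is a density. -/
theorem isDensity_of_alternating {B : OpenPartialHomeomorph S ℂ → ℂ → ℂ →L[ℝ] ℂ →L[ℝ] ℝ}
    (hB : ∀ e ζ v v', B e ζ v v' = -B e ζ v' v)
    (h : ∀ e e', IsHolomorphicChart e → IsHolomorphicChart e' → ∀ ζ ∈ e.target,
      e.symm ζ ∈ e'.source → B e ζ 1 I = B e' (e' (e.symm ζ))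
        (fderiv ℝ (fun y => e' (e.symm y)) ζ 1) (fderiv ℝ (fun y => e' (e.symm y)) ζ I)) :
    IsDensity fun e ζ => B e ζ 1 I := by
  intro e e' he he' ζ hζ hζ'
  obtain ⟨c, hc⟩ := hasFDerivAt_trans he he' hζ hζ'
  dsimp only
  rw [h e e' he he' ζ hζ hζ', hc.fderiv]
  exact alternating_smul_one (hB _ _) c

theorem IsOneForm.isDensity_curl {F : OpenPartialHomeomorph S ℂ → ℂ → ℂ →L[ℝ] ℝ} (hF : IsOneForm F)
    (hF1 : IsC1Form F) : IsDensity fun e ζ => curl (F e) ζ 1 I := by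
  refine isDensity_of_alternating (B := fun e ζ => curlForm (F e) ζ)
    (fun e ζ v v' => curl_swap _ _ _ _) fun e e' he he' ζ hζ hζ' => ?_
  have h1 : F e =ᶠ[𝓝 ζ] fun y => (F e' (e' (e.symm y))).comp
      (fderiv ℝ (fun y => e' (e.symm y)) y) := by
    filter_upwards [eventually_mem_trans hζ hζ'] with y hy using hF e e' he he' y hy.1 hy.2
  exact (curl_congr h1 1 I).trans (curl_comp_fderiv (f := fun y => e' (e.symm y))
    ((hF1 e' he' _ (e'.map_source hζ')).differentiableAt one_ne_zero)
    ((contDiffAt_trans he he' hζ hζ').of_le ENat.LEInfty.out) 1 I)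

/-- The integral of a density that is supported in one chart can be computed in that chart. -/
theorem IsDissection.sum_setIntegral_eq (h : IsDissection e A)
    {D : OpenPartialHomeomorph S ℂ → ℂ → ℝ} (hD : IsDensity D) {c : OpenPartialHomeomorph S ℂ}
    (hc : IsHolomorphicChart c)
    (hsupp : ∀ i, ∀ ζ ∈ A i, (e i).symm ζ ∉ c.source → D (e i) ζ = 0)
    (hint : IntegrableOn (D c) c.target) :
    ∑ i, ∫ ζ in A i, D (e i) ζ = ∫ ζ in c.target, D c ζ := by
  set A' : Fin k → Set ℂ := fun i => A i ∩ ((e i).target ∩ (e i).symm ⁻¹' c.source) with hA'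
  have hmeas : ∀ i, MeasurableSet (A' i) := fun i =>
    (h.measurableSet i).inter ((e i).isOpen_inter_preimage_symm c.open_source).measurableSet
  have hder : ∀ i, ∀ ζ ∈ A' i, HasFDerivWithinAt (fun y => c ((e i).symm y))
      (fderiv ℝ (fun y => c ((e i).symm y)) ζ) (A' i) ζ := by
    intro i ζ hζ
    obtain ⟨a, ha⟩ := hasFDerivAt_trans (h.chart i) hc hζ.2.1 hζ.2.2
    rw [ha.fderiv]
    exact ha.hasFDerivWithinAt
  have hinj : ∀ i, InjOn (fun y => c ((e i).symm y)) (A' i) := by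
    intro i y hy y' hy' hyy
    exact (e i).symm.injOn hy.2.1 hy'.2.1 (c.injOn hy.2.2 hy'.2.2 hyy)
  have h1 : ∀ i, ∫ ζ in A i, D (e i) ζ = ∫ ζ in (fun y => c ((e i).symm y)) '' A' i, D c ζ := by
    intro i
    rw [integral_image_eq_integral_abs_det_fderiv_smul volume (hmeas i) (hder i) (hinj i)]
    rw [setIntegral_eq_of_subset_of_forall_sdiff_eq_zero (h.measurableSet i)
      (inter_subset_left : A' i ⊆ A i) fun ζ hζ => hsupp i ζ hζ.1 fun h2 =>
        hζ.2 ⟨hζ.1, h.subset_target i hζ.1, h2⟩]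
    exact setIntegral_congr_fun (hmeas i) fun ζ hζ =>
      hD (e i) c (h.chart i) hc ζ hζ.2.1 hζ.2.2
  have hU : ⋃ i, (fun y => c ((e i).symm y)) '' A' i = c.target := by
    ext y
    simp only [mem_iUnion, mem_image]
    constructor
    · rintro ⟨i, ζ, hζ, rfl⟩
      exact c.map_source hζ.2.2
    · intro hy
      obtain ⟨i, hi⟩ := mem_iUnion.1 (h.cover.ge (mem_univ (c.symm y)))
      obtain ⟨ζ, hζ, hζy⟩ := hi
      refine ⟨i, ζ, ⟨hζ, h.subset_target i hζ, ?_⟩, ?_⟩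
      · rw [mem_preimage, hζy]; exact c.map_target hy
      · rw [hζy, c.right_inv hy]
  rw [Finset.sum_congr rfl fun i _ => h1 i, ← hU]
  refine (integral_iUnion_fintype
    (fun i => measurable_image_of_fderivWithin (hmeas i) (hder i) (hinj i)) ?_ fun i => ?_).symm
  · intro i i' hii
    refine Set.disjoint_left.2 ?_
    rintro _ ⟨y, hy, rfl⟩ ⟨y', hy', hyy⟩
    have h2 := c.injOn hy'.2.2 hy.2.2 hyy
    exact Set.disjoint_left.1 (h.disjoint hii) ⟨y, hy.1, rfl⟩ ⟨y', hy'.1, h2⟩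
  · exact hint.mono_set ((subset_iUnion _ i).trans hU.le)

theorem IsC1Form.continuousOn_curl {F : OpenPartialHomeomorph S ℂ → ℂ → ℂ →L[ℝ] ℝ}
    (hF : IsC1Form F) {e : OpenPartialHomeomorph S ℂ} (he : IsHolomorphicChart e) :
    ContinuousOn (fun ζ => curl (F e) ζ 1 I) e.target := fun ζ hζ =>
  (((contDiffAt_curlForm (k := 0) (hF e he ζ hζ) (by norm_num)).continuousAt.clm_apply
      continuousAt_const).clm_apply continuousAt_const).continuousWithinAt

theorem curl_eq_zero {β : ℂ → ℂ →L[ℝ] ℝ} {ζ : ℂ} (h : β =ᶠ[𝓝 ζ] 0) (a b : ℂ) :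
    curl β ζ a b = 0 := by
  rw [curl_congr h]; simp [curl]

/-- Stokes' theorem for a form with compact support inside one chart. -/
theorem IsDissection.sum_integral_curl_of_support [T2Space S] (h : IsDissection e A)
    {F : OpenPartialHomeomorph S ℂ → ℂ → ℂ →L[ℝ] ℝ} (hF : IsOneForm F) (hF1 : IsC1Form F)
    {c : OpenPartialHomeomorph S ℂ} (hc : IsHolomorphicChart c) {K : Set S} (hK : IsCompact K)
    (hKc : K ⊆ c.source) (hsupp : ∀ e ζ, e.symm ζ ∉ K → F e ζ = 0) :
    ∑ i, ∫ ζ in A i, curl (F (e i)) ζ 1 I = 0 := by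
  have hK' : IsCompact (c '' K) := hK.image_of_continuousOn (c.continuousOn.mono hKc)
  have hKt : c '' K ⊆ c.target := by
    rintro _ ⟨y, hy, rfl⟩
    exact c.map_source (hKc hy)
  have hzero : ∀ ζ ∈ c.target, ζ ∉ c '' K → F c ζ = 0 := fun ζ hζ hn =>
    hsupp c ζ fun h2 => hn ⟨_, h2, c.right_inv hζ⟩
  set β : ℂ → ℂ →L[ℝ] ℝ := c.target.indicator (F c) with hβ
  have hβ0 : ∀ ζ ∉ c '' K, β ζ = 0 := fun ζ hn => by
    by_cases h2 : ζ ∈ c.target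
    · rw [hβ, indicator_of_mem h2, hzero ζ h2 hn]
    · rw [hβ, indicator_of_notMem h2]
  have hβe : ∀ ζ ∈ c.target, β =ᶠ[𝓝 ζ] F c := fun ζ hζ => by
    filter_upwards [c.open_target.mem_nhds hζ] with y hy using indicator_of_mem hy _
  have hβn : ∀ ζ ∉ c '' K, β =ᶠ[𝓝 ζ] 0 := fun ζ hζ => by
    filter_upwards [hK'.isClosed.isOpen_compl.mem_nhds hζ] with y hy using hβ0 y hy
  have hβ1 : ContDiff ℝ 1 β := contDiff_iff_contDiffAt.2 fun ζ => by
    by_cases h2 : ζ ∈ c '' K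
    · exact (hF1 c hc ζ (hKt h2)).congr_of_eventuallyEq (hβe ζ (hKt h2))
    · exact (contDiffAt_const (c := (0 : ℂ →L[ℝ] ℝ))).congr_of_eventuallyEq (hβn ζ h2)
  have hβs : HasCompactSupport β := HasCompactSupport.intro hK' hβ0
  have hcurl0 : ∀ ζ ∉ c '' K, curl β ζ 1 I = 0 := fun ζ hζ => curl_eq_zero (hβn ζ hζ) 1 I
  have hcont : Continuous fun ζ => curl β ζ 1 I := continuous_iff_continuousAt.2 fun ζ =>
    ((contDiffAt_curlForm (k := 0) hβ1.contDiffAt (by norm_num)).continuousAt.clm_apply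
      continuousAt_const).clm_apply continuousAt_const
  have hint : Integrable fun ζ => curl β ζ 1 I :=
    hcont.integrable_of_hasCompactSupport (HasCompactSupport.intro hK' hcurl0)
  have hcongr : ∀ ζ ∈ c.target, curl (F c) ζ 1 I = curl β ζ 1 I := fun ζ hζ =>
    (curl_congr (hβe ζ hζ) 1 I).symm
  rw [h.sum_setIntegral_eq (hF.isDensity_curl hF1) hc ?_ ?_]
  · rw [setIntegral_congr_fun c.open_target.measurableSet hcongr, ← integral_curl_eq_zero hβ1 hβs]
    exact setIntegral_eq_integral_of_forall_compl_eq_zero fun ζ hζ =>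
      hcurl0 ζ fun h2 => hζ (hKt h2)
  · intro i ζ hζ hn
    refine curl_eq_zero ?_ 1 I
    have h2 : ∀ᶠ y in 𝓝 ζ, (e i).symm y ∈ Kᶜ :=
      ((e i).continuousAt_symm (h.subset_target i hζ)).eventually
        (hK.isClosed.isOpen_compl.mem_nhds fun h3 => hn (hKc h3))
    filter_upwards [h2] with y hy using hsupp _ _ hy
  · exact hint.integrableOn.congr_fun (fun ζ hζ => (hcongr ζ hζ).symm) c.open_target.measurableSet

theorem IsOneForm.smul {F : OpenPartialHomeomorph S ℂ → ℂ → ℂ →L[ℝ] ℝ} (hF : IsOneForm F)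
    (χ : S → ℝ) : IsOneForm fun e ζ => χ (e.symm ζ) • F e ζ := by
  intro e e' he he' ζ hζ hζ'
  dsimp only
  rw [hF e e' he he' ζ hζ hζ', e'.left_inv hζ', ContinuousLinearMap.smul_comp]

theorem contDiffAt_comp_symm {χ : S → ℝ} (hχ : ContMDiff 𝓘(ℝ, ℂ) 𝓘(ℝ, ℝ) ∞ χ)
    {e : OpenPartialHomeomorph S ℂ} (he : IsHolomorphicChart e) {ζ : ℂ} (hζ : ζ ∈ e.target) :
    ContDiffAt ℝ ∞ (fun ζ => χ (e.symm ζ)) ζ :=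
  contMDiffAt_iff_contDiffAt.1 (hχ.contMDiffAt.comp ζ (he.contMDiffAt_symm_real hζ))

theorem IsC1Form.smul {F : OpenPartialHomeomorph S ℂ → ℂ → ℂ →L[ℝ] ℝ} (hF : IsC1Form F)
    {χ : S → ℝ} (hχ : ContMDiff 𝓘(ℝ, ℂ) 𝓘(ℝ, ℝ) ∞ χ) :
    IsC1Form fun e ζ => χ (e.symm ζ) • F e ζ := fun e he ζ hζ =>
  ((contDiffAt_comp_symm hχ he hζ).of_le (by simp)).smul (hF e he ζ hζ)

/-- Stokes' theorem: the exterior derivative of a one-form on a closed surface has integral zero. -/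
theorem IsDissection.sum_integral_curl [T2Space S] [CompactSpace S] [IsManifold 𝓘(ℂ, ℂ) ω S]
    (h : IsDissection e A) {F : OpenPartialHomeomorph S ℂ → ℂ → ℂ →L[ℝ] ℝ} (hF : IsOneForm F)
    (hF1 : IsC1Form F) : ∑ i, ∫ ζ in A i, curl (F (e i)) ζ 1 I = 0 := by
  have : IsManifold 𝓘(ℝ, ℂ) ∞ S := isManifold_real
  have hcov : univ ⊆ ⋃ i, (e i).source := by
    rw [← h.cover]
    refine iUnion_mono fun i => ?_
    rintro _ ⟨y, hy, rfl⟩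
    exact (e i).map_target (h.subset_target i hy)
  obtain ⟨χ, hχ⟩ := SmoothPartitionOfUnity.exists_isSubordinate 𝓘(ℝ, ℂ) isClosed_univ
    (fun i => (e i).source) (fun i => (e i).open_source) hcov
  have hsum : ∀ z, ∑ j, χ j z = 1 := fun z => by
    rw [← finsum_eq_sum_of_fintype]; exact χ.sum_eq_one (mem_univ z)
  have hG1 := fun j => hF1.smul (χ j).contMDiff
  have hcurl : ∀ i, ∀ ζ ∈ A i, curl (F (e i)) ζ 1 I =
      ∑ j, curl (fun ζ => χ j ((e i).symm ζ) • F (e i) ζ) ζ 1 I := by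
    intro i ζ hζ
    have h1 : F (e i) = fun ζ => ∑ j, χ j ((e i).symm ζ) • F (e i) ζ := by
      ext1 ζ
      rw [← Finset.sum_smul, hsum, one_smul]
    have h2 : fderiv ℝ (F (e i)) ζ = ∑ j, fderiv ℝ (fun ζ => χ j ((e i).symm ζ) • F (e i) ζ) ζ := by
      conv_lhs => rw [h1]
      exact fderiv_fun_sum fun j _ => (hG1 j (e i) (h.chart i) ζ
        (h.subset_target i hζ)).differentiableAt one_ne_zero
    simp only [curl, h2, sum_apply, Finset.sum_sub_distrib]
  calc ∑ i, ∫ ζ in A i, curl (F (e i)) ζ 1 I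
      = ∑ i, ∑ j, ∫ ζ in A i, curl (fun ζ => χ j ((e i).symm ζ) • F (e i) ζ) ζ 1 I := by
        refine Finset.sum_congr rfl fun i _ => ?_
        rw [setIntegral_congr_fun (h.measurableSet i) (hcurl i)]
        exact integral_finsetSum _ fun j _ =>
          h.integrableOn ((hG1 j).continuousOn_curl (h.chart i))
    _ = ∑ j, ∑ i, ∫ ζ in A i, curl (fun ζ => χ j ((e i).symm ζ) • F (e i) ζ) ζ 1 I :=
        Finset.sum_comm
    _ = 0 := Finset.sum_eq_zero fun j _ =>
        h.sum_integral_curl_of_support (hF.smul (χ j)) (hG1 j) (h.chart j)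
          (isClosed_tsupport (χ j)).isCompact (hχ j) fun e ζ hζ => by
            rw [image_eq_zero_of_notMem_tsupport hζ, zero_smul]

variable (S) in
/-- From each disc of a finite cover by coordinate discs, the previous discs are removed. -/
theorem exists_isDissection [T2Space S] [CompactSpace S] [IsManifold 𝓘(ℂ, ℂ) ω S] :
    ∃ (k : ℕ) (e : Fin k → OpenPartialHomeomorph S ℂ) (A : Fin k → Set ℂ), IsDissection e A := by
  have h1 : ∀ p : S, ∃ r > 0, Metric.closedBall (chartAt ℂ p p) r ⊆ (chartAt ℂ p).target := fun p =>
    Metric.nhds_basis_closedBall.mem_iff.1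
      ((chartAt ℂ p).open_target.mem_nhds (mem_chart_target ℂ p))
  choose r hr hrt using h1
  have hbt : ∀ p, Metric.ball (chartAt ℂ p p) (r p) ⊆ (chartAt ℂ p).target := fun p =>
    Metric.ball_subset_closedBall.trans (hrt p)
  set U : S → Set S := fun p => (chartAt ℂ p).symm '' Metric.ball (chartAt ℂ p p) (r p) with hU
  have hUo : ∀ p, IsOpen (U p) := fun p =>
    (chartAt ℂ p).symm.isOpen_image_of_subset_source Metric.isOpen_ball (hbt p)
  have hUm : ∀ p, p ∈ U p := fun p =>
    ⟨_, Metric.mem_ball_self (hr p), (chartAt ℂ p).left_inv (mem_chart_source ℂ p)⟩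
  obtain ⟨t, ht⟩ := isCompact_univ.elim_finite_subcover U hUo
    fun p _ => mem_iUnion.2 ⟨p, hUm p⟩
  let g : Fin t.card → S := fun i => (t.equivFin.symm i : S)
  have hg : ∀ y : S, ∃ i, y ∈ U (g i) := fun y => by
    obtain ⟨p, hp, hy⟩ := mem_iUnion₂.1 (ht (mem_univ y))
    exact ⟨t.equivFin ⟨p, hp⟩, by simpa [g] using hy⟩
  refine ⟨t.card, fun i => chartAt ℂ (g i), fun i => Metric.ball (chartAt ℂ (g i) (g i)) (r (g i)) ∩
    ⋂ j ∈ Iio i, ((chartAt ℂ (g i)).target ∩ (chartAt ℂ (g i)).symm ⁻¹' U (g j))ᶜ, ?_⟩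
  refine ⟨fun i => IsManifold.chart_mem_maximalAtlas _, fun i => ?_, fun i => ?_, ?_, ?_⟩
  · exact measurableSet_ball.inter (MeasurableSet.biInter (to_countable _) fun j _ =>
      ((chartAt ℂ (g i)).isOpen_inter_preimage_symm (hUo (g j))).measurableSet.compl)
  · exact ⟨_, isCompact_closedBall _ _, inter_subset_left.trans Metric.ball_subset_closedBall,
      hrt (g i)⟩
  · have h2 : ∀ i j, j < i → ∀ y ∈ Metric.ball (chartAt ℂ (g i) (g i)) (r (g i)) ∩
        ⋂ j ∈ Iio i, ((chartAt ℂ (g i)).target ∩ (chartAt ℂ (g i)).symm ⁻¹' U (g j))ᶜ,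
        (chartAt ℂ (g i)).symm y ∉ U (g j) := by
      intro i j hj y hy hyU
      exact mem_iInter₂.1 hy.2 j hj ⟨hbt _ hy.1, hyU⟩
    intro i j hij
    refine Set.disjoint_left.2 ?_
    rintro _ ⟨y, hy, rfl⟩ ⟨y', hy', hyy⟩
    rcases lt_or_gt_of_ne hij with hlt | hlt
    · exact h2 j i hlt y' hy' (hyy ▸ ⟨y, hy.1, rfl⟩)
    · exact h2 i j hlt y hy (hyy ▸ ⟨y', hy'.1, rfl⟩)
  · refine eq_univ_of_forall fun y => ?_
    obtain ⟨i, hi, hmin⟩ := WellFounded.has_min (wellFounded_lt (α := Fin t.card))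
      {i | y ∈ U (g i)} (hg y)
    obtain ⟨ζ, hζ, rfl⟩ := hi
    refine mem_iUnion.2 ⟨i, ζ, ⟨hζ, mem_iInter₂.2 fun j hj hn => ?_⟩, rfl⟩
    exact hmin j hn.2 hj

end SurfaceForms

/-! ### Energy bounds along a curve -/

section PunctureDisc

open Complex (I)

variable {n : ℕ} {M : Type*} [TopologicalSpace M] [ChartedSpace (Model n) M]
  [IsManifold 𝓘(ℝ, Model n) ∞ M] {α : ContactForm n M}
  {S : Type*} [TopologicalSpace S] [ChartedSpace ℂ S]

/-- The pointwise inequalities between the energy density, the exterior derivative of the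
pulled-back contact form, and the components of the curve. -/
theorem energyDensity_bounds (J : α.CompatibleStructure) {u : S → ℝ × M}
    {ν : (z : S) → TangentSpace 𝓘(ℝ, ℂ) z →L[ℝ] SymplTangent (n := n) (u z)} {P : ℂ → S} {ζ : ℂ}
    (hP : MDifferentiableAt 𝓘(ℂ, ℂ) 𝓘(ℂ, ℂ) P ζ)
    (hu : MDifferentiableAt 𝓘(ℝ, ℂ) (𝓘(ℝ, ℝ).prod 𝓘(ℝ, Model n)) u (P ζ))
    (hw : ContMDiffAt 𝓘(ℝ, ℂ) 𝓘(ℝ, Model n) 2 (fun ζ => (u (P ζ)).2) ζ)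
    (hν : differential u (P ζ) +
      ((J.symplJ (u (P ζ))).comp (differential u (P ζ))).comp (complexStructure (P ζ)) = ν (P ζ)) :
    -4 * curl (α.form.pull fun ζ => (u (P ζ)).2) ζ 1 I ≤ energyDensity J u ν P ζ ∧
    α.form.d (u (P ζ)).2 (mfderiv 𝓘(ℝ, ℂ) 𝓘(ℝ, Model n) (fun ζ => (u (P ζ)).2) ζ I)
      (J.J _ (mfderiv 𝓘(ℝ, ℂ) 𝓘(ℝ, Model n) (fun ζ => (u (P ζ)).2) ζ I)) -
      2 * curl (α.form.pull fun ζ => (u (P ζ)).2) ζ 1 I ≤ energyDensity J u ν P ζ ∧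
    (α.form.pull (fun ζ => (u (P ζ)).2) ζ I - fderiv ℝ (fun ζ => (u (P ζ)).1) ζ 1) ^ 2 ≤
      energyDensity J u ν P ζ := by
  have h1 := energyDensity_eq J hP hu hν
  have h2 := α.curl_pull hw 1 I
  have h3 := J.two_d_le (u (P ζ)).2 (mfderiv 𝓘(ℝ, ℂ) 𝓘(ℝ, Model n) (fun ζ => (u (P ζ)).2) ζ (1 : ℂ))
    (mfderiv 𝓘(ℝ, ℂ) 𝓘(ℝ, Model n) (fun ζ => (u (P ζ)).2) ζ I)
  have h4 := J.d_nonneg (u (P ζ)).2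
    (mfderiv 𝓘(ℝ, ℂ) 𝓘(ℝ, Model n) (fun ζ => (u (P ζ)).2) ζ (1 : ℂ))
  have key : ∀ t m x y d : ℝ, -(2 * d) ≤ x + y → 2 * d ≤ y + x → 0 ≤ x →
      -4 * d ≤ t ^ 2 + m ^ 2 + (x + y - 2 * d) ∧ y - 2 * d ≤ t ^ 2 + m ^ 2 + (x + y - 2 * d) ∧
        m ^ 2 ≤ t ^ 2 + m ^ 2 + (x + y - 2 * d) := by
    intro t m x y d h5 h6 h9
    have h7 := sq_nonneg t
    have h8 := sq_nonneg m
    refine ⟨?_, ?_, ?_⟩ <;> linarith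
  rw [h2, h1]
  refine key _ _ _ _ _ h3 (le_trans (le_of_eq ?_) (J.two_d_le (u (P ζ)).2
    (mfderiv 𝓘(ℝ, ℂ) 𝓘(ℝ, Model n) (fun ζ => (u (P ζ)).2) ζ I)
    (mfderiv 𝓘(ℝ, ℂ) 𝓘(ℝ, Model n) (fun ζ => (u (P ζ)).2) ζ (1 : ℂ)))) h4
  rw [α.form.d_swap]
  ring

theorem continuousOn_energyDensity (J : α.CompatibleStructure) {u : S → ℝ × M}
    {ν : (z : S) → TangentSpace 𝓘(ℝ, ℂ) z →L[ℝ] SymplTangent (n := n) (u z)} {P : ℂ → S}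
    {D : Set ℂ} (hP : ∀ ζ ∈ D, MDifferentiableAt 𝓘(ℂ, ℂ) 𝓘(ℂ, ℂ) P ζ)
    (hu : ∀ ζ ∈ D, MDifferentiableAt 𝓘(ℝ, ℂ) (𝓘(ℝ, ℝ).prod 𝓘(ℝ, Model n)) u (P ζ))
    (hw : ∀ ζ ∈ D, ContMDiffAt 𝓘(ℝ, ℂ) 𝓘(ℝ, Model n) 2 (fun ζ => (u (P ζ)).2) ζ)
    (ha : ∀ ζ ∈ D, ContDiffAt ℝ 1 (fun ζ => (u (P ζ)).1) ζ)
    (hν : ∀ ζ ∈ D, differential u (P ζ) +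
      ((J.symplJ (u (P ζ))).comp (differential u (P ζ))).comp (complexStructure (P ζ)) = ν (P ζ)) :
    ContinuousOn (energyDensity J u ν P) D := by
  have h1 : ∀ ζ ∈ D, energyDensity J u ν P ζ = _ := fun ζ hζ =>
    (energyDensity_eq J (hP ζ hζ) (hu ζ hζ) (hν ζ hζ)).trans
      (congrArg (fun d => _ + _ + (_ + _ - 2 * d)) (α.curl_pull (hw ζ hζ) 1 I).symm)
  refine ContinuousOn.congr (fun ζ hζ => ContinuousAt.continuousWithinAt ?_) h1
  have ca : ∀ v : ℂ, ContinuousAt (fun ζ => fderiv ℝ (fun ζ => (u (P ζ)).1) ζ v) ζ := fun v =>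
    ((ha ζ hζ).fderiv_right (m := 0) (by norm_num)).continuousAt.clm_apply continuousAt_const
  have cp : ∀ v : ℂ, ContinuousAt (fun ζ => α.form.pull (fun ζ => (u (P ζ)).2) ζ v) ζ := fun v =>
    (α.contDiffAt_pull (hw ζ hζ)).continuousAt.clm_apply continuousAt_const
  have cc : ContinuousAt (fun ζ => curl (α.form.pull fun ζ => (u (P ζ)).2) ζ 1 I) ζ :=
    ((contDiffAt_curlForm (k := 0) (α.contDiffAt_pull (hw ζ hζ)) (by norm_num)).continuousAt.clm_apply
      continuousAt_const).clm_apply continuousAt_const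
  exact ((((ca I).add (cp 1)).pow 2).add (((cp I).sub (ca 1)).pow 2)).add
    (((J.continuousAt_d_map (hw ζ hζ) 1).add (J.continuousAt_d_map (hw ζ hζ) I)).sub
      (cc.const_mul 2))

/-- The energy in one chart is at most the total energy. -/
theorem lintegral_energyDensity_le (J : α.CompatibleStructure) (u : S → ℝ × M)
    (ν : (z : S) → TangentSpace 𝓘(ℝ, ℂ) z →L[ℝ] SymplTangent (n := n) (u z)) {k : ℕ}
    {e : Fin k → OpenPartialHomeomorph S ℂ} {A : Fin k → Set ℂ}
    (he : ∀ i, IsHolomorphicChart (e i) ∧ MeasurableSet (A i) ∧ A i ⊆ (e i).target)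
    (hA : Pairwise fun i i' => Disjoint ((e i).symm '' A i) ((e i').symm '' A i')) :
    ∑ i, ∫⁻ ζ in A i, normSqInChart J u ν (e i) ζ ≤ l2Norm J u ν ^ 2 := by
  rw [l2Norm, ← ENNReal.rpow_natCast, ← ENNReal.rpow_mul]
  norm_num
  exact le_iSup_of_le k (le_iSup_of_le e (le_iSup_of_le A (le_iSup₂_of_le
    (f := fun _ _ => ∑ i, ∫⁻ ζ in A i, normSqInChart J u ν (e i) ζ) he hA le_rfl)))

/-! ### The action near a negative puncture -/

/-- Around a negative puncture at an orbit of period larger than `T₀`, the contact form has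
integral at least `T₀` over all small circles. -/
theorem IsNegativePuncture.exists_le_integral_pull [T2Space S] [IsManifold 𝓘(ℂ, ℂ) ω S]
    (J : α.CompatibleStructure) {T₀ : ℝ}
    (hT₀ : ∀ (γ : ℝ → M) (T : ℝ), α.IsClosedOrbit γ T → T₀ < T) {z : Set S} (hz : z.Finite)
    {u : S → ℝ × M}
    (hu : ∀ q ∉ z, ContMDiffAt 𝓘(ℝ, ℂ) (𝓘(ℝ, ℝ).prod 𝓘(ℝ, Model n)) ∞ u q)
    {ν : (z : S) → TangentSpace 𝓘(ℝ, ℂ) z →L[ℝ] SymplTangent (n := n) (u z)}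
    (hν : ∀ q ∉ z, differential u q +
      ((J.symplJ (u q)).comp (differential u q)).comp (complexStructure q) = ν q)
    (hfin : l2Norm J u ν ≠ ⊤) {p : S} (hp : IsNegativePuncture α u p) :
    ∃ φ : OpenPartialHomeomorph S ℂ, IsHolomorphicChart φ ∧ p ∈ φ.source ∧ φ p = 0 ∧
      ∃ R > 0, ∀ r : ℝ, 0 < r → r < R → T₀ ≤ ∫ θ in -Real.pi..Real.pi,
        α.form.pull (fun y => (u (φ.symm y)).2) (r * Complex.exp (θ * I))
          (r * Complex.exp (θ * I) * I) := by
  obtain ⟨hlim, γ, T, hγ, φ, hφ, hpφ, hφ0, hconv⟩ := hp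
  refine ⟨φ, hφ, hpφ, hφ0, ?_⟩
  have h0 : (0 : ℂ) ∈ φ.target := hφ0 ▸ φ.map_source hpφ
  have hφp : φ.symm 0 = p := by rw [← hφ0, φ.left_inv hpφ]
  -- a punctured disc that avoids the other punctures
  have hnear : ∀ᶠ y in 𝓝 (0 : ℂ), y ∈ φ.target ∧ φ.symm y ∉ z \ {p} := by
    refine (φ.open_target.eventually_mem h0).and ?_
    have h2 : (z \ {p})ᶜ ∈ 𝓝 (φ.symm 0) :=
      (hz.subset sdiff_subset).isClosed.isOpen_compl.mem_nhds (by simp [hφp])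
    exact (φ.continuousAt_symm h0).eventually h2
  obtain ⟨ρ, hρ, hball⟩ := Metric.eventually_nhds_iff.1 hnear
  set s₀ := Real.log ρ with hs₀
  set P : ℂ → S := fun ζ => φ.symm (Complex.exp ζ) with hPdef
  have hexp : ∀ ζ : ℂ, ζ.re < s₀ → Complex.exp ζ ∈ φ.target ∧ φ.symm (Complex.exp ζ) ∉ z \ {p} :=
    fun ζ hζ => hball (by
      rw [dist_zero_right, Complex.norm_exp]
      exact (Real.lt_log_iff_exp_lt hρ).1 hζ)
  have hPz : ∀ ζ : ℂ, ζ.re < s₀ → P ζ ∉ z := by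
    intro ζ hζ hm
    have h1 := hexp ζ hζ
    have h2 : P ζ = p := by
      by_contra h3
      exact h1.2 ⟨hm, h3⟩
    exact Complex.exp_ne_zero ζ (φ.symm.injOn h1.1 h0 (h2.trans hφp.symm))
  have hPω : ∀ ζ : ℂ, ζ.re < s₀ → ContMDiffAt 𝓘(ℂ, ℂ) 𝓘(ℂ, ℂ) ω P ζ := fun ζ hζ =>
    ContMDiffAt.comp ζ (hφ.contMDiffAt_symm (hexp ζ hζ).1)
      Complex.contDiff_exp.contDiffAt.contMDiffAt
  have hPr : ∀ ζ : ℂ, ζ.re < s₀ → ContMDiffAt 𝓘(ℝ, ℂ) 𝓘(ℝ, ℂ) ∞ P ζ := fun ζ hζ =>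
    (contMDiffAt_real (hPω ζ hζ)).of_le le_top
  have hPd : ∀ ζ : ℂ, ζ.re < s₀ → MDifferentiableAt 𝓘(ℂ, ℂ) 𝓘(ℂ, ℂ) P ζ := fun ζ hζ =>
    (hPω ζ hζ).mdifferentiableAt (by simp)
  have hW : ∀ ζ : ℂ, ζ.re < s₀ →
      ContMDiffAt 𝓘(ℝ, ℂ) (𝓘(ℝ, ℝ).prod 𝓘(ℝ, Model n)) ∞ (fun ζ => u (P ζ)) ζ := fun ζ hζ =>
    ContMDiffAt.comp ζ (hu _ (hPz ζ hζ)) (hPr ζ hζ)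
  have hw : ∀ ζ : ℂ, ζ.re < s₀ →
      ContMDiffAt 𝓘(ℝ, ℂ) 𝓘(ℝ, Model n) 2 (fun ζ => (u (P ζ)).2) ζ := fun ζ hζ =>
    (contMDiffAt_snd.comp ζ (hW ζ hζ)).of_le ENat.LEInfty.out
  have ha : ∀ ζ : ℂ, ζ.re < s₀ → ContDiffAt ℝ 1 (fun ζ => (u (P ζ)).1) ζ := fun ζ hζ =>
    (contMDiffAt_iff_contDiffAt.1 (contMDiffAt_fst.comp ζ (hW ζ hζ))).of_le (by simp)
  have hud : ∀ ζ : ℂ, ζ.re < s₀ →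
      MDifferentiableAt 𝓘(ℝ, ℂ) (𝓘(ℝ, ℝ).prod 𝓘(ℝ, Model n)) u (P ζ) := fun ζ hζ =>
    (hu _ (hPz ζ hζ)).mdifferentiableAt (by simp)
  have hbd := fun ζ hζ => energyDensity_bounds J (hPd ζ hζ) (hud ζ hζ) (hw ζ hζ) (hν _ (hPz ζ hζ))
  -- the strip of width `2 π` lies in the target of a branch of `log ∘ φ`, a holomorphic chart
  have hEC : ∫⁻ ζ in {ζ : ℂ | ζ.re < s₀ ∧ ζ.im ∈ Ioo (-Real.pi) Real.pi},
      ENNReal.ofReal (energyDensity J u ν P ζ) ≤ l2Norm J u ν ^ 2 := by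
    have hmeas : MeasurableSet {ζ : ℂ | ζ.re < s₀ ∧ ζ.im ∈ Ioo (-Real.pi) Real.pi} :=
      (Complex.measurable_re measurableSet_Iio).inter (Complex.measurable_im measurableSet_Ioo)
    have h1 := lintegral_energyDensity_le J u ν (k := 1)
      (e := fun _ => φ.trans Complex.expOpenPartialHomeomorph.symm)
      (A := fun _ => {ζ : ℂ | ζ.re < s₀ ∧ ζ.im ∈ Ioo (-Real.pi) Real.pi})
      (fun _ => ⟨hφ.trans_log, hmeas, fun ζ hζ => by
        rw [OpenPartialHomeomorph.trans_target]
        exact ⟨hζ.2, (hexp ζ hζ.1).1⟩⟩)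
      (fun i j hij => absurd (Subsingleton.elim i j) hij)
    rw [Fin.sum_univ_one] at h1
    exact (lintegral_mono fun ζ => ofReal_energyDensity_le J u ν
      (φ.trans Complex.expOpenPartialHomeomorph.symm) ζ).trans h1
  -- the ends of the half-cylinder converge to the puncture
  have hP0 : Tendsto P (comap Complex.re atBot) (𝓝[≠] p) := by
    have h1 : Tendsto φ.symm (𝓝[≠] 0) (𝓝[≠] p) := by
      refine tendsto_nhdsWithin_iff.2 ⟨?_, ?_⟩
      · have := (φ.continuousAt_symm h0).tendsto
        rw [hφp] at this
        exact this.mono_left nhdsWithin_le_nhds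
      · filter_upwards [self_mem_nhdsWithin,
          mem_nhdsWithin_of_mem_nhds (φ.open_target.mem_nhds h0)] with y hy hyt h3
        exact hy (φ.symm.injOn hyt h0 (h3.trans hφp.symm))
    exact h1.comp Complex.tendsto_exp_comap_re_atBot_nhdsNE
  obtain ⟨S₁, hS₁, hS⟩ := J.eventually_le_integral_pull hγ.integralCurve (T := T) (s₀ := s₀)
    (w := fun ζ => (u (P ζ)).2) (a := fun ζ => (u (P ζ)).1) (E := energyDensity J u ν P)
    (C := l2Norm J u ν ^ 2) (by finiteness) hw ha
    (fun ζ => by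
      have h1 : Complex.exp (ζ + (2 * Real.pi : ℝ) * I) = Complex.exp ζ := by
        push_cast; exact Complex.exp_periodic ζ
      simp only [hPdef, h1])
    (continuousOn_energyDensity J hPd hud hw ha fun ζ hζ => hν _ (hPz ζ hζ))
    (energyDensity_nonneg J u ν P) (fun ζ hζ => (hbd ζ hζ).1) (fun ζ hζ => (hbd ζ hζ).2.1)
    (fun ζ hζ => (hbd ζ hζ).2.2) hEC (hlim.comp hP0)
    (fun θ₀ => by
      have h1 := (hconv θ₀).comp (f := fun q : ℝ × ℝ => (Real.exp q.1, q.2))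
        ((Real.tendsto_exp_atBot_nhdsGT.comp tendsto_fst).prodMk tendsto_snd)
      rw [neg_neg, one_mul] at h1
      refine h1.congr fun q => ?_
      simp only [Function.comp_apply, hPdef, Complex.exp_add, Complex.ofReal_exp])
    (T - T₀) (sub_pos.2 (hT₀ γ T hγ))
  -- back to the coordinate of `φ`: the circle of radius `r` is the circle at `s = log r`
  refine ⟨Real.exp S₁, Real.exp_pos _, fun r hr hrS => ?_⟩
  have h1 : Real.log r < S₁ := (Real.log_lt_iff_lt_exp hr).2 hrS
  have h2 := hS (Real.log r) h1.le
  rw [sub_sub_cancel] at h2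
  refine h2.trans (le_of_eq (intervalIntegral.integral_congr fun θ _ => ?_))
  have hre : ((Real.log r : ℂ) + θ * I).re < s₀ := by simpa using h1.trans hS₁
  have hexpr : Complex.exp ((Real.log r : ℂ) + θ * I) = r * Complex.exp (θ * I) := by
    rw [Complex.exp_add, ← Complex.ofReal_exp, Real.exp_log hr]
  have hwφ : MDifferentiableAt 𝓘(ℝ, ℂ) 𝓘(ℝ, Model n) (fun y => (u (φ.symm y)).2)
      (Complex.exp ((Real.log r : ℂ) + θ * I)) :=
    (contMDiffAt_snd.comp (Complex.exp ((Real.log r : ℂ) + θ * I))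
      (ContMDiffAt.comp (g := u) (f := φ.symm) (Complex.exp ((Real.log r : ℂ) + θ * I))
        (hu _ (hPz _ hre)) (hφ.contMDiffAt_symm_real (hexp _ hre).1))).mdifferentiableAt (by simp)
  have hexpd : HasMFDerivAt 𝓘(ℝ, ℂ) 𝓘(ℝ, ℂ) Complex.exp ((Real.log r : ℂ) + θ * I)
      (Complex.exp ((Real.log r : ℂ) + θ * I) • (1 : ℂ →L[ℝ] ℂ)) :=
    (Complex.hasDerivAt_exp _).complexToReal_fderiv.hasMFDerivAt
  have h3 := (HasMFDerivAt.comp ((Real.log r : ℂ) + θ * I) hwφ.hasMFDerivAt hexpd).mfderiv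
  rw [← hexpr]
  exact congrArg (show Model n →L[ℝ] ℝ from α.form _) (DFunLike.congr_fun h3 I)

end PunctureDisc

/-! ### Radial cut-offs -/

section Radial

open Complex (I)

/-- A smooth function of `x = r ^ 2`, equal to `0` for `r ≤ r₁` and to `1` for `r ≥ r₂`. -/
noncomputable def radialStep (r₁ r₂ x : ℝ) : ℝ :=
  Real.smoothTransition ((x - r₁ ^ 2) / (r₂ ^ 2 - r₁ ^ 2))

variable {r₁ r₂ : ℝ}

theorem contDiff_radialStep : ContDiff ℝ ∞ (radialStep r₁ r₂) :=
  Real.smoothTransition.contDiff.comp ((contDiff_id.sub contDiff_const).div_const _)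

theorem radialStep_nonneg (x : ℝ) : 0 ≤ radialStep r₁ r₂ x := Real.smoothTransition.nonneg _

theorem radialStep_le_one (x : ℝ) : radialStep r₁ r₂ x ≤ 1 := Real.smoothTransition.le_one _

theorem sq_sub_sq_pos (h₁ : 0 < r₁) (h₂ : r₁ < r₂) : 0 < r₂ ^ 2 - r₁ ^ 2 := by nlinarith

theorem radialStep_eq_zero (h₁ : 0 < r₁) (h₂ : r₁ < r₂) {x : ℝ} (hx : x ≤ r₁ ^ 2) :
    radialStep r₁ r₂ x = 0 :=
  Real.smoothTransition.zero_of_nonpos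
    (div_nonpos_of_nonpos_of_nonneg (by linarith) (sq_sub_sq_pos h₁ h₂).le)

theorem radialStep_eq_one (h₁ : 0 < r₁) (h₂ : r₁ < r₂) {x : ℝ} (hx : r₂ ^ 2 ≤ x) :
    radialStep r₁ r₂ x = 1 :=
  Real.smoothTransition.one_of_one_le
    ((one_le_div (sq_sub_sq_pos h₁ h₂)).2 (by linarith))

theorem deriv_radialStep_nonneg (h₁ : 0 < r₁) (h₂ : r₁ < r₂) (x : ℝ) :
    0 ≤ deriv (radialStep r₁ r₂) x := by
  refine Monotone.deriv_nonneg ?_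
  intro y y' hy
  refine Real.smoothTransition.monotone ?_
  have := sq_sub_sq_pos h₁ h₂
  gcongr

theorem deriv_radialStep_eq_zero (h₁ : 0 < r₁) (h₂ : r₁ < r₂) {x : ℝ}
    (hx : x < r₁ ^ 2 ∨ r₂ ^ 2 < x) : deriv (radialStep r₁ r₂) x = 0 := by
  rcases hx with hx | hx
  · have h : radialStep r₁ r₂ =ᶠ[𝓝 x] fun _ => 0 := by
      filter_upwards [Iio_mem_nhds hx] with y hy using radialStep_eq_zero h₁ h₂ (mem_Iio.1 hy).le
    rw [h.deriv_eq, deriv_const]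
  · have h : radialStep r₁ r₂ =ᶠ[𝓝 x] fun _ => 1 := by
      filter_upwards [Ioi_mem_nhds hx] with y hy using radialStep_eq_one h₁ h₂ (mem_Ioi.1 hy).le
    rw [h.deriv_eq, deriv_const]

/-- The wedge product of two real covectors on the plane, evaluated on the standard basis. -/
noncomputable def wedge (a b : ℂ →L[ℝ] ℝ) : ℝ := a 1 * b I - a I * b 1

theorem contDiff_normSq : ContDiff ℝ ∞ (fun ζ : ℂ => Complex.normSq ζ) := by
  simp only [Complex.normSq_apply]
  exact (Complex.reCLM.contDiff.mul Complex.reCLM.contDiff).add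
    (Complex.imCLM.contDiff.mul Complex.imCLM.contDiff)

/-- The differential of a radial function only sees the component of a form along circles. -/
theorem wedge_fderiv_radial {g : ℝ → ℝ} (ζ : ℂ) (hg : DifferentiableAt ℝ g (Complex.normSq ζ))
    (b : ℂ →L[ℝ] ℝ) : wedge (fderiv ℝ (fun ζ : ℂ => g (Complex.normSq ζ)) ζ) b =
      2 * deriv g (Complex.normSq ζ) * b (ζ * I) := by
  have hre := Complex.reCLM.hasFDerivAt (x := ζ)
  have him := Complex.imCLM.hasFDerivAt (x := ζ)
  have h1 : HasFDerivAt (fun ζ : ℂ => Complex.normSq ζ) _ ζ := (hre.mul hre).add (him.mul him)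
  have h2 := (hg.hasDerivAt.comp_hasFDerivAt ζ h1).fderiv
  have h3 : ζ * I = ζ.re • I - ζ.im • (1 : ℂ) := by
    apply Complex.ext <;> simp
  have h4 : fderiv ℝ (fun ζ : ℂ => g (Complex.normSq ζ)) ζ = _ := h2
  rw [wedge, h4, h3, map_sub, map_smul, map_smul]
  simp
  ring

/-- If `β` has integral at least `T₀` over all circles of radius between `r₁` and `r₂`, then the
integral of `dκ ∧ β` is at least `T₀`, for a radial function `κ` that increases from `0` to `1`. -/
theorem le_integral_wedge_radial {β : ℂ → ℂ →L[ℝ] ℝ} {T₀ : ℝ} (h₁ : 0 < r₁) (h₂ : r₁ < r₂)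
    (hβ : ∀ ζ : ℂ, r₁ ≤ ‖ζ‖ → ‖ζ‖ ≤ r₂ → ContinuousAt β ζ)
    (hT : ∀ r ∈ Icc r₁ r₂, T₀ ≤ ∫ θ in -Real.pi..Real.pi,
      β (r * Complex.exp (θ * I)) (r * Complex.exp (θ * I) * I)) :
    T₀ ≤ ∫ ζ, wedge (fderiv ℝ (fun ζ : ℂ => radialStep r₁ r₂ (Complex.normSq ζ)) ζ) (β ζ) := by
  have hpi : -Real.pi ≤ Real.pi := by linarith [Real.pi_pos]
  set g := radialStep r₁ r₂ with hg
  have hgd : Differentiable ℝ g := contDiff_radialStep.differentiable (by simp)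
  have hgc : Continuous (deriv g) := contDiff_radialStep.continuous_deriv (by simp)
  set k : ℝ → ℝ := fun r => 2 * r * deriv g (r ^ 2) with hk
  have hkc : Continuous k := by fun_prop
  have hk0 : ∀ r, 0 < r → r ∉ Icc r₁ r₂ → k r = 0 := by
    intro r hr hn
    have : deriv g (r ^ 2) = 0 := by
      refine deriv_radialStep_eq_zero h₁ h₂ ?_
      rcases lt_or_ge r r₁ with h | h
      · left; gcongr
      · right
        have h3 : r₂ < r := lt_of_not_ge fun h4 => hn ⟨h, h4⟩
        have : 0 < r₂ := h₁.trans h₂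
        gcongr
    simp [hk, this]
  have hkn : ∀ r ∈ Icc r₁ r₂, 0 ≤ k r := fun r hr =>
    mul_nonneg (by linarith [hr.1]) (deriv_radialStep_nonneg h₁ h₂ _)
  have hkint : ∫ r in r₁..r₂, k r = 1 := by
    have h3 : ∀ r ∈ uIcc r₁ r₂, HasDerivAt (fun r : ℝ => g (r ^ 2)) (k r) r := by
      intro r _
      have := (hgd (r ^ 2)).hasDerivAt.comp r (hasDerivAt_pow 2 r)
      refine this.congr_deriv ?_
      simp [hk]; ring
    rw [intervalIntegral.integral_eq_sub_of_hasDerivAt h3 (hkc.intervalIntegrable _ _), hg,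
      radialStep_eq_one h₁ h₂ le_rfl, radialStep_eq_zero h₁ h₂ le_rfl, sub_zero]
  set B : ℝ → ℝ → ℝ := fun r θ =>
    β (r * Complex.exp (θ * I)) (r * Complex.exp (θ * I) * I) with hB
  -- in polar coordinates the integrand is the derivative of `κ` in `r` times the integrand of
  -- the integral of `β` over the circle of radius `r`
  have hpolar : ∀ p ∈ polarCoord.target, p.1 • wedge (fderiv ℝ (fun ζ : ℂ => g (Complex.normSq ζ))
      (Complex.polarCoord.symm p)) (β (Complex.polarCoord.symm p)) = k p.1 * B p.1 p.2 := by
    intro p _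
    have h3 : Complex.polarCoord.symm p = p.1 * Complex.exp (p.2 * I) := by
      rw [Complex.polarCoord_symm_apply, Complex.exp_mul_I, Complex.ofReal_cos, Complex.ofReal_sin]
    have h4 : Complex.normSq (p.1 * Complex.exp (p.2 * I)) = p.1 ^ 2 := by
      rw [Complex.normSq_eq_norm_sq, norm_mul, Complex.norm_exp_ofReal_mul_I, Complex.norm_real,
        mul_one, Real.norm_eq_abs, sq_abs]
    rw [h3, wedge_fderiv_radial _ (hgd _), h4, smul_eq_mul]
    simp only [hk, hB]
    ring
  have hBc : ContinuousOn (fun p : ℝ × ℝ => k p.1 * B p.1 p.2)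
      (Icc r₁ r₂ ×ˢ Icc (-Real.pi) Real.pi) := by
    intro p hp
    have hn : ‖(p.1 : ℂ) * Complex.exp (p.2 * I)‖ = p.1 := by
      rw [norm_mul, Complex.norm_exp_ofReal_mul_I, Complex.norm_real, mul_one, Real.norm_eq_abs,
        abs_of_pos (h₁.trans_le hp.1.1)]
    have h3 : ContinuousAt (fun p : ℝ × ℝ => (p.1 : ℂ) * Complex.exp (p.2 * I)) p := by fun_prop
    have h4 : ContinuousAt (fun p : ℝ × ℝ => β ((p.1 : ℂ) * Complex.exp (p.2 * I))) p :=
      ContinuousAt.comp (g := β) (f := fun p : ℝ × ℝ => (p.1 : ℂ) * Complex.exp (p.2 * I))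
        (hβ _ (by rw [hn]; exact hp.1.1) (by rw [hn]; exact hp.1.2)) h3
    exact ((hkc.comp continuous_fst).continuousAt.mul
      (h4.clm_apply (h3.mul continuousAt_const))).continuousWithinAt
  have hint : IntegrableOn (fun p : ℝ × ℝ => k p.1 * B p.1 p.2)
      (Icc r₁ r₂ ×ˢ Ioo (-Real.pi) Real.pi) (volume.prod volume) :=
    (hBc.integrableOn_compact (isCompact_Icc.prod isCompact_Icc)).mono_set
      (prod_mono le_rfl Ioo_subset_Icc_self)
  have hinner : ∀ r, ∫ θ in Ioo (-Real.pi) Real.pi, k r * B r θ =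
      k r * ∫ θ in -Real.pi..Real.pi, B r θ := fun r => by
    rw [intervalIntegral.integral_of_le hpi, integral_Ioc_eq_integral_Ioo, integral_const_mul]
  have hint' : IntegrableOn (fun r => k r * ∫ θ in -Real.pi..Real.pi, B r θ) (Icc r₁ r₂) := by
    have h3 := hint
    rw [IntegrableOn, ← Measure.prod_restrict] at h3
    exact h3.integral_prod_left.congr (Eventually.of_forall hinner)
  rw [← Complex.integral_comp_polarCoord_symm,
    setIntegral_congr_fun polarCoord.open_target.measurableSet hpolar,
    setIntegral_eq_of_subset_of_forall_sdiff_eq_zero (s := Icc r₁ r₂ ×ˢ Ioo (-Real.pi) Real.pi)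
      polarCoord.open_target.measurableSet
      (fun p hp => ⟨h₁.trans_le hp.1.1, hp.2⟩)
      (fun p hp => by
        rw [hk0 p.1 hp.1.1 fun h => hp.2 ⟨h, hp.1.2⟩, zero_mul]),
    Measure.volume_eq_prod, setIntegral_prod _ hint]
  simp only [hinner]
  calc T₀ = ∫ r in Icc r₁ r₂, k r * T₀ := by
        rw [integral_mul_const, integral_Icc_eq_integral_Ioc,
          ← intervalIntegral.integral_of_le h₂.le, hkint, one_mul]
    _ ≤ _ := setIntegral_mono_on ((hkc.mul continuous_const).continuousOn.integrableOn_compact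
          isCompact_Icc) hint' measurableSet_Icc fun r hr =>
        mul_le_mul_of_nonneg_left (hT r hr) (hkn r hr)

end Radial

/-! ### Cut-offs at the punctures -/

section Cutoff

open Complex (I)

theorem wedge_neg_left (a b : ℂ →L[ℝ] ℝ) : wedge (-a) b = -wedge a b := by
  simp only [wedge, neg_apply]; ring

theorem wedge_zero_left (b : ℂ →L[ℝ] ℝ) : wedge 0 b = 0 := by simp [wedge]

theorem wedge_zero_right (a : ℂ →L[ℝ] ℝ) : wedge a 0 = 0 := by simp [wedge]

theorem wedge_sum_left {ι : Type*} (t : Finset ι) (a : ι → ℂ →L[ℝ] ℝ) (b : ℂ →L[ℝ] ℝ) :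
    wedge (∑ i ∈ t, a i) b = ∑ i ∈ t, wedge (a i) b := by
  simp only [wedge, sum_apply, Finset.sum_mul, Finset.sum_sub_distrib]

/-- The Leibniz rule `d(χ β) = χ dβ + dχ ∧ β`. -/
theorem curl_smul {χ : ℂ → ℝ} {β : ℂ → ℂ →L[ℝ] ℝ} {ζ : ℂ} (hχ : DifferentiableAt ℝ χ ζ)
    (hβ : DifferentiableAt ℝ β ζ) :
    curl (fun ζ => χ ζ • β ζ) ζ 1 I = χ ζ * curl β ζ 1 I + wedge (fderiv ℝ χ ζ) (β ζ) := by
  rw [curl, fderiv_fun_smul hχ hβ]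
  simp [curl, wedge]
  ring

/-- The function on `S` that equals `1 - radialStep` in the chart `φ` and vanishes outside of it.
It is smooth if `φ` covers the closed disc of radius `r₂`. -/
noncomputable def discBump {S : Type*} [TopologicalSpace S] (φ : OpenPartialHomeomorph S ℂ)
    (r₁ r₂ : ℝ) : S → ℝ :=
  φ.source.indicator fun y => 1 - radialStep r₁ r₂ (Complex.normSq (φ y))

variable {S : Type*} [TopologicalSpace S] {φ : OpenPartialHomeomorph S ℂ} {r₁ r₂ : ℝ}

theorem discBump_nonneg (y : S) : 0 ≤ discBump φ r₁ r₂ y :=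
  indicator_nonneg (fun _ _ => sub_nonneg.2 (radialStep_le_one _)) y

theorem discBump_le_one (y : S) : discBump φ r₁ r₂ y ≤ 1 :=
  indicator_le' (fun _ _ => sub_le_self _ (radialStep_nonneg _)) (fun _ _ => zero_le_one) y

theorem discBump_symm {ζ : ℂ} (hζ : ζ ∈ φ.target) :
    discBump φ r₁ r₂ (φ.symm ζ) = 1 - radialStep r₁ r₂ (Complex.normSq ζ) := by
  rw [discBump, indicator_of_mem (φ.map_target hζ), φ.right_inv hζ]

theorem discBump_eq_zero (h₁ : 0 < r₁) (h₂ : r₁ < r₂) {y : S}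
    (hy : y ∉ φ.symm '' Metric.closedBall 0 r₂) : discBump φ r₁ r₂ y = 0 := by
  by_cases h : y ∈ φ.source
  · have h3 : r₂ < ‖φ y‖ := by
      by_contra h4
      exact hy ⟨φ y, by simpa using h4, φ.left_inv h⟩
    have h5 : r₂ ^ 2 ≤ Complex.normSq (φ y) := by
      have : 0 < r₂ := h₁.trans h₂
      rw [Complex.normSq_eq_norm_sq]; gcongr
    rw [discBump, indicator_of_mem h, radialStep_eq_one h₁ h₂ h5, sub_self]
  · exact indicator_of_notMem h _

theorem isCompact_disc (hball : Metric.closedBall 0 r₂ ⊆ φ.target) :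
    IsCompact (φ.symm '' Metric.closedBall 0 r₂) :=
  (isCompact_closedBall _ _).image_of_continuousOn (φ.symm.continuousOn.mono hball)

theorem discBump_eventuallyEq_zero [T2Space S] (h₁ : 0 < r₁) (h₂ : r₁ < r₂)
    (hball : Metric.closedBall 0 r₂ ⊆ φ.target) {y : S}
    (hy : y ∉ φ.symm '' Metric.closedBall 0 r₂) : discBump φ r₁ r₂ =ᶠ[𝓝 y] fun _ => 0 := by
  filter_upwards [(isCompact_disc hball).isClosed.isOpen_compl.mem_nhds hy] with y' hy'
    using discBump_eq_zero h₁ h₂ hy'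

variable [ChartedSpace ℂ S]

theorem contMDiff_discBump [T2Space S] (hφ : IsHolomorphicChart φ) (h₁ : 0 < r₁) (h₂ : r₁ < r₂)
    (hball : Metric.closedBall 0 r₂ ⊆ φ.target) :
    ContMDiff 𝓘(ℝ, ℂ) 𝓘(ℝ, ℝ) ∞ (discBump φ r₁ r₂) := by
  intro y
  by_cases h : y ∈ φ.source
  · have h3 : ContMDiffAt 𝓘(ℝ, ℂ) 𝓘(ℝ, ℝ) ∞
        (fun y => 1 - radialStep r₁ r₂ (Complex.normSq (φ y))) y :=
      ContMDiffAt.comp (g := fun ζ : ℂ => 1 - radialStep r₁ r₂ (Complex.normSq ζ)) (f := φ) y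
        (contDiff_const.sub (contDiff_radialStep.comp contDiff_normSq)).contDiffAt.contMDiffAt
        (hφ.contMDiffAt_real h)
    refine h3.congr_of_eventuallyEq ?_
    filter_upwards [φ.open_source.mem_nhds h] with y' hy' using indicator_of_mem hy' _
  · refine contMDiffAt_const.congr_of_eventuallyEq
      (discBump_eventuallyEq_zero h₁ h₂ hball fun ⟨ζ, hζ, hy⟩ => h ?_)
    rw [← hy]
    exact φ.map_target (hball hζ)

/-- The wedge product of the differential of a function with a one-form is a density. -/
theorem IsOneForm.isDensity_wedge {F : OpenPartialHomeomorph S ℂ → ℂ → ℂ →L[ℝ] ℝ}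
    (hF : IsOneForm F) {b : S → ℝ} (hb : ContMDiff 𝓘(ℝ, ℂ) 𝓘(ℝ, ℝ) ∞ b) :
    IsDensity fun e ζ => wedge (fderiv ℝ (fun ζ => b (e.symm ζ)) ζ) (F e ζ) := by
  have key := isDensity_of_alternating (B := fun (e : OpenPartialHomeomorph S ℂ) ζ =>
    (fderiv ℝ (fun ζ => b (e.symm ζ)) ζ).smulRight (F e ζ) -
      (F e ζ).smulRight (fderiv ℝ (fun ζ => b (e.symm ζ)) ζ))
    (fun e ζ v v' => by simp; ring) fun e e' he he' ζ hζ hζ' => ?_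
  · intro e e' he he' ζ hζ hζ'
    have h := key e e' he he' ζ hζ hζ'
    simp only [sub_apply, ContinuousLinearMap.smulRight_apply, smul_apply, smul_eq_mul] at h
    simp only [wedge]
    rw [mul_comm (fderiv ℝ (fun ζ => b (e.symm ζ)) ζ I),
      mul_comm (fderiv ℝ (fun ζ => b (e'.symm ζ)) _ I)]
    exact h
  · have h1 : (fun ζ => b (e.symm ζ)) =ᶠ[𝓝 ζ] fun y => b (e'.symm (e' (e.symm y))) := by
      filter_upwards [eventually_mem_trans hζ hζ'] with y hy
      rw [e'.left_inv hy.2]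
    have h2 := fderiv_comp (g := fun ζ => b (e'.symm ζ)) (f := fun y => e' (e.symm y)) ζ
      ((contDiffAt_comp_symm hb he' (e'.map_source hζ')).differentiableAt (by simp))
      ((contDiffAt_trans he he' hζ hζ').differentiableAt (by simp))
    have h3 : fderiv ℝ (fun ζ => b (e.symm ζ)) ζ = _ := h1.fderiv_eq.trans h2
    rw [hF e e' he he' ζ hζ hζ', h3]
    simp

/-- A one-form `F` on `S \ z` that has integral at least `T₀` over all small circles around the
puncture `p` admits a cut-off `b` near `p` for which the integral of `db ∧ F` is at most `-T₀`. -/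
theorem exists_cutoff [T2Space S] {z : Set S} {F : OpenPartialHomeomorph S ℂ → ℂ → ℂ →L[ℝ] ℝ}
    (hF : IsOneForm F)
    (hFc : ∀ e, IsHolomorphicChart e → ∀ ζ ∈ e.target, e.symm ζ ∉ z → ContinuousAt (F e) ζ)
    {p : S} {φ : OpenPartialHomeomorph S ℂ} (hφ : IsHolomorphicChart φ)
    (hpφ : p ∈ φ.source) (hφ0 : φ p = 0) {β : ℂ → ℂ →L[ℝ] ℝ}
    (hβ : ∀ ζ ∈ φ.target, φ.symm ζ ∉ z → F φ ζ = β ζ) {R T₀ : ℝ} (hR : 0 < R)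
    (hT : ∀ r : ℝ, 0 < r → r < R → T₀ ≤ ∫ θ in -Real.pi..Real.pi,
      β (r * Complex.exp (θ * I)) (r * Complex.exp (θ * I) * I))
    {U : Set S} (hU : IsOpen U) (hpU : p ∈ U) (hUz : ∀ q ∈ z, q ∈ U → q = p) :
    ∃ b : S → ℝ, ContMDiff 𝓘(ℝ, ℂ) 𝓘(ℝ, ℝ) ∞ b ∧ (∀ y, 0 ≤ b y) ∧ (∀ y, b y ≤ 1) ∧
      (∀ y ∉ U, b y = 0) ∧ (∀ᶠ y in 𝓝 p, b y = 1) ∧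
      (∀ e, IsHolomorphicChart e → ContinuousOn
        (fun ζ => wedge (fderiv ℝ (fun ζ => b (e.symm ζ)) ζ) (F e ζ)) e.target) ∧
      ∀ (k : ℕ) (e : Fin k → OpenPartialHomeomorph S ℂ) (A : Fin k → Set ℂ), IsDissection e A →
        ∑ i, ∫ ζ in A i, wedge (fderiv ℝ (fun ζ => b ((e i).symm ζ)) ζ) (F (e i) ζ) ≤ -T₀ := by
  have h0 : (0 : ℂ) ∈ φ.target := hφ0 ▸ φ.map_source hpφ
  have hφp : φ.symm 0 = p := by rw [← hφ0, φ.left_inv hpφ]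
  have hnear : ∀ᶠ y in 𝓝 (0 : ℂ), y ∈ φ.target ∧ φ.symm y ∈ U :=
    (φ.open_target.eventually_mem h0).and
      ((φ.continuousAt_symm h0).eventually (hU.mem_nhds (hφp.symm ▸ hpU)))
  obtain ⟨ρ, hρ, hball⟩ := Metric.eventually_nhds_iff.1 hnear
  obtain ⟨r₂, hr₂, hr₂'⟩ := exists_between (lt_min hρ hR)
  have hrρ : r₂ < ρ := hr₂'.trans_le (min_le_left _ _)
  have hrR : r₂ < R := hr₂'.trans_le (min_le_right _ _)
  obtain ⟨r₁, h₁, h₂⟩ := exists_between hr₂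
  have hin : ∀ ζ : ℂ, ‖ζ‖ ≤ r₂ → ζ ∈ φ.target ∧ φ.symm ζ ∈ U := fun ζ hζ =>
    hball (by rw [dist_zero_right]; exact hζ.trans_lt hrρ)
  have hdisc : Metric.closedBall 0 r₂ ⊆ φ.target := fun ζ hζ =>
    (hin ζ (mem_closedBall_zero_iff.1 hζ)).1
  have hdiscU : φ.symm '' Metric.closedBall 0 r₂ ⊆ U := by
    rintro _ ⟨ζ, hζ, rfl⟩
    exact (hin ζ (mem_closedBall_zero_iff.1 hζ)).2
  have hoff : ∀ ζ : ℂ, 0 < ‖ζ‖ → ‖ζ‖ ≤ r₂ → φ.symm ζ ∉ z := by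
    intro ζ hζ hζ' hm
    have h3 := hUz _ hm (hin ζ hζ').2
    have h4 := φ.symm.injOn (hin ζ hζ').1 h0 (h3.trans hφp.symm)
    simp [h4] at hζ
  set b := discBump φ r₁ r₂ with hb
  have hbs : ContMDiff 𝓘(ℝ, ℂ) 𝓘(ℝ, ℝ) ∞ b := contMDiff_discBump hφ h₁ h₂ hdisc
  have hbp : ∀ᶠ y in 𝓝 p, b y = 1 := by
    have h3 : ContinuousAt (fun y => ‖φ y‖) p := (φ.continuousAt hpφ).norm
    have h4 : ‖φ p‖ < r₁ := by simpa [hφ0] using h₁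
    filter_upwards [φ.open_source.mem_nhds hpφ, h3.eventually (gt_mem_nhds h4)] with y hy hy'
    have h5 : Complex.normSq (φ y) ≤ r₁ ^ 2 := by
      rw [Complex.normSq_eq_norm_sq]; gcongr
    rw [hb, discBump, indicator_of_mem hy, radialStep_eq_zero h₁ h₂ h5, sub_zero]
  have hconst : ∀ q ∈ z, ∃ c, b =ᶠ[𝓝 q] fun _ => c := by
    intro q hq
    by_cases hqp : q = p
    · exact ⟨1, hqp ▸ hbp⟩
    · exact ⟨0, discBump_eventuallyEq_zero h₁ h₂ hdisc fun h3 => hqp (hUz q hq (hdiscU h3))⟩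
  have hfd0 : ∀ (e : OpenPartialHomeomorph S ℂ) (ζ : ℂ) (c : ℝ), ζ ∈ e.target →
      (b =ᶠ[𝓝 (e.symm ζ)] fun _ => c) → ∀ᶠ y in 𝓝 ζ, fderiv ℝ (fun ζ => b (e.symm ζ)) y = 0 := by
    intro e ζ c hζ hc
    have h3 : (fun ζ => b (e.symm ζ)) =ᶠ[𝓝 ζ] fun _ => c :=
      (e.continuousAt_symm hζ).eventually hc
    filter_upwards [h3.eventuallyEq_nhds] with y hy
    rw [hy.fderiv_eq, fderiv_const_apply]
  have hWc : ∀ e, IsHolomorphicChart e → ContinuousOn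
      (fun ζ => wedge (fderiv ℝ (fun ζ => b (e.symm ζ)) ζ) (F e ζ)) e.target := by
    intro e he ζ hζ
    refine ContinuousAt.continuousWithinAt ?_
    by_cases hζz : e.symm ζ ∈ z
    · obtain ⟨c, hc⟩ := hconst _ hζz
      refine (continuousAt_const (y := (0 : ℝ))).congr ?_
      filter_upwards [hfd0 e ζ c hζ hc] with y hy
      rw [hy, wedge_zero_left]
    · have h3 : ContinuousAt (fderiv ℝ (fun ζ => b (e.symm ζ))) ζ :=
        ((contDiffAt_comp_symm hbs he hζ).fderiv_right (m := 0) (by simp)).continuousAt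
      have h4 := hFc e he ζ hζ hζz
      exact ((h3.clm_apply continuousAt_const).mul (h4.clm_apply continuousAt_const)).sub
        ((h3.clm_apply continuousAt_const).mul (h4.clm_apply continuousAt_const))
  refine ⟨b, hbs, discBump_nonneg, discBump_le_one, fun y hy =>
    discBump_eq_zero h₁ h₂ fun h3 => hy (hdiscU h3), hbp, hWc, fun k e A hA => ?_⟩
  set κ : ℂ → ℝ := fun ζ => radialStep r₁ r₂ (Complex.normSq ζ) with hκ
  have hκ0 : ∀ ζ : ℂ, r₂ < ‖ζ‖ → fderiv ℝ κ ζ = 0 := by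
    intro ζ hζ
    have h3 : κ =ᶠ[𝓝 ζ] fun _ => 1 := by
      filter_upwards [continuous_norm.continuousAt.eventually (lt_mem_nhds hζ)] with y hy
      refine radialStep_eq_one h₁ h₂ ?_
      have : 0 < r₂ := hr₂
      rw [Complex.normSq_eq_norm_sq]
      gcongr
    rw [h3.fderiv_eq, fderiv_const_apply]
  have hWφ : ∀ ζ ∈ φ.target, wedge (fderiv ℝ (fun ζ => b (φ.symm ζ)) ζ) (F φ ζ) =
      -wedge (fderiv ℝ κ ζ) (F φ ζ) := by
    intro ζ hζ
    have h3 : (fun ζ => b (φ.symm ζ)) =ᶠ[𝓝 ζ] fun ζ => 1 - κ ζ := by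
      filter_upwards [φ.open_target.mem_nhds hζ] with y hy using discBump_symm hy
    rw [h3.fderiv_eq, fderiv_const_sub, wedge_neg_left]
  have hint : IntegrableOn (fun ζ => wedge (fderiv ℝ (fun ζ => b (φ.symm ζ)) ζ) (F φ ζ))
      φ.target := by
    refine (((hWc φ hφ).mono hdisc).integrableOn_compact
      (isCompact_closedBall 0 r₂)).of_forall_sdiff_eq_zero φ.open_target.measurableSet
      fun ζ hζ => ?_
    rw [hWφ ζ hζ.1, hκ0 ζ (by simpa using hζ.2), wedge_zero_left, neg_zero]
  rw [hA.sum_setIntegral_eq (hF.isDensity_wedge hbs) hφ ?_ hint]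
  · rw [setIntegral_congr_fun φ.open_target.measurableSet hWφ, integral_neg,
      setIntegral_eq_integral_of_forall_compl_eq_zero fun ζ hζ => by
        rw [hκ0 ζ (lt_of_not_ge fun h3 => hζ (hin ζ h3).1), wedge_zero_left]]
    refine neg_le_neg (le_integral_wedge_radial h₁ h₂ (fun ζ hζ hζ' =>
      hFc φ hφ ζ (hin ζ hζ').1 (hoff ζ (h₁.trans_le hζ) hζ')) fun r hr => ?_)
    refine (hT r (h₁.trans_le hr.1) (hr.2.trans_lt hrR)).trans (le_of_eq ?_)
    refine intervalIntegral.integral_congr fun θ _ => ?_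
    have hn : ‖(r : ℂ) * Complex.exp (θ * I)‖ = r := by
      rw [norm_mul, Complex.norm_exp_ofReal_mul_I, Complex.norm_real, mul_one, Real.norm_eq_abs,
        abs_of_pos (h₁.trans_le hr.1)]
    rw [hβ _ (hin _ (hn.le.trans hr.2)).1
      (hoff _ (by rw [hn]; exact h₁.trans_le hr.1) (hn.le.trans hr.2))]
  · intro i ζ hζ hn
    have h3 : (e i).symm ζ ∉ φ.symm '' Metric.closedBall 0 r₂ := by
      rintro ⟨y, hy, hyy⟩
      exact hn (hyy ▸ φ.map_target (hdisc hy))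
    have h4 := (hfd0 (e i) ζ 0 (hA.subset_target i hζ)
      (discBump_eventuallyEq_zero h₁ h₂ hdisc h3)).self_of_nhds
    rw [h4, wedge_zero_left]

end Cutoff

/-! ### The energy of a curve without positive punctures -/

section Final

open Complex (I)

variable {n : ℕ} {M : Type*} [TopologicalSpace M] [ChartedSpace (Model n) M]
  {S : Type*} [TopologicalSpace S]

/-- The pull-back of a one-form under a map `w : S → M` that is of interest outside `z` only, in
the chart `e`; it is given the value zero at the points of `z`. -/
noncomputable def curveForm (α : OneForm n M) (w : S → M) (z : Set S)
    (e : OpenPartialHomeomorph S ℂ) : ℂ → ℂ →L[ℝ] ℝ :=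
  {ζ | e.symm ζ ∉ z}.indicator (α.pull fun ζ => w (e.symm ζ))

variable {z : Set S} {w : S → M}

theorem curveForm_apply (α : OneForm n M) {e : OpenPartialHomeomorph S ℂ} {ζ : ℂ}
    (hζ : e.symm ζ ∉ z) : curveForm α w z e ζ = α.pull (fun ζ => w (e.symm ζ)) ζ :=
  indicator_of_mem (s := {ζ | e.symm ζ ∉ z}) hζ _

theorem curveForm_of_mem (α : OneForm n M) {e : OpenPartialHomeomorph S ℂ} {ζ : ℂ}
    (hζ : e.symm ζ ∈ z) : curveForm α w z e ζ = 0 :=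
  indicator_of_notMem (s := {ζ | e.symm ζ ∉ z}) (fun h => h hζ) _

theorem curveForm_eventuallyEq (α : OneForm n M) (hz : IsClosed z)
    {e : OpenPartialHomeomorph S ℂ} {ζ : ℂ} (hζ : ζ ∈ e.target) (hζz : e.symm ζ ∉ z) :
    curveForm α w z e =ᶠ[𝓝 ζ] α.pull fun ζ => w (e.symm ζ) := by
  filter_upwards [(e.continuousAt_symm hζ).eventually (hz.isOpen_compl.mem_nhds hζz)] with y hy
    using curveForm_apply α hy

variable [ChartedSpace ℂ S]

theorem isOneForm_curveForm (α : OneForm n M)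
    (hw : ∀ q ∉ z, MDifferentiableAt 𝓘(ℝ, ℂ) 𝓘(ℝ, Model n) w q) :
    IsOneForm (curveForm α w z) := by
  intro e e' he he' ζ hζ hζ'
  by_cases hζz : e.symm ζ ∈ z
  · rw [curveForm_of_mem α hζz, curveForm_of_mem α (by rwa [e'.left_inv hζ']),
      ContinuousLinearMap.zero_comp]
  · rw [curveForm_apply α hζz, curveForm_apply α (by rwa [e'.left_inv hζ'])]
    have h1 : MDifferentiableAt 𝓘(ℝ, ℂ) 𝓘(ℝ, Model n) (fun ζ => w (e'.symm ζ))
        (e' (e.symm ζ)) :=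
      MDifferentiableAt.comp (g := w) (f := e'.symm) (e' (e.symm ζ))
        (by rw [e'.left_inv hζ']; exact hw _ hζz)
        ((he'.contMDiffAt_symm_real (e'.map_source hζ')).mdifferentiableAt (by simp))
    have h2 := ((contDiffAt_trans he he' hζ hζ').differentiableAt (by simp)).hasFDerivAt
    have h3 : HasMFDerivAt 𝓘(ℝ, ℂ) 𝓘(ℝ, Model n) (fun ζ => w (e'.symm (e' (e.symm ζ)))) ζ _ :=
      HasMFDerivAt.comp (g := fun y => w (e'.symm y)) (f := fun y => e' (e.symm y)) ζ
        h1.hasMFDerivAt h2.hasMFDerivAt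
    have h4 : (fun ζ => w (e.symm ζ)) =ᶠ[𝓝 ζ] fun ζ => w (e'.symm (e' (e.symm ζ))) := by
      filter_upwards [eventually_mem_trans hζ hζ'] with y hy
      rw [e'.left_inv hy.2]
    have h5 := (h3.congr_of_eventuallyEq h4).mfderiv
    ext v
    exact α.apply_congr h4.self_of_nhds (DFunLike.congr_fun h5 v)

variable [IsManifold 𝓘(ℝ, Model n) ∞ M]

theorem contDiffAt_curveForm (α : ContactForm n M) (hz : IsClosed z)
    (hw : ∀ q ∉ z, ContMDiffAt 𝓘(ℝ, ℂ) 𝓘(ℝ, Model n) 2 w q) {e : OpenPartialHomeomorph S ℂ}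
    (he : IsHolomorphicChart e) {ζ : ℂ} (hζ : ζ ∈ e.target) (hζz : e.symm ζ ∉ z) :
    ContDiffAt ℝ 1 (curveForm α.form w z e) ζ :=
  (α.contDiffAt_pull (ContMDiffAt.comp ζ (hw _ hζz)
    ((he.contMDiffAt_symm_real hζ).of_le ENat.LEInfty.out))).congr_of_eventuallyEq
      (curveForm_eventuallyEq α.form hz hζ hζz)

/-- A curve all of whose punctures are negative, and which has at least one of them, has energy at
least `4 T₀`, if `T₀` is a lower bound for the periods of the closed orbits. -/
theorem le_l2Norm_sq {α : ContactForm n M} (J : α.CompatibleStructure) [T2Space S] [CompactSpace S]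
    [IsManifold 𝓘(ℂ, ℂ) ω S] {T₀ : ℝ} (hT₀ : 0 < T₀)
    (hT₀_lt : ∀ (γ : ℝ → M) (T : ℝ), α.IsClosedOrbit γ T → T₀ < T) (hz : z.Finite)
    (hne : z.Nonempty) {u : S → ℝ × M}
    (hu : ∀ q ∉ z, ContMDiffAt 𝓘(ℝ, ℂ) (𝓘(ℝ, ℝ).prod 𝓘(ℝ, Model n)) ∞ u q)
    (huz : ∀ p ∈ z, IsNegativePuncture α u p)
    {ν : (z : S) → TangentSpace 𝓘(ℝ, ℂ) z →L[ℝ] SymplTangent (n := n) (u z)}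
    (hν : ∀ q ∉ z, differential u q +
      ((J.symplJ (u q)).comp (differential u q)).comp (complexStructure q) = ν q)
    (hfin : l2Norm J u ν ≠ ⊤) : ENNReal.ofReal (4 * T₀) ≤ l2Norm J u ν ^ 2 := by
  have hzc : IsClosed z := hz.isClosed
  have hw : ∀ q ∉ z, ContMDiffAt 𝓘(ℝ, ℂ) 𝓘(ℝ, Model n) 2 (fun q => (u q).2) q := fun q hq =>
    (contMDiffAt_snd.comp q (hu q hq)).of_le ENat.LEInfty.out
  set F := curveForm α.form (fun q => (u q).2) z with hFdef
  have hF : IsOneForm F := isOneForm_curveForm α.form fun q hq =>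
    (hw q hq).mdifferentiableAt (by norm_num)
  have hF1 : ∀ e, IsHolomorphicChart e → ∀ ζ ∈ e.target, e.symm ζ ∉ z → ContDiffAt ℝ 1 (F e) ζ :=
    fun e he ζ hζ hζz => contDiffAt_curveForm α hzc hw he hζ hζz
  -- cut-offs `b p` at the punctures, with disjoint supports
  obtain ⟨U, hU, hUd⟩ := hz.t2_separation
  have hUz : ∀ p ∈ z, ∀ q ∈ z, q ∈ U p → q = p := by
    intro p hp q hq hqU
    by_contra hqp
    exact Set.disjoint_left.1 (hUd hq hp hqp) (hU q).1 hqU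
  have hcut : ∀ p : z, ∃ b : S → ℝ, ContMDiff 𝓘(ℝ, ℂ) 𝓘(ℝ, ℝ) ∞ b ∧ (∀ y, 0 ≤ b y) ∧
      (∀ y, b y ≤ 1) ∧ (∀ y ∉ U p, b y = 0) ∧ (∀ᶠ y in 𝓝 (p : S), b y = 1) ∧
      (∀ e, IsHolomorphicChart e → ContinuousOn
        (fun ζ => wedge (fderiv ℝ (fun ζ => b (e.symm ζ)) ζ) (F e ζ)) e.target) ∧
      ∀ (k : ℕ) (e : Fin k → OpenPartialHomeomorph S ℂ) (A : Fin k → Set ℂ), IsDissection e A →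
        ∑ i, ∫ ζ in A i, wedge (fderiv ℝ (fun ζ => b ((e i).symm ζ)) ζ) (F (e i) ζ) ≤ -T₀ := by
    intro p
    obtain ⟨φ, hφ, hpφ, hφ0, R, hR, hT⟩ :=
      (huz p p.2).exists_le_integral_pull J hT₀_lt hz hu hν hfin
    exact exists_cutoff hF (fun e he ζ hζ hζz => (hF1 e he ζ hζ hζz).continuousAt) hφ hpφ hφ0
      (fun ζ _ hζz => curveForm_apply α.form hζz) hR hT (hU p).2 (hU p).1 (hUz p p.2)
  choose b hb hb0 hb1 hbU hbp hbc hbW using hcut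
  have : Fintype z := hz.fintype
  set η : S → ℝ := fun y => 1 - ∑ p, b p y with hη
  have hsingle : ∀ (p : z), ∀ y ∈ U p, ∑ q, b q y = b p y := by
    intro p y hy
    refine Finset.sum_eq_single p (fun q _ hqp => hbU q y fun hyq => ?_) (by simp)
    exact Set.disjoint_left.1 (hUd q.2 p.2 fun h => hqp (Subtype.ext h)) hyq hy
  have hη0 : ∀ y, 0 ≤ η y := by
    intro y
    by_cases h : ∃ p : z, y ∈ U p
    · obtain ⟨p, hp⟩ := h
      simp only [hη, hsingle p y hp]
      linarith [hb1 p y]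
    · rw [hη]
      simp only [not_exists] at h
      simp [Finset.sum_eq_zero fun q (_ : q ∈ Finset.univ) => hbU q y (h q)]
  have hη1 : ∀ y, η y ≤ 1 := fun y =>
    sub_le_self _ (Finset.sum_nonneg fun q _ => hb0 q y)
  have hηz : ∀ q ∈ z, ∀ᶠ y in 𝓝 q, η y = 0 := by
    intro q hq
    filter_upwards [hbp ⟨q, hq⟩, (hU q).2.mem_nhds (hU q).1] with y hy hyU
    simp only [hη, hsingle ⟨q, hq⟩ y hyU, hy, sub_self]
  have hηs : ContMDiff 𝓘(ℝ, ℂ) 𝓘(ℝ, ℝ) ∞ η :=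
    contMDiff_const.sub (contMDiff_finsetSum fun p _ => hb p)
  have hηF : ∀ (e : OpenPartialHomeomorph S ℂ), ∀ ζ ∈ e.target, e.symm ζ ∈ z →
      (fun ζ => η (e.symm ζ) • F e ζ) =ᶠ[𝓝 ζ] 0 := by
    intro e ζ hζ hζz
    filter_upwards [(e.continuousAt_symm hζ).eventually (hηz _ hζz)] with y hy
    rw [hy, zero_smul]; rfl
  have hηF1 : IsC1Form fun e ζ => η (e.symm ζ) • F e ζ := by
    intro e he ζ hζ
    by_cases hζz : e.symm ζ ∈ z
    · exact (contDiffAt_const (c := (0 : ℂ →L[ℝ] ℝ))).congr_of_eventuallyEq (hηF e ζ hζ hζz)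
    · exact ((contDiffAt_comp_symm hηs he hζ).of_le (by simp)).smul (hF1 e he ζ hζ hζz)
  -- the Leibniz rule
  have hleib : ∀ (e : OpenPartialHomeomorph S ℂ), IsHolomorphicChart e → ∀ ζ ∈ e.target,
      η (e.symm ζ) * curl (F e) ζ 1 I = curl (fun ζ => η (e.symm ζ) • F e ζ) ζ 1 I +
        ∑ p, wedge (fderiv ℝ (fun ζ => b p (e.symm ζ)) ζ) (F e ζ) := by
    intro e he ζ hζ
    by_cases hζz : e.symm ζ ∈ z
    · have h1 : F e ζ = 0 := curveForm_of_mem α.form hζz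
      rw [(hηz _ hζz).self_of_nhds, zero_mul, curl_eq_zero (hηF e ζ hζ hζz), h1]
      simp [wedge_zero_right]
    · have hbd : ∀ p, DifferentiableAt ℝ (fun ζ => b p (e.symm ζ)) ζ := fun p =>
        (contDiffAt_comp_symm (hb p) he hζ).differentiableAt (by simp)
      have h1 : fderiv ℝ (fun ζ => η (e.symm ζ)) ζ =
          -∑ p, fderiv ℝ (fun ζ => b p (e.symm ζ)) ζ := by
        simp only [hη]
        rw [fderiv_const_sub, fderiv_fun_sum fun p _ => hbd p]
      rw [curl_smul ((contDiffAt_comp_symm hηs he hζ).differentiableAt (by simp))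
        ((hF1 e he ζ hζ hζz).differentiableAt one_ne_zero), h1, wedge_neg_left, wedge_sum_left]
      ring
  obtain ⟨k, e, A, hA⟩ := exists_isDissection S
  -- Stokes' theorem for the form `η F`
  have hstokes : ∑ i, ∫ ζ in A i, η ((e i).symm ζ) * curl (F (e i)) ζ 1 I ≤ -T₀ := by
    have h1 : ∀ i, ∫ ζ in A i, η ((e i).symm ζ) * curl (F (e i)) ζ 1 I =
        (∫ ζ in A i, curl (fun ζ => η ((e i).symm ζ) • F (e i) ζ) ζ 1 I) +
          ∑ p, ∫ ζ in A i, wedge (fderiv ℝ (fun ζ => b p ((e i).symm ζ)) ζ) (F (e i) ζ) := by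
      intro i
      rw [setIntegral_congr_fun (hA.measurableSet i) fun ζ hζ =>
        hleib (e i) (hA.chart i) ζ (hA.subset_target i hζ),
        integral_add (hA.integrableOn (hηF1.continuousOn_curl (hA.chart i)))
          (integrable_finsetSum _ fun p _ => hA.integrableOn (hbc p (e i) (hA.chart i))),
        integral_finsetSum _ fun p _ => hA.integrableOn (hbc p (e i) (hA.chart i))]
    rw [Finset.sum_congr rfl fun i _ => h1 i, Finset.sum_add_distrib,
      hA.sum_integral_curl (hF.smul η) hηF1, zero_add, Finset.sum_comm]
    calc ∑ p, ∑ i, ∫ ζ in A i, wedge (fderiv ℝ (fun ζ => b p ((e i).symm ζ)) ζ) (F (e i) ζ)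
        ≤ ∑ p : z, -T₀ := Finset.sum_le_sum fun p _ => hbW p k e A hA
      _ ≤ -T₀ := by
        have h2 : (1 : ℝ) ≤ Fintype.card z := by
          have h3 : 0 < Fintype.card z := Fintype.card_pos_iff.2 hne.to_subtype
          exact_mod_cast h3
        rw [Finset.sum_const, nsmul_eq_mul, Finset.card_univ]
        nlinarith
  -- comparison with the energy
  have hint : ∀ i, IntegrableOn (fun ζ => -4 * (η ((e i).symm ζ) * curl (F (e i)) ζ 1 I)) (A i) := by
    intro i
    refine (hA.integrableOn (f := fun ζ => η ((e i).symm ζ) * curl (F (e i)) ζ 1 I) ?_).const_mul _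
    exact ((hηF1.continuousOn_curl (hA.chart i)).add
      (continuousOn_finsetSum _ fun p _ => hbc p (e i) (hA.chart i))).congr
        (hleib (e i) (hA.chart i))
  have hpt : ∀ i, ∀ ζ ∈ A i, ENNReal.ofReal (-4 * (η ((e i).symm ζ) * curl (F (e i)) ζ 1 I)) ≤
      normSqInChart J u ν (e i) ζ := by
    intro i ζ hζ
    refine le_trans (ENNReal.ofReal_le_ofReal ?_) (ofReal_energyDensity_le J u ν (e i) ζ)
    have hE := energyDensity_nonneg J u ν (e i).symm ζ
    have hζt := hA.subset_target i hζ
    by_cases hζz : (e i).symm ζ ∈ z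
    · rw [(hηz _ hζz).self_of_nhds]
      simpa using hE
    · have h1 := (energyDensity_bounds J (ν := ν) (P := (e i).symm) (ζ := ζ)
        (((hA.chart i).contMDiffAt_symm hζt).mdifferentiableAt (by simp))
        ((hu _ hζz).mdifferentiableAt (by simp))
        (ContMDiffAt.comp (g := fun q => (u q).2) (f := (e i).symm) ζ (hw _ hζz)
          (((hA.chart i).contMDiffAt_symm_real hζt).of_le ENat.LEInfty.out)) (hν _ hζz)).1
      rw [← curl_congr (curveForm_eventuallyEq (w := fun q => (u q).2) α.form hzc hζt hζz) 1 I] at h1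
      have h2 := hη0 ((e i).symm ζ)
      have h3 := hη1 ((e i).symm ζ)
      calc -4 * (η ((e i).symm ζ) * curl (F (e i)) ζ 1 I)
          = η ((e i).symm ζ) * (-4 * curl (F (e i)) ζ 1 I) := by ring
        _ ≤ η ((e i).symm ζ) * energyDensity J u ν (e i).symm ζ :=
          mul_le_mul_of_nonneg_left h1 h2
        _ ≤ energyDensity J u ν (e i).symm ζ := mul_le_of_le_one_left hE h3
  calc ENNReal.ofReal (4 * T₀)
      ≤ ENNReal.ofReal (∑ i, ∫ ζ in A i, -4 * (η ((e i).symm ζ) * curl (F (e i)) ζ 1 I)) := by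
        refine ENNReal.ofReal_le_ofReal ?_
        simp only [integral_const_mul]
        rw [← Finset.mul_sum]
        linarith
    _ ≤ ENNReal.ofReal (∑ i, ∫ ζ in A i,
          max (-4 * (η ((e i).symm ζ) * curl (F (e i)) ζ 1 I)) 0) :=
        ENNReal.ofReal_le_ofReal (Finset.sum_le_sum fun i _ =>
          integral_mono (hint i) (hint i).pos_part fun ζ => le_max_left _ _)
    _ = ∑ i, ∫⁻ ζ in A i, ENNReal.ofReal (-4 * (η ((e i).symm ζ) * curl (F (e i)) ζ 1 I)) := by
        have hm : ∀ i ∈ Finset.univ, 0 ≤ ∫ ζ in A i,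
            max (-4 * (η ((e i).symm ζ) * curl (F (e i)) ζ 1 I)) 0 := fun i _ =>
          integral_nonneg fun ζ => le_max_right _ _
        rw [ENNReal.ofReal_sum_of_nonneg hm]
        refine Finset.sum_congr rfl fun i _ => ?_
        rw [ofReal_integral_eq_lintegral_ofReal (hint i).pos_part
          (Eventually.of_forall fun ζ => le_max_right _ _)]
        simp
    _ ≤ ∑ i, ∫⁻ ζ in A i, normSqInChart J u ν (e i) ζ :=
        Finset.sum_le_sum fun i _ => setLIntegral_mono' (hA.measurableSet i) (hpt i)
    _ ≤ l2Norm J u ν ^ 2 := lintegral_energyDensity_le J u ν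
        (fun i => ⟨hA.chart i, hA.measurableSet i, hA.subset_target i⟩) hA.disjoint

end Final

end SymplectizationCurve

open SymplectizationCurve in
theorem mainTheorem3 {n : ℕ} {M : Type*} [TopologicalSpace M] [ChartedSpace (Model n) M]
    [IsManifold 𝓘(ℝ, Model n) ∞ M] [T2Space M] [SecondCountableTopology M]
    (α : ContactForm n M) (J : α.CompatibleStructure)
    (T₀ : ℝ) (hT₀ : 0 < T₀) (hT₀_lt : ∀ (γ : ℝ → M) (T : ℝ), α.IsClosedOrbit γ T → T₀ < T)
    {S : Type*} [TopologicalSpace S] [ChartedSpace ℂ S] [IsManifold 𝓘(ℂ, ℂ) ω S]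
    [T2Space S] [CompactSpace S] [ConnectedSpace S]
    (x z : Set S) (hx : x.Finite) (hz : z.Finite) (hxz : Disjoint x z) (hne : (x ∪ z).Nonempty)
    (u : S → ℝ × M)
    (hu : ContMDiffOn 𝓘(ℝ, ℂ) (𝓘(ℝ, ℝ).prod 𝓘(ℝ, Model n)) ∞ u (x ∪ z)ᶜ)
    (hux : ∀ p ∈ x, IsPositivePuncture α u p) (huz : ∀ p ∈ z, IsNegativePuncture α u p)
    (ν : (p : S) → TangentSpace 𝓘(ℝ, ℂ) p →L[ℝ] SymplTangent (n := n) (u p))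
    (hν : ∀ p ∈ (x ∪ z)ᶜ, differential u p +
      ((J.symplJ (u p)).comp (differential u p)).comp (complexStructure p) = ν p)
    (hν_norm : l2Norm J u ν < ENNReal.ofReal (2 * Real.sqrt T₀)) :
    x.Nonempty := by
  by_contra hx0
  obtain rfl : x = ∅ := not_nonempty_iff_eq_empty.1 hx0
  rw [empty_union] at hne hu hν
  have hfin : l2Norm J u ν ≠ ⊤ := (hν_norm.trans ENNReal.ofReal_lt_top).ne
  have h1 := le_l2Norm_sq J hT₀ hT₀_lt hz hne
    (fun q hq => (hu q hq).contMDiffAt (hz.isClosed.isOpen_compl.mem_nhds hq)) huz hν hfin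
  have h2 : l2Norm J u ν ^ 2 < ENNReal.ofReal (2 * Real.sqrt T₀) ^ 2 :=
    ENNReal.pow_lt_pow_left two_ne_zero hν_norm
  rw [← ENNReal.ofReal_pow (by positivity), mul_pow, Real.sq_sqrt hT₀.le,
    show (2 : ℝ) ^ 2 = 4 by norm_num] at h2
  exact absurd h1 (not_le.2 h2)
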